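/- **Theorem (posterior ratio, continuous parent and discrete child).** Let $\mu_1,\beta\in\mathbb R$, $\sigma_1>0$, and let $X_1\sim\mathcal N(\mu_1,\sigma_1^2)$ and $X_2\mid X_1=x_1\sim\mathrm{Bernoulli}\left(\frac{e^{\beta(x_1-\mu_1)}}{1+e^{\beta(x_1-\mu_1)}}\right)$. The data $\boldsymbol X$ are $N$ independent samples of $(X_1,X_2)$. Let $\mathcal G_0$ be the graph on the nodes $X_1,X_2$ without edges and $\mathcal G_1$ the graph $X_1\to X_2$. Fix a prior that gives positive weight $P(\mathcal G)$ to each of the three directed acyclic graphs on the two nodes, and let $P(\mathcal G\mid\boldsymbol X)\propto P(\boldsymbol X\mid\mathcal G)P(\mathcal G)$ be the posterior, where $P(\boldsymbol X\mid\mathcal G)$ is the marginal likelihood (likelihood integrated against the parameter prior). *RAG.* Treat $(X_1,X_2)$ as bivariate normal with mean $\boldsymbol\mu$ and precision matrix $\boldsymbol W$ (BGe score), with the prior $\boldsymbol W\sim\mathcal W_2(\boldsymbol T^{-1},\alpha_w)$, $\boldsymbol\mu\mid\boldsymbol W\sim\mathcal N(0,(\alpha_\mu\boldsymbol W)^{-1})$,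 $\boldsymbol T=tI_2$, $t>0$, $\alpha_\mu>0$, $\alpha_w>3$; under $\mathcal G_0$ the (mean, variance) pairs of $X_1$ and of $X_2$ are independent a priori, each with its marginal prior from this model. Put $r_{10}=\frac1N\,\mathbb E\left[\log\frac{P(\mathcal G_1\mid\boldsymbol X)}{P(\mathcal G_0\mid\boldsymbol X)}\right]$. The logarithm is integrable for every $N$, and $$\lim_{N\to\infty}r_{10}=\frac12\log\left(\frac{\Sigma_{11}\Sigma_{22}}{\Sigma_{11}\Sigma_{22}-\Sigma_{12}^2}\right),$$ where $\Sigma$ is the covariance matrix of $(X_1,X_2)$, $\Sigma_{11}\Sigma_{22}-\Sigma_{12}^2>0$, and $$\Sigma_{11}=\sigma_1^2,\quad \Sigma_{12}=\int_{-\infty}^{\infty}\frac{s\sigma_1}{\sqrt{2\pi}}\,\frac{e^{\beta\sigma_1 s}}{1+e^{\beta\sigma_1 s}}\,e^{-s^2/2}\,ds,\quad \Sigma_{22}=\mathbb E(X_2)-(\mathbb E(X_2))^2,\quad \mathbb E(X_2)=\int_{-\infty}^{\infty}\frac{1}{\sqrt{2\pi}}\,\frac{e^{\beta\sigma_1 s}}{1+e^{\beta\sigma_1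 s}}\,e^{-s^2/2}\,ds .$$ *DISC.* Let $X_1'=1$ if $X_1\ge m$ and $X_1'=0$ otherwise, where $m$ is the median of the law of $X_1$, let $X_2'=X_2$, and let $\boldsymbol X'$ be the discretized data. Use the BDe score: the probabilities of the cells $(1,1),(1,0),(0,1),(0,0)$ of $(X_1',X_2')$ have a Dirichlet prior with parameters $\alpha_1,\dots,\alpha_4>0$; under $\mathcal G_0$ the parameters $P(X_1'=1)$ and $P(X_2'=1)$ are independent a priori, each with its marginal prior from this model. Put $\tilde r_{10}=\frac1N\sum_{\boldsymbol x}\log\left(\frac{P(\mathcal G_1\mid\boldsymbol X'=\boldsymbol x)}{P(\mathcal G_0\mid\boldsymbol X'=\boldsymbol x)}\right)P(\boldsymbol X'=\boldsymbol x)$, the sum over all binary data sets of $N$ samples. Then $$\lim_{N\to\infty}\tilde r_{10}=\log 4+2\tilde p_{11}\log\tilde p_{11}+(1-2\tilde p_{11})\log\left(\tfrac12-\tilde p_{11}\right),$$ where $$\tilde p_{11}=P(X_1'=1,X_2'=1)=\int_0^\infty\frac{1}{\sqrt{2\pi}}\,e^{-x^2/2}\,\frac{e^{\beta\sigma_1x}}{1+e^{\beta\sigma_1x}}\,dx\in\left(0,\tfrac12\right).$$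 -/

import Mathlib

open MeasureTheory ProbabilityTheory Real Filter Topology

noncomputable section

namespace HybridBN

/-! ### Structures on two nodes and the posterior over them -/

/-- The directed acyclic graphs on the two nodes `X₁`, `X₂`: no edge (`𝒢₀`), the edge
`X₁ → X₂` (`𝒢₁`), and the edge `X₂ → X₁`. -/
inductive TwoNodeDAG : Type
  | empty : TwoNodeDAG
  | forward : TwoNodeDAG
  | backward : TwoNodeDAG

/-- Bayes' rule: the posterior probability `P(𝒢 ∣ X)`, given the structure prior `P(𝒢)` and the
marginal likelihood `P(X ∣ 𝒢)` of the data. -/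
def posterior (structPrior : TwoNodeDAG → ℝ) (marginal : TwoNodeDAG → ℝ) (G : TwoNodeDAG) : ℝ :=
  structPrior G * marginal G /
    (structPrior TwoNodeDAG.empty * marginal TwoNodeDAG.empty
      + structPrior TwoNodeDAG.forward * marginal TwoNodeDAG.forward
      + structPrior TwoNodeDAG.backward * marginal TwoNodeDAG.backward)

/-- `log (P(𝒢₁ ∣ X) / P(𝒢₀ ∣ X))`. -/
def logPosteriorRatio (structPrior : TwoNodeDAG → ℝ) (marginal : TwoNodeDAG → ℝ) : ℝ :=
  log (posterior structPrior marginal TwoNodeDAG.forward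
    / posterior structPrior marginal TwoNodeDAG.empty)

/-! ### The BGe score: Gaussian likelihood with a normal-Wishart prior -/

/-- Density at `x` of the `n`-dimensional normal law with mean `m` and precision matrix `W`. -/
def normalPrecisionPDF {n : ℕ} (m : Fin n → ℝ) (W : Matrix (Fin n) (Fin n) ℝ)
    (x : Fin n → ℝ) : ℝ :=
  W.det ^ (1 / 2 : ℝ) / (2 * π) ^ ((n : ℝ) / 2)
    * exp (-(1 / 2) * ((x - m) ⬝ᵥ W.mulVec (x - m)))

/-- The multivariate gamma function `Γₙ(a)`. -/
def multivariateGamma (n : ℕ) (a : ℝ) : ℝ :=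
  π ^ ((n : ℝ) * ((n : ℝ) - 1) / 4) * ∏ j ∈ Finset.Icc 1 n, Gamma (a + (1 - (j : ℝ)) / 2)

open Classical in
/-- Density at `W` of the Wishart law `𝒲ₙ(T⁻¹, α_w)`, with respect to Lebesgue measure on the
entries on and above the diagonal of the symmetric matrix `W`. -/
def wishartPDF {n : ℕ} (T : Matrix (Fin n) (Fin n) ℝ) (αw : ℝ)
    (W : Matrix (Fin n) (Fin n) ℝ) : ℝ :=
  if W.PosDef then
    W.det ^ ((αw - (n : ℝ) - 1) / 2)
      / (2 ^ (αw * (n : ℝ) / 2) * multivariateGamma n (αw / 2) / T.det ^ (αw / 2))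
      * exp (-(1 / 2) * (T * W).trace)
  else 0

/-- The symmetric `2 × 2` matrix with entries `W₁₁, W₁₂, W₂₂` on and above the diagonal. -/
def symMatrix (w : ℝ × ℝ × ℝ) : Matrix (Fin 2) (Fin 2) ℝ :=
  !![w.1, w.2.1; w.2.1, w.2.2]

/-- The normal-Wishart prior on `(μ, W)` for two nodes, with `ν = (0, 0)` and `T = t I`:
`W ∼ 𝒲₂(T⁻¹, α_w)` and `μ ∣ W` is normal with mean `ν` and precision matrix `α_μ W`.
The matrix `W` is recorded by `(W₁₁, W₁₂, W₂₂)`. -/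
def bgePrior (t αμ αw : ℝ) : Measure ((Fin 2 → ℝ) × (ℝ × ℝ × ℝ)) :=
  volume.withDensity fun p =>
    ENNReal.ofReal
      (wishartPDF (t • (1 : Matrix (Fin 2) (Fin 2) ℝ)) αw (symMatrix p.2)
        * normalPrecisionPDF 0 (αμ • symMatrix p.2) p.1)

/-- The mean and the variance of the variable `X_i` when `(X₁, X₂)` is bivariate normal with mean
`μ` and precision matrix `W`. -/
def nodeMeanVar (i : Fin 2) (p : (Fin 2 → ℝ) × (ℝ × ℝ × ℝ)) : ℝ × ℝ :=
  (p.1 i, (symMatrix p.2)⁻¹ i i)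

/-- The prior on the parameters of the graph without edges, i.e. on the means and variances of
the two variables: by parameter modularity each variable keeps the prior which it has in the full
model, and by global parameter independence the two are independent. -/
def bgePriorEmpty (t αμ αw : ℝ) : Measure ((ℝ × ℝ) × (ℝ × ℝ)) :=
  ((bgePrior t αμ αw).map (nodeMeanVar 0)).prod ((bgePrior t αμ αw).map (nodeMeanVar 1))

/-- BGe marginal likelihood `P(X ∣ 𝒢)` of `N` samples. Both graphs with an edge are complete:
their parameters amount to `(μ, W)` and they place no constraint on the bivariate normal law. -/
def bgeMarginal (t αμ αw : ℝ) {N : ℕ} (x : Fin N → Fin 2 → ℝ) : TwoNodeDAG → ℝ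
  | TwoNodeDAG.empty =>
      ∫ q, ∏ k, (gaussianPDFReal q.1.1 q.1.2.toNNReal (x k 0)
        * gaussianPDFReal q.2.1 q.2.2.toNNReal (x k 1)) ∂(bgePriorEmpty t αμ αw)
  | TwoNodeDAG.forward =>
      ∫ p, ∏ k, normalPrecisionPDF p.1 (symMatrix p.2) (x k) ∂(bgePrior t αμ αw)
  | TwoNodeDAG.backward =>
      ∫ p, ∏ k, normalPrecisionPDF p.1 (symMatrix p.2) (x k) ∂(bgePrior t αμ αw)

/-- `r₁₀`: `1/N` times the expected log posterior ratio under the BGe score, for `N` independent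
samples from the law `P` of `(X₁, X₂)`. -/
def rBGe (structPrior : TwoNodeDAG → ℝ) (t αμ αw : ℝ) (P : Measure (Fin 2 → ℝ)) (N : ℕ) : ℝ :=
  1 / (N : ℝ) * ∫ x : Fin N → Fin 2 → ℝ,
    logPosteriorRatio structPrior (bgeMarginal t αμ αw x) ∂(Measure.pi fun _ : Fin N => P)

/-! ### The BDe score: binary variables with a Dirichlet prior -/

/-- The cell probabilities of a pair of binary variables, from the parameters
`(θ₁₂, θ_{1\bar 2}, θ_{\bar 1 2})`, the probabilities of `(1,1)`, `(1,0)` and `(0,1)`. -/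
def cellProb (θ : ℝ × ℝ × ℝ) : Bool × Bool → ℝ
  | (true, true) => θ.1
  | (true, false) => θ.2.1
  | (false, true) => θ.2.2
  | (false, false) => 1 - θ.1 - θ.2.1 - θ.2.2

open Classical in
/-- Density of the Dirichlet law with parameters `α₁, …, α₄`, attached to the cells `(1,1)`,
`(1,0)`, `(0,1)`, `(0,0)` in this order. -/
def dirichletPDF (α : Fin 4 → ℝ) (θ : ℝ × ℝ × ℝ) : ℝ :=
  if ∀ c, 0 < cellProb θ c then
    Gamma (∑ i, α i) / (∏ i, Gamma (α i))
      * (cellProb θ (true, true) ^ (α 0 - 1) * cellProb θ (true, false) ^ (α 1 - 1)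
        * cellProb θ (false, true) ^ (α 2 - 1) * cellProb θ (false, false) ^ (α 3 - 1))
  else 0

/-- The Dirichlet prior. -/
def bdePrior (α : Fin 4 → ℝ) : Measure (ℝ × ℝ × ℝ) :=
  volume.withDensity fun θ => ENNReal.ofReal (dirichletPDF α θ)

/-- `θ₁ = P(X₁ = 1)`. -/
def successProb₁ (θ : ℝ × ℝ × ℝ) : ℝ := cellProb θ (true, true) + cellProb θ (true, false)

/-- `θ₂ = P(X₂ = 1)`. -/
def successProb₂ (θ : ℝ × ℝ × ℝ) : ℝ := cellProb θ (true, true) + cellProb θ (false, true)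

/-- The prior on `(θ₁, θ₂)` for the graph without edges: by parameter modularity each parameter
keeps the prior which it has in the full model, and by global parameter independence the two are
independent. -/
def bdePriorEmpty (α : Fin 4 → ℝ) : Measure (ℝ × ℝ) :=
  ((bdePrior α).map successProb₁).prod ((bdePrior α).map successProb₂)

/-- BDe marginal likelihood `P(X' ∣ 𝒢)` of `N` binary samples. Both graphs with an edge are
complete: their parameters amount to the cell probabilities. -/
def bdeMarginal (α : Fin 4 → ℝ) {N : ℕ} (x : Fin N → Bool × Bool) : TwoNodeDAG → ℝ
  | TwoNodeDAG.empty =>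
      ∫ q, ∏ k, ((if (x k).1 then q.1 else 1 - q.1) * (if (x k).2 then q.2 else 1 - q.2))
        ∂(bdePriorEmpty α)
  | TwoNodeDAG.forward => ∫ θ, ∏ k, cellProb θ (x k) ∂(bdePrior α)
  | TwoNodeDAG.backward => ∫ θ, ∏ k, cellProb θ (x k) ∂(bdePrior α)

/-- `r̃₁₀`: `1/N` times the expected log posterior ratio under the BDe score, for `N` independent
samples from the law `P` of the binary pair `(X₁', X₂')`. -/
def rBDe (structPrior : TwoNodeDAG → ℝ) (α : Fin 4 → ℝ) (P : Measure (Bool × Bool)) (N : ℕ) : ℝ :=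
  1 / (N : ℝ) * ∑ x : Fin N → Bool × Bool,
    logPosteriorRatio structPrior (bdeMarginal α x) * (Measure.pi fun _ : Fin N => P).real {x}

/-! ### The continuous-to-discrete data generating mechanism -/

/-- The logistic function `exp u / (1 + exp u)`, as a point of the unit interval. -/
def logistic (u : ℝ) : unitInterval :=
  ⟨exp u / (1 + exp u), by positivity, by
    rw [div_le_one (by positivity)]; linarith [exp_pos u]⟩

theorem measurable_logistic : Measurable logistic := by
  refine Measurable.subtype_mk ?_
  fun_prop

/-- The conditional law of `X₂` given `X₁ = x`: Bernoulli with success probability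
`logistic (β (x - μ₁))`. -/
def scdKernel (μ₁ β : ℝ) : Kernel ℝ Bool where
  toFun x := bernoulliMeasure true false (logistic (β * (x - μ₁)))
  measurable' := by
    have hp : Measurable fun x : ℝ => logistic (β * (x - μ₁)) :=
      measurable_logistic.comp (by fun_prop)
    refine Measure.measurable_of_measurable_coe _ fun s hs => ?_
    classical
    simp only [bernoulliMeasure_apply _ hs]
    have h0 : Measurable unitInterval.toNNReal := by
      refine Measurable.subtype_mk ?_
      fun_prop
    have h1 : Measurable fun x : ℝ =>
        ((unitInterval.toNNReal (logistic (β * (x - μ₁))) : NNReal) : ENNReal) :=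
      (h0.comp hp).coe_nnreal_ennreal
    have h2 : Measurable fun x : ℝ =>
        ((unitInterval.toNNReal (unitInterval.symm (logistic (β * (x - μ₁)))) : NNReal)
          : ENNReal) :=
      (h0.comp (unitInterval.continuous_symm.measurable.comp hp)).coe_nnreal_ennreal
    split_ifs
    · exact measurable_const
    · exact h1
    · exact h2
    · exact measurable_const

instance isMarkovKernel_scdKernel (μ₁ β : ℝ) : IsMarkovKernel (scdKernel μ₁ β) :=
  ⟨fun x => inferInstanceAs
    (IsProbabilityMeasure (bernoulliMeasure true false (logistic (β * (x - μ₁)))))⟩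

/-- The joint law of `(X₁, X₂)`: `X₁ ∼ 𝒩(μ₁, σ₁²)` and `X₂ ∣ X₁` as above. -/
def scdLaw (μ₁ σ₁ β : ℝ) : Measure (ℝ × Bool) :=
  gaussianReal μ₁ (σ₁ ^ 2).toNNReal ⊗ₘ scdKernel μ₁ β

/-- The pair `(X₁, X₂)` treated as two real variables, with `X₂ ∈ {0, 1}`. -/
def asReal (z : ℝ × Bool) : Fin 2 → ℝ := ![z.1, if z.2 then 1 else 0]

/-- The pair after discretization of `X₁` at the cutting point `m`; `X₂` is binary already. -/
def discretize (m : ℝ) (z : ℝ × Bool) : Bool × Bool := (decide (m ≤ z.1), z.2)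

/-- `m` is a median of the law `P`. -/
def IsMedian (P : Measure ℝ) (m : ℝ) : Prop :=
  1 / 2 ≤ P.real (Set.Iic m) ∧ 1 / 2 ≤ P.real (Set.Ici m)

/-- The covariance matrix of a law on `ℝ²`. -/
def covMatrix (P : Measure (Fin 2 → ℝ)) : Matrix (Fin 2) (Fin 2) ℝ :=
  Matrix.of fun i j => covariance (fun x => x i) (fun x => x j) P

end HybridBN

end

namespace HybridBN

/-! The normalizing sum of the posterior cancels in the ratio and the structure prior contributes
only a constant, so both limits concern the expected log Bayes factor of the complete model against
independence, divided by `N`. Conjugacy makes the marginal likelihoods explicit. To leading order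
the logarithm is `N` times the mutual information of the fitted family, evaluated at sample means;
by the law of large numbers these tend to the population moments.

BGe. In the coordinates `a`, `b`, `s = c - b ^ 2 / a` (Schur complement of the precision matrix) the
normal-Wishart integral splits into one-dimensional Gaussian and gamma integrals
(`lintegral_normalWishart`). With `T₁, T₂` the regularized scatters of the two variables and `D` the
determinant of the regularized scatter matrix, `bge_logPosteriorRatio` gives a constant, plus a log
ratio of Gamma values half a unit apart, plus `(N + αw - 1) / 2 * (log T₁ + log T₂) - (N + αw) / 2 *
log D`. The Gamma ratio is `O(log N)` by log-convexity, and the rest divided by `N` tends to `1/2 *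
log (Σ₁₁ Σ₂₂ / det Σ)`, the mutual information of a bivariate normal law with covariance `Σ`.

BDe. Dirichlet integrals are products of Beta functions, so the ratio is a combination of `log
Gamma` at cell and margin counts. A Stirling bound with error `O(log n)`
(`exists_abs_log_Gamma_add_natCast_le`) turns it into `N` times the empirical mutual information,
uniformly over the data sets.

Expectations. Almost sure convergence is not enough, as the logarithms are unbounded in the BGe
case. `tendsto_integral_sampleMean` needs only square integrable features and growth at most linear
in the sample means plus `log N`: away from the limit point the Chebyshev bound `O(1/N)` beats `log
N`.

The data law. `covChild_sq_lt` gives nondegeneracy of `Σ`. The median is `μ₁`, and the reflection of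
the standardized parent together with `logistic (-u) = 1 - logistic u` makes the two-by-two table
symmetric with uniform margins, hence the closed form in `p₁₁`. -/

/-! ### Integrals of positive-part powers -/

/-- The power `x ^ p` cut off to the positive half line. -/
noncomputable def posPow (x p : ℝ) : ℝ := if 0 < x then x ^ p else 0

theorem posPow_of_pos {x : ℝ} (hx : 0 < x) (p : ℝ) : posPow x p = x ^ p := if_pos hx

theorem posPow_of_nonpos {x : ℝ} (hx : x ≤ 0) (p : ℝ) : posPow x p = 0 := if_neg hx.not_gt

theorem posPow_nonneg (x p : ℝ) : 0 ≤ posPow x p := by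
  unfold posPow; split_ifs <;> positivity

theorem posPow_mul (x p q : ℝ) : posPow x p * posPow x q = posPow x (p + q) := by
  unfold posPow
  split_ifs with h
  · rw [rpow_add h]
  · simp

theorem posPow_mul_mul {u v : ℝ} (hu : 0 < u) (p : ℝ) :
    posPow (u * v) p = u ^ p * posPow v p := by
  rcases lt_or_ge 0 v with hv | hv
  · rw [posPow_of_pos hv, posPow_of_pos (mul_pos hu hv), mul_rpow hu.le hv.le]
  · rw [posPow_of_nonpos hv, posPow_of_nonpos (mul_nonpos_of_nonneg_of_nonpos hu.le hv), mul_zero]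

@[fun_prop]
theorem measurable_posPow (p : ℝ) : Measurable fun x => posPow x p :=
  Measurable.ite measurableSet_Ioi (by fun_prop) measurable_const

theorem lintegral_ofReal_const_mul {X : Type*} [MeasurableSpace X] {μ : Measure X} {c I : ℝ}
    (hc : 0 ≤ c) {f : X → ℝ} (h : ∫⁻ x, ENNReal.ofReal (f x) ∂μ = ENNReal.ofReal I) :
    ∫⁻ x, ENNReal.ofReal (c * f x) ∂μ = ENNReal.ofReal (c * I) := by
  simp_rw [ENNReal.ofReal_mul hc]
  rw [lintegral_const_mul' _ _ ENNReal.ofReal_ne_top, h]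

theorem lintegral_gauss {A : ℝ} (hA : 0 < A) (h : ℝ) :
    ∫⁻ u, ENNReal.ofReal (exp (-(1 / 2) * (A * (u - h) ^ 2))) = ENNReal.ofReal √(2 * π / A) := by
  rw [lintegral_sub_right_eq_self (fun u => ENNReal.ofReal (exp (-(1 / 2) * (A * u ^ 2)))) h]
  have e : ∀ u : ℝ, exp (-(1 / 2) * (A * u ^ 2)) = exp (-(A / 2) * u ^ 2) := fun u => by
    congr 1; ring
  simp_rw [e]
  rw [← ofReal_integral_eq_lintegral_ofReal (integrable_exp_neg_mul_sq (by positivity))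
    (ae_of_all _ fun _ => (exp_pos _).le), integral_gaussian]
  congr 2
  field_simp

theorem lintegral_gauss_linear {A : ℝ} (hA : 0 < A) (B : ℝ) :
    ∫⁻ b, ENNReal.ofReal (exp (-(1 / 2) * (A * b ^ 2 + 2 * B * b)))
      = ENNReal.ofReal (exp (B ^ 2 / (2 * A)) * √(2 * π / A)) := by
  rw [← lintegral_ofReal_const_mul (exp_pos _).le (lintegral_gauss hA (-(B / A)))]
  congr 1 with b
  rw [← exp_add]
  congr 2
  field_simp
  ring

theorem lintegral_posPow_mul_exp {ν r : ℝ} (hν : 0 < ν) (hr : 0 < r) :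
    ∫⁻ s, ENNReal.ofReal (posPow s (ν - 1) * exp (-(r * s)))
      = ENNReal.ofReal (Gamma ν * (1 / r) ^ ν) := by
  have hG := Gamma_pos_of_pos hν
  have hrp := rpow_pos_of_pos hr ν
  have h1 : ∫⁻ s, ENNReal.ofReal (gammaPDFReal ν r s) = ENNReal.ofReal 1 := by
    simpa [gammaPDF] using lintegral_gammaPDF_eq_one hν hr
  have h2 := lintegral_ofReal_const_mul (c := Gamma ν * (1 / r) ^ ν) (by positivity) h1
  rw [mul_one] at h2
  rw [← h2]
  refine lintegral_congr_ae ?_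
  -- The gamma density is defined by its formula on `0 ≤ s`, whereas `posPow` already vanishes at
  -- `0`; the two sides may differ at that null point.
  filter_upwards [compl_mem_ae_iff.2 (measure_singleton (0 : ℝ))] with s hs
  have hs : s ≠ 0 := hs
  congr 1
  rcases lt_or_gt_of_ne hs with h | h
  · rw [posPow_of_nonpos h.le, gammaPDFReal, if_neg h.not_ge]; simp
  · rw [posPow_of_pos h, gammaPDFReal, if_pos h.le, one_div, inv_rpow hr.le]
    field_simp

/-- Substituting `x = u * s` reduces the convolution to the Beta density. The cutoffs restrict `x`
to `(0, u)`, so for `u ≤ 0` both sides vanish and no sign hypothesis is needed. -/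
theorem lintegral_posPow_mul_posPow {a b : ℝ} (ha : 0 < a) (hb : 0 < b) (u : ℝ) :
    ∫⁻ x, ENNReal.ofReal (posPow x (a - 1) * posPow (u - x) (b - 1))
      = ENNReal.ofReal (beta a b * posPow u (a + b - 1)) := by
  rcases le_or_gt u 0 with hu | hu
  · rw [posPow_of_nonpos hu, mul_zero, ENNReal.ofReal_zero]
    refine (lintegral_congr fun x => ?_).trans lintegral_zero
    rcases le_or_gt x 0 with hx | hx
    · simp [posPow_of_nonpos hx]
    · simp [posPow_of_nonpos (show u - x ≤ 0 by linarith)]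
  have hB := beta_pos ha hb
  have h1 : ∫⁻ s, ENNReal.ofReal (betaPDFReal a b s) = ENNReal.ofReal 1 := by
    simpa [betaPDF] using lintegral_betaPDF_eq_one ha hb
  have h2 := lintegral_ofReal_const_mul (c := beta a b * u ^ (a + b - 2)) (by positivity) h1
  have key : ENNReal.ofReal |u| * ∫⁻ s, ENNReal.ofReal
        (posPow (u * s) (a - 1) * posPow (u - u * s) (b - 1))
      = ∫⁻ x, ENNReal.ofReal (posPow x (a - 1) * posPow (u - x) (b - 1)) := by
    have h3 := measurable_posPow (a - 1)
    have h4 := measurable_posPow (b - 1)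
    conv_rhs => rw [← Real.smul_map_volume_mul_left hu.ne', lintegral_smul_measure,
      lintegral_map (by fun_prop) (by fun_prop)]
    rfl
  have e : ∀ s, ENNReal.ofReal (posPow (u * s) (a - 1) * posPow (u - u * s) (b - 1))
      = ENNReal.ofReal (beta a b * u ^ (a + b - 2) * betaPDFReal a b s) := by
    intro s
    congr 1
    rw [show u - u * s = u * (1 - s) by ring, posPow_mul_mul hu, posPow_mul_mul hu, betaPDFReal,
      show a + b - 2 = (a - 1) + (b - 1) by ring, rpow_add hu]
    unfold posPow
    by_cases h0 : 0 < s <;> by_cases h3 : 0 < 1 - s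
    · rw [if_pos h0, if_pos h3, if_pos ⟨h0, by linarith⟩]; field_simp
    · rw [if_neg h3, if_neg fun h : 0 < s ∧ s < 1 => h3 (by linarith [h.2])]; simp
    · rw [if_neg h0, if_neg fun h : 0 < s ∧ s < 1 => h0 h.1]; simp
    · rw [if_neg h0, if_neg fun h : 0 < s ∧ s < 1 => h0 h.1]; simp
  simp_rw [e] at key
  rw [← key, h2, mul_one, abs_of_pos hu, ← ENNReal.ofReal_mul hu.le,
    posPow_of_pos hu, show a + b - 1 = 1 + (a + b - 2) by ring, rpow_add hu, rpow_one]
  congr 1; ring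

/-! ### The normal-Wishart integral -/

/-- With `s = c - b ^ 2 / a` each integration is elementary: `u` gives `a ^ (-1/2)`, `v` gives `s ^
(-1/2)`, `c` is a gamma integral in `s`, `b` is Gaussian with precision `T₂₂ / a` and returns `a ^
(1/2)`, and `a` is a last gamma integral. The centres `h` and `d` disappear by translation
invariance. The coefficients `T₂₂` and `R` are kept apart because data on the second node alone
change only `R`. -/
theorem lintegral_normalWishart {p q κ₁ κ₂ T₁₁ T₁₂ T₂₂ R : ℝ} (hp : 0 < p + 1)
    (hq : 0 < q + 1 / 2) (hκ₁ : 0 < κ₁) (hκ₂ : 0 < κ₂) (hT : 0 < T₂₂)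
    (hdet : 0 < T₁₁ * T₂₂ - T₁₂ ^ 2) (hR : 0 < R) (h : ℝ → ℝ → ℝ → ℝ) (d : ℝ) :
    ∫⁻ a : ℝ, ∫⁻ b : ℝ, ∫⁻ c : ℝ, ∫⁻ v : ℝ, ∫⁻ u : ℝ, ENNReal.ofReal
      (posPow a p * posPow (c - b ^ 2 / a) q * exp (-(1 / 2) *
        (κ₁ * a * (u - h a b v) ^ 2 + κ₂ * (c - b ^ 2 / a) * (v - d) ^ 2
          + T₁₁ * a + 2 * T₁₂ * b + T₂₂ * (b ^ 2 / a) + R * (c - b ^ 2 / a))))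
      = ENNReal.ofReal (√(2 * π / κ₁) * √(2 * π / κ₂) * √(2 * π / T₂₂)
          * (Gamma (q + 1 / 2) * (2 / R) ^ (q + 1 / 2))
          * (Gamma (p + 1) * (2 * T₂₂ / (T₁₁ * T₂₂ - T₁₂ ^ 2)) ^ (p + 1))) := by
  -- Isolates the power of the precision variable so that it can be absorbed into the exponent of
  -- `posPow`.
  have sq : ∀ {k x : ℝ}, 0 < k → 0 < x → √(2 * π / (k * x)) = √(2 * π / k) * x ^ (-(1 / 2) : ℝ) := by
    intro k x hk hx
    rw [rpow_neg hx.le, ← sqrt_eq_rpow, ← div_div, sqrt_div (by positivity), div_eq_mul_inv]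
  have step_u : ∀ a b c v : ℝ, ∫⁻ u : ℝ, ENNReal.ofReal
      (posPow a p * posPow (c - b ^ 2 / a) q * exp (-(1 / 2) *
        (κ₁ * a * (u - h a b v) ^ 2 + κ₂ * (c - b ^ 2 / a) * (v - d) ^ 2
          + T₁₁ * a + 2 * T₁₂ * b + T₂₂ * (b ^ 2 / a) + R * (c - b ^ 2 / a))))
      = ENNReal.ofReal (√(2 * π / κ₁) * posPow a (p - 1 / 2) * posPow (c - b ^ 2 / a) q
        * exp (-(1 / 2) * (T₁₁ * a + 2 * T₁₂ * b + T₂₂ * (b ^ 2 / a) + R * (c - b ^ 2 / a)))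
        * exp (-(1 / 2) * (κ₂ * (c - b ^ 2 / a) * (v - d) ^ 2))) := by
    intro a b c v
    rcases le_or_gt a 0 with ha | ha
    · simp [posPow_of_nonpos ha]
    have h1 := lintegral_ofReal_const_mul (c := posPow a p * posPow (c - b ^ 2 / a) q
      * exp (-(1 / 2) * (T₁₁ * a + 2 * T₁₂ * b + T₂₂ * (b ^ 2 / a) + R * (c - b ^ 2 / a)))
        * exp (-(1 / 2) * (κ₂ * (c - b ^ 2 / a) * (v - d) ^ 2)))
      (mul_nonneg (mul_nonneg (mul_nonneg (posPow_nonneg _ _) (posPow_nonneg _ _))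
        (exp_pos _).le) (exp_pos _).le)
      (lintegral_gauss (mul_pos hκ₁ ha) (h a b v))
    refine Eq.trans (lintegral_congr fun u => ?_) (h1.trans ?_)
    · congr 1
      simp only [mul_assoc, ← exp_add]
      congr 3; ring
    · congr 1
      rw [sq hκ₁ ha, posPow_of_pos ha, posPow_of_pos ha, sub_eq_add_neg p, rpow_add ha]
      ring
  simp_rw [step_u]
  have step_v : ∀ a b c : ℝ, ∫⁻ v : ℝ, ENNReal.ofReal
      (√(2 * π / κ₁) * posPow a (p - 1 / 2) * posPow (c - b ^ 2 / a) q
        * exp (-(1 / 2) * (T₁₁ * a + 2 * T₁₂ * b + T₂₂ * (b ^ 2 / a) + R * (c - b ^ 2 / a)))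
        * exp (-(1 / 2) * (κ₂ * (c - b ^ 2 / a) * (v - d) ^ 2)))
      = ENNReal.ofReal (√(2 * π / κ₁) * √(2 * π / κ₂) * posPow a (p - 1 / 2)
        * exp (-(1 / 2) * (T₁₁ * a)) * exp (-(1 / 2) * (T₂₂ / a * b ^ 2 + 2 * T₁₂ * b))
        * (posPow (c - b ^ 2 / a) (q + 1 / 2 - 1) * exp (-(R / 2 * (c - b ^ 2 / a))))) := by
    intro a b c
    rcases le_or_gt (c - b ^ 2 / a) 0 with hs | hs
    · simp [posPow_of_nonpos hs]
    have h1 := lintegral_ofReal_const_mul (c := √(2 * π / κ₁) * posPow a (p - 1 / 2)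
        * posPow (c - b ^ 2 / a) q
        * exp (-(1 / 2) * (T₁₁ * a + 2 * T₁₂ * b + T₂₂ * (b ^ 2 / a) + R * (c - b ^ 2 / a))))
      (mul_nonneg (mul_nonneg (mul_nonneg (sqrt_nonneg _) (posPow_nonneg _ _))
        (posPow_nonneg _ _)) (exp_pos _).le)
      (lintegral_gauss (mul_pos hκ₂ hs) d)
    rw [h1]
    congr 1
    rw [sq hκ₂ hs, posPow_of_pos hs, posPow_of_pos hs,
      show q + 1 / 2 - 1 = q + -(1 / 2) by ring, rpow_add hs,
      show -(1 / 2) * (T₁₁ * a + 2 * T₁₂ * b + T₂₂ * (b ^ 2 / a) + R * (c - b ^ 2 / a))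
        = -(1 / 2) * (T₁₁ * a) + -(1 / 2) * (T₂₂ / a * b ^ 2 + 2 * T₁₂ * b)
          + -(R / 2 * (c - b ^ 2 / a)) by ring, exp_add, exp_add]
    ring
  simp_rw [step_v]
  have hR2 : (1 : ℝ) / (R / 2) = 2 / R := by field_simp
  have step_c : ∀ a b : ℝ, ∫⁻ c : ℝ, ENNReal.ofReal
      (√(2 * π / κ₁) * √(2 * π / κ₂) * posPow a (p - 1 / 2)
        * exp (-(1 / 2) * (T₁₁ * a)) * exp (-(1 / 2) * (T₂₂ / a * b ^ 2 + 2 * T₁₂ * b))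
        * (posPow (c - b ^ 2 / a) (q + 1 / 2 - 1) * exp (-(R / 2 * (c - b ^ 2 / a)))))
      = ENNReal.ofReal (√(2 * π / κ₁) * √(2 * π / κ₂)
        * (Gamma (q + 1 / 2) * (2 / R) ^ (q + 1 / 2)) * posPow a (p - 1 / 2)
        * exp (-(1 / 2) * (T₁₁ * a)) * exp (-(1 / 2) * (T₂₂ / a * b ^ 2 + 2 * T₁₂ * b))) := by
    intro a b
    have h0 := lintegral_posPow_mul_exp hq (half_pos hR)
    rw [← lintegral_sub_right_eq_self _ (b ^ 2 / a), hR2] at h0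
    rw [lintegral_ofReal_const_mul _ h0]
    · congr 1; ring
    · have := posPow_nonneg a (p - 1 / 2)
      positivity
  simp_rw [step_c]
  have hGq := Gamma_pos_of_pos hq
  have step_b : ∀ a : ℝ, ∫⁻ b : ℝ, ENNReal.ofReal (√(2 * π / κ₁) * √(2 * π / κ₂)
        * (Gamma (q + 1 / 2) * (2 / R) ^ (q + 1 / 2)) * posPow a (p - 1 / 2)
        * exp (-(1 / 2) * (T₁₁ * a)) * exp (-(1 / 2) * (T₂₂ / a * b ^ 2 + 2 * T₁₂ * b)))
      = ENNReal.ofReal (√(2 * π / κ₁) * √(2 * π / κ₂) * √(2 * π / T₂₂)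
        * (Gamma (q + 1 / 2) * (2 / R) ^ (q + 1 / 2))
        * (posPow a (p + 1 - 1)
          * exp (-((T₁₁ * T₂₂ - T₁₂ ^ 2) / (2 * T₂₂) * a)))) := by
    intro a
    rcases le_or_gt a 0 with ha | ha
    · simp [posPow_of_nonpos ha]
    rw [lintegral_ofReal_const_mul _ (lintegral_gauss_linear (div_pos hT ha) T₁₂)]
    · congr 1
      have e1 : √(2 * π / (T₂₂ / a)) = √(2 * π / T₂₂) * a ^ (1 / 2 : ℝ) := by
        rw [← sqrt_eq_rpow, ← sqrt_mul (by positivity)]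
        congr 1; field_simp
      rw [e1, posPow_of_pos ha, posPow_of_pos ha,
        show p + 1 - 1 = (p - 1 / 2) + 1 / 2 by ring, rpow_add ha,
        show -((T₁₁ * T₂₂ - T₁₂ ^ 2) / (2 * T₂₂) * a)
          = -(1 / 2) * (T₁₁ * a) + T₁₂ ^ 2 / (2 * (T₂₂ / a)) by field_simp; ring, exp_add]
      ring
    · have := posPow_nonneg a (p - 1 / 2)
      positivity
  simp_rw [step_b]
  rw [lintegral_ofReal_const_mul (by positivity)
    (lintegral_posPow_mul_exp hp (div_pos hdet (by positivity))), one_div_div]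

/-! ### The Dirichlet integral -/

/-- Aggregation: integrate `z` on its simplex edge, pass from `y` to the total `x + y`, integrate
`x` at fixed total, and finish with the total. The factors with exponents `e` and `f` depend on the
total only; they carry the powers of a margin and its complement needed for the edgeless graph. -/
theorem lintegral_dirichlet {a b c d e f : ℝ} (ha : 0 < a) (hb : 0 < b) (hc : 0 < c) (hd : 0 < d)
    (he : 0 ≤ e) (hf : 0 ≤ f) :
    ∫⁻ x : ℝ, ∫⁻ y : ℝ, ∫⁻ z : ℝ, ENNReal.ofReal
      (posPow x (a - 1) * posPow y (b - 1) * posPow (x + y) e * posPow (1 - (x + y)) f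
        * (posPow z (c - 1) * posPow (1 - (x + y) - z) (d - 1)))
      = ENNReal.ofReal (beta a b * beta c d * beta (a + b + e) (c + d + f)) := by
  have hB1 := beta_pos ha hb
  have hB2 := beta_pos hc hd
  have step_z : ∀ x y : ℝ, ∫⁻ z : ℝ, ENNReal.ofReal
      (posPow x (a - 1) * posPow y (b - 1) * posPow (x + y) e * posPow (1 - (x + y)) f
        * (posPow z (c - 1) * posPow (1 - (x + y) - z) (d - 1)))
      = ENNReal.ofReal (beta c d * posPow (x + y) e * posPow (1 - (x + y)) (c + d + f - 1)
        * (posPow x (a - 1) * posPow (x + y - x) (b - 1))) := by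
    intro x y
    rw [lintegral_ofReal_const_mul _ (lintegral_posPow_mul_posPow hc hd _)]
    · congr 1
      rw [show c + d + f - 1 = f + (c + d - 1) by ring, ← posPow_mul, add_sub_cancel_left]
      ring
    · have := posPow_nonneg x (a - 1)
      have := posPow_nonneg y (b - 1)
      have := posPow_nonneg (x + y) e
      have := posPow_nonneg (1 - (x + y)) f
      positivity
  simp_rw [step_z]
  -- Writing the old `y` as `x + y - x` exposes the integrand as a translate, so the total becomes
  -- the variable of integration.
  have step_shift : ∀ x : ℝ, ∫⁻ y : ℝ, ENNReal.ofReal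
      (beta c d * posPow (x + y) e * posPow (1 - (x + y)) (c + d + f - 1)
        * (posPow x (a - 1) * posPow (x + y - x) (b - 1)))
      = ∫⁻ y : ℝ, ENNReal.ofReal (beta c d * posPow y e * posPow (1 - y) (c + d + f - 1)
        * (posPow x (a - 1) * posPow (y - x) (b - 1))) := fun x =>
    lintegral_add_left_eq_self (fun y => ENNReal.ofReal
      (beta c d * posPow y e * posPow (1 - y) (c + d + f - 1)
        * (posPow x (a - 1) * posPow (y - x) (b - 1)))) x
  simp_rw [step_shift]
  rw [lintegral_lintegral_swap]
  swap
  · have h1 := measurable_posPow (a - 1)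
    have h2 := measurable_posPow (b - 1)
    have h3 := measurable_posPow e
    have h4 := measurable_posPow (c + d + f - 1)
    refine Measurable.aemeasurable ?_
    simp only [Function.uncurry_def]
    fun_prop
  have step_x : ∀ y : ℝ, ∫⁻ x : ℝ, ENNReal.ofReal
      (beta c d * posPow y e * posPow (1 - y) (c + d + f - 1)
        * (posPow x (a - 1) * posPow (y - x) (b - 1)))
      = ENNReal.ofReal (beta a b * beta c d
        * (posPow y (a + b + e - 1) * posPow (1 - y) (c + d + f - 1))) := by
    intro y
    rw [lintegral_ofReal_const_mul _ (lintegral_posPow_mul_posPow ha hb _)]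
    · congr 1
      rw [show a + b + e - 1 = e + (a + b - 1) by ring, ← posPow_mul]
      ring
    · have := posPow_nonneg y e
      have := posPow_nonneg (1 - y) (c + d + f - 1)
      positivity
  simp_rw [step_x]
  rw [lintegral_ofReal_const_mul (by positivity)
    (lintegral_posPow_mul_posPow (by positivity) (by positivity) _)]
  simp [posPow]

/-! ### Convergence in mean of functions of sample means -/

/-- The sample mean of the features `φ j`. -/
noncomputable def sampleMean {E ι : Type*} (φ : ι → E → ℝ) {N : ℕ} (x : Fin N → E) (j : ι) : ℝ :=
  (∑ k, φ j (x k)) / N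

section SampleMean

variable {E ι : Type*} [MeasurableSpace E] {P : Measure E} [IsProbabilityMeasure P]
  {φ : ι → E → ℝ}

theorem memLp_sampleMean (hφ : ∀ j, MemLp (φ j) 2 P) (N : ℕ) (j : ι) :
    MemLp (fun x : Fin N → E => sampleMean φ x j) 2 (Measure.pi fun _ => P) := by
  have h : ∀ k ∈ Finset.univ, MemLp (fun x : Fin N → E => φ j (x k)) 2 (Measure.pi fun _ => P) :=
    fun k _ => (hφ j).comp_measurePreserving (measurePreserving_eval _ k)
  have := (memLp_finsetSum Finset.univ h).const_mul ((N : ℝ)⁻¹)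
  simpa [sampleMean, div_eq_inv_mul] using this

theorem integral_sampleMean (hφ : ∀ j, MemLp (φ j) 2 P) {N : ℕ} (hN : 0 < N) (j : ι) :
    ∫ x : Fin N → E, sampleMean φ x j ∂(Measure.pi fun _ => P) = ∫ z, φ j z ∂P := by
  have h : ∀ k : Fin N, ∫ x : Fin N → E, φ j (x k) ∂(Measure.pi fun _ => P) = ∫ z, φ j z ∂P :=
    fun k => integral_comp_eval (μ := fun _ : Fin N => P) (hφ j).aestronglyMeasurable
  simp only [sampleMean]
  rw [integral_div, integral_finsetSum]
  · simp only [h, Finset.sum_const, Finset.card_univ, Fintype.card_fin, nsmul_eq_mul]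
    field_simp
  · exact fun k _ => ((hφ j).comp_measurePreserving
      (measurePreserving_eval (fun _ : Fin N => P) k)).integrable one_le_two

theorem integral_sq_sampleMean_sub (hφ : ∀ j, MemLp (φ j) 2 P) {N : ℕ} (hN : 0 < N) (j : ι) :
    ∫ x : Fin N → E, (sampleMean φ x j - ∫ z, φ j z ∂P) ^ 2 ∂(Measure.pi fun _ => P)
      = Var[φ j; P] / N := by
  rw [← integral_sampleMean hφ hN j,
    ← variance_eq_integral (memLp_sampleMean hφ N j).aestronglyMeasurable.aemeasurable]
  have h := variance_sum_pi (μ := fun _ : Fin N => P) (X := fun _ => φ j) fun _ => hφ j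
  have e : (fun x : Fin N → E => sampleMean φ x j)
      = fun x => (N : ℝ)⁻¹ * (∑ k, fun x : Fin N → E => φ j (x k)) x := by
    ext x; simp [sampleMean, div_eq_inv_mul]
  rw [e, variance_const_mul, h]
  simp only [Finset.sum_const, Finset.card_univ, Fintype.card_fin, nsmul_eq_mul]
  field_simp

variable [Fintype ι]

theorem integrable_of_le_sampleMean (hφ : ∀ j, MemLp (φ j) 2 P) {N : ℕ} {f : (Fin N → E) → ℝ}
    (hf : AEStronglyMeasurable f (Measure.pi fun _ => P)) {C K : ℝ}
    (h : ∀ x, |f x| ≤ C + K * ∑ j, |sampleMean φ x j|) :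
    Integrable f (Measure.pi fun _ => P) := by
  refine Integrable.mono' (g := fun x => C + K * ∑ j, |sampleMean φ x j|) ?_ hf (ae_of_all _ h)
  exact (integrable_const _).add ((integrable_finsetSum _ fun j _ =>
    ((memLp_sampleMean hφ N j).integrable one_le_two).abs).const_mul _)

/-- Let `D` be the squared Euclidean distance of the sample means from their expectations; its
integral is `V / N`. Within `δ` of the limit point `g` is near `l` by joint convergence. Elsewhere
`D ≥ δ ^ 2`, so the growth bound on `|g - l|` can be multiplied by `D / δ ^ 2`, which leaves terms
of order `log N / N`. The factor `log N` is allowed because the regularized BGe scatter may be as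
small as a multiple of `1 / N`. -/
theorem tendsto_integral_sampleMean (hφ : ∀ j, MemLp (φ j) 2 P) {g : ℕ → (ι → ℝ) → ℝ} {l K : ℝ}
    (hg : Tendsto (fun p : ℕ × (ι → ℝ) => g p.1 p.2) (atTop ×ˢ 𝓝 fun j => ∫ z, φ j z ∂P) (𝓝 l))
    (hK0 : 0 ≤ K)
    (hK : ∀ N : ℕ, 0 < N → ∀ x : Fin N → E,
      |g N (sampleMean φ x)| ≤ K * (1 + log N + ∑ j, |sampleMean φ x j|))
    (hint : ∀ N : ℕ, 0 < N →
      Integrable (fun x : Fin N → E => g N (sampleMean φ x)) (Measure.pi fun _ => P)) :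
    Tendsto (fun N : ℕ => ∫ x : Fin N → E, g N (sampleMean φ x) ∂(Measure.pi fun _ => P))
      atTop (𝓝 l) := by
  set e : ι → ℝ := fun j => ∫ z, φ j z ∂P with he
  set V : ℝ := ∑ j, Var[φ j; P] with hV
  set C : ℝ := ∑ j, (|e j| + 1) with hC
  have hC0 : 0 ≤ C := Finset.sum_nonneg fun j _ => by positivity
  rw [Metric.tendsto_atTop']
  intro ε hε
  have hnear : ∀ᶠ p in (atTop : Filter ℕ) ×ˢ 𝓝 e, |g p.1 p.2 - l| < ε / 2 := by
    have := (Metric.tendsto_nhds.1 hg) (ε / 2) (half_pos hε)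
    simpa [Real.dist_eq] using this
  obtain ⟨pa, hpa, pb, hpb, hab⟩ := Filter.eventually_prod_iff.1 hnear
  obtain ⟨δ, hδ, hball⟩ := Metric.eventually_nhds_iff.1 hpb
  have hlim : Tendsto (fun N : ℕ => (|l| + K * (1 + log N + C)) / δ ^ 2 * (V / N) + K * (V / N))
      atTop (𝓝 0) := by
    have h1 : Tendsto (fun N : ℕ => log N / N) atTop (𝓝 0) := by
      have := (Real.isLittleO_log_id_atTop.tendsto_div_nhds_zero).comp
        (tendsto_natCast_atTop_atTop (R := ℝ))
      simpa [Function.comp_def] using this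
    have h2 : Tendsto (fun N : ℕ => (1 : ℝ) / N) atTop (𝓝 0) := tendsto_one_div_atTop_nhds_zero_nat
    have h3 := ((h2.const_mul ((|l| + K * (1 + C)) * V / δ ^ 2)).add
      (h1.const_mul (K * V / δ ^ 2))).add (h2.const_mul (K * V))
    simp only [mul_zero, add_zero] at h3
    refine h3.congr fun N => ?_
    ring
  have hsmall := (Metric.tendsto_nhds.1 hlim) (ε / 2) (half_pos hε)
  have hev : ∀ᶠ N : ℕ in atTop, dist
      (∫ x : Fin N → E, g N (sampleMean φ x) ∂(Measure.pi fun _ => P)) l < ε := by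
    filter_upwards [hpa, hsmall, eventually_gt_atTop 0] with N hN1 hN2 hN
    have hNlog : 0 ≤ log (N : ℝ) := log_natCast_nonneg N
    set D : (Fin N → E) → ℝ := fun x => ∑ j, (sampleMean φ x j - e j) ^ 2 with hD
    have hD0 : ∀ x, 0 ≤ D x := fun x => Finset.sum_nonneg fun j _ => sq_nonneg _
    have hDj : ∀ j ∈ Finset.univ, Integrable
        (fun x : Fin N → E => (sampleMean φ x j - e j) ^ 2) (Measure.pi fun _ => P) := fun j _ =>
      ((memLp_sampleMean hφ N j).sub (memLp_const (e j))).integrable_sq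
    have hDint : Integrable D (Measure.pi fun _ => P) := integrable_finsetSum _ hDj
    have hDval : ∫ x, D x ∂(Measure.pi fun _ => P) = V / N := by
      rw [integral_finsetSum _ hDj, hV, Finset.sum_div]
      exact Finset.sum_congr rfl fun j _ => integral_sq_sampleMean_sub hφ hN j
    have hpt : ∀ x : Fin N → E, |g N (sampleMean φ x) - l|
        ≤ ε / 2 + ((|l| + K * (1 + log N + C)) / δ ^ 2 * D x + K * D x) := by
      intro x
      have hA : 0 ≤ (|l| + K * (1 + log N + C)) := by positivity
      by_cases hx : dist (sampleMean φ x) e < δ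
      · have h1 := (hab hN1 (hball hx)).le
        have h2 : 0 ≤ (|l| + K * (1 + log N + C)) / δ ^ 2 * D x + K * D x := by
          have := hD0 x
          positivity
        simp only at h1
        linarith
      · have hδD : δ ^ 2 ≤ D x := by
          rw [dist_pi_lt_iff hδ] at hx
          push Not at hx
          obtain ⟨j, hj⟩ := hx
          rw [Real.dist_eq] at hj
          calc δ ^ 2 ≤ |sampleMean φ x j - e j| ^ 2 := by gcongr
            _ = (sampleMean φ x j - e j) ^ 2 := sq_abs _
            _ ≤ D x := Finset.single_le_sum (f := fun j => (sampleMean φ x j - e j) ^ 2)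
                (fun j _ => sq_nonneg _) (Finset.mem_univ j)
        have hsum : ∑ j, |sampleMean φ x j| ≤ C + D x := by
          rw [hC, hD, ← Finset.sum_add_distrib]
          refine Finset.sum_le_sum fun j _ => ?_
          have h1 : |sampleMean φ x j| ≤ |e j| + |sampleMean φ x j - e j| := by
            have := abs_add_le (e j) (sampleMean φ x j - e j)
            simpa using this
          -- Trading a linear deviation for a quadratic one lets the second moment alone control the
          -- tail.
          have h2 : |sampleMean φ x j - e j| ≤ 1 + (sampleMean φ x j - e j) ^ 2 := by
            rw [← sq_abs (sampleMean φ x j - e j)]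
            nlinarith [sq_nonneg (|sampleMean φ x j - e j| - 1), abs_nonneg (sampleMean φ x j - e j)]
          linarith
        have h1 : |g N (sampleMean φ x) - l| ≤ |l| + K * (1 + log N + C) + K * D x := by
          have h2 := hK N hN x
          have h3 : K * (1 + log N + ∑ j, |sampleMean φ x j|) ≤ K * (1 + log N + (C + D x)) := by
            gcongr
          have h4 := abs_sub (g N (sampleMean φ x)) l
          linarith
        have h2 : |l| + K * (1 + log N + C) ≤ (|l| + K * (1 + log N + C)) / δ ^ 2 * D x := by
          rw [div_mul_eq_mul_div, le_div_iff₀ (by positivity)]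
          gcongr
        linarith
    have hc : ∀ c : ℝ, Integrable (fun x => c * D x) (Measure.pi fun _ => P) :=
      fun c => hDint.const_mul c
    have hcc : ∀ c c' : ℝ, Integrable (fun x => c * D x + c' * D x) (Measure.pi fun _ => P) :=
      fun c c' => (hc c).add (hc c')
    have hbound : Integrable (fun x : Fin N → E =>
        ε / 2 + ((|l| + K * (1 + log N + C)) / δ ^ 2 * D x + K * D x)) (Measure.pi fun _ => P) :=
      (integrable_const _).add (hcc _ _)
    have hsub : ∫ x : Fin N → E, g N (sampleMean φ x) ∂(Measure.pi fun _ => P) - l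
        = ∫ x : Fin N → E, (g N (sampleMean φ x) - l) ∂(Measure.pi fun _ => P) := by
      rw [integral_sub (hint N hN) (integrable_const _)]; simp
    rw [Real.dist_eq, hsub]
    calc |∫ x : Fin N → E, (g N (sampleMean φ x) - l) ∂(Measure.pi fun _ => P)|
        ≤ ∫ x : Fin N → E, |g N (sampleMean φ x) - l| ∂(Measure.pi fun _ => P) :=
          abs_integral_le_integral_abs
      _ ≤ ∫ x : Fin N → E, (ε / 2 + ((|l| + K * (1 + log N + C)) / δ ^ 2 * D x + K * D x))
            ∂(Measure.pi fun _ => P) :=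
          integral_mono (((hint N hN).sub (integrable_const _)).abs) hbound hpt
      _ = ε / 2 + ((|l| + K * (1 + log N + C)) / δ ^ 2 * (V / N) + K * (V / N)) := by
          rw [integral_add (integrable_const _) (hcc _ _), integral_add (hc _) (hc _), integral_const_mul,
            integral_const_mul, hDval]
          simp
      _ < ε := by
          have := lt_of_abs_lt (by simpa [Real.dist_eq] using hN2)
          linarith
  obtain ⟨N0, hN0⟩ := eventually_atTop.1 hev
  exact ⟨N0, fun n hn => hN0 n hn.le⟩

end SampleMean

/-! ### The normal-Wishart prior in coordinates -/

theorem det_symMatrix (a b c : ℝ) : (symMatrix (a, b, c)).det = a * c - b ^ 2 := by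
  simp [symMatrix, Matrix.det_fin_two]; ring

theorem posDef_symMatrix_iff (a b c : ℝ) :
    (symMatrix (a, b, c)).PosDef ↔ 0 < a ∧ 0 < a * c - b ^ 2 := by
  constructor
  · intro h
    refine ⟨?_, ?_⟩
    · simpa [symMatrix] using h.diag_pos (i := 0)
    · rw [← det_symMatrix]; exact h.det_pos
  · rintro ⟨ha, hd⟩
    refine Matrix.PosDef.of_dotProduct_mulVec_pos ?_ fun x hx => ?_
    · ext i j
      fin_cases i <;> fin_cases j <;> simp [symMatrix, Matrix.conjTranspose_apply]
    · have e : star x ⬝ᵥ (symMatrix (a, b, c)).mulVec x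
          = ((a * x 0 + b * x 1) ^ 2 + (a * c - b ^ 2) * x 1 ^ 2) / a := by
        simp [symMatrix, Matrix.mulVec, dotProduct, Fin.sum_univ_two]
        field_simp
        ring
      rw [e]
      refine div_pos ?_ ha
      rcases eq_or_ne (x 1) 0 with h1 | h1
      · have h0 : x 0 ≠ 0 := fun h0 => hx (by ext i; fin_cases i <;> simp [h0, h1])
        rw [h1]
        have : 0 < (a * x 0) ^ 2 := by positivity
        simpa using this
      · positivity

theorem nodeMeanVar_zero (p : (Fin 2 → ℝ) × (ℝ × ℝ × ℝ)) :
    nodeMeanVar 0 p = (p.1 0, (p.2.1 * p.2.2.2 - p.2.2.1 ^ 2)⁻¹ * p.2.2.2) := by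
  simp [nodeMeanVar, symMatrix, Matrix.inv_def, Matrix.det_fin_two, Matrix.adjugate_fin_two, sq]

theorem nodeMeanVar_one (p : (Fin 2 → ℝ) × (ℝ × ℝ × ℝ)) :
    nodeMeanVar 1 p = (p.1 1, (p.2.1 * p.2.2.2 - p.2.2.1 ^ 2)⁻¹ * p.2.1) := by
  simp [nodeMeanVar, symMatrix, Matrix.inv_def, Matrix.det_fin_two, Matrix.adjugate_fin_two, sq]

theorem measurable_nodeMeanVar_one : Measurable (nodeMeanVar 1) := by
  rw [funext nodeMeanVar_one]
  fun_prop

theorem normalPrecisionPDF_symMatrix (m x : Fin 2 → ℝ) (a b c : ℝ) :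
    normalPrecisionPDF m (symMatrix (a, b, c)) x
      = (a * c - b ^ 2) ^ (1 / 2 : ℝ) / (2 * π) * exp (-(1 / 2) *
        (a * (x 0 - m 0) ^ 2 + 2 * b * ((x 0 - m 0) * (x 1 - m 1)) + c * (x 1 - m 1) ^ 2)) := by
  rw [normalPrecisionPDF, det_symMatrix]
  congr 2
  · norm_num
  · simp [symMatrix, Matrix.mulVec, dotProduct, Fin.sum_univ_two]
    ring

/-- The density of `bgePrior`. -/
noncomputable def bgeDensity (t αμ αw : ℝ) (p : (Fin 2 → ℝ) × (ℝ × ℝ × ℝ)) : ℝ :=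
  wishartPDF (t • (1 : Matrix (Fin 2) (Fin 2) ℝ)) αw (symMatrix p.2)
    * normalPrecisionPDF 0 (αμ • symMatrix p.2) p.1

/-- The normalizing constant in the density of `bgePrior`. -/
noncomputable def bgeConst (t αμ αw : ℝ) : ℝ :=
  αμ / (2 * π) / (2 ^ (αw * (2 : ℕ) / 2) * multivariateGamma 2 (αw / 2)
    / (t • (1 : Matrix (Fin 2) (Fin 2) ℝ)).det ^ (αw / 2))

theorem bgeConst_pos {t αμ αw : ℝ} (ht : 0 < t) (hαμ : 0 < αμ) (hαw : 3 < αw) :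
    0 < bgeConst t αμ αw := by
  have h1 : 0 < (t • (1 : Matrix (Fin 2) (Fin 2) ℝ)).det := by
    rw [Matrix.det_smul]; simp; positivity
  have h2 : 0 < multivariateGamma 2 (αw / 2) := by
    refine mul_pos (by positivity) (Finset.prod_pos fun j hj => Gamma_pos_of_pos ?_)
    have : (j : ℝ) ≤ 2 := by exact_mod_cast (Finset.mem_Icc.1 hj).2
    linarith
  unfold bgeConst
  positivity

/-- The Wishart exponent `(αw - 3) / 2` gains `1 / 2` from the determinant factor of the normal
density; in dimension two that factor also releases exactly one power of `αμ`. -/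
theorem bgeDensity_eq_of_pos {t αμ αw : ℝ} (hαμ : 0 < αμ) {u v a b c : ℝ} (ha : 0 < a)
    (hd : 0 < a * c - b ^ 2) :
    bgeDensity t αμ αw (![u, v], (a, b, c))
      = bgeConst t αμ αw * (a * c - b ^ 2) ^ ((αw - 2) / 2)
        * exp (-(1 / 2) * (αμ * (a * u ^ 2 + 2 * b * (u * v) + c * v ^ 2) + t * (a + c))) := by
  have e1 : αμ • symMatrix (a, b, c) = symMatrix (αμ * a, αμ * b, αμ * c) := by
    ext i j; fin_cases i <;> fin_cases j <;> simp [symMatrix]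
  have e2 : ((t • (1 : Matrix (Fin 2) (Fin 2) ℝ)) * symMatrix (a, b, c)).trace = t * (a + c) := by
    simp [symMatrix, Matrix.trace_fin_two]; ring
  have e3 : (αμ * a * (αμ * c) - (αμ * b) ^ 2) ^ (1 / 2 : ℝ)
      = αμ * (a * c - b ^ 2) ^ (1 / 2 : ℝ) := by
    rw [show αμ * a * (αμ * c) - (αμ * b) ^ 2 = αμ ^ 2 * (a * c - b ^ 2) by ring,
      mul_rpow (by positivity) hd.le, ← rpow_natCast, ← rpow_mul hαμ.le]
    norm_num
  simp only [bgeDensity]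
  rw [wishartPDF, if_pos ((posDef_symMatrix_iff a b c).2 ⟨ha, hd⟩), e1,
    normalPrecisionPDF_symMatrix, e2, e3, det_symMatrix,
    show (αw - 2) / 2 = (αw - (2 : ℕ) - 1) / 2 + 1 / 2 by push_cast; ring, rpow_add hd,
    show -(1 / 2) * (αμ * (a * u ^ 2 + 2 * b * (u * v) + c * v ^ 2) + t * (a + c))
      = -(1 / 2) * (t * (a + c)) + -(1 / 2) * (αμ * (a * u ^ 2 + 2 * b * (u * v) + c * v ^ 2))
      by ring, exp_add, bgeConst]
  simp
  ring_nf

theorem bgeDensity_eq_zero {t αμ αw : ℝ} {u v a b c : ℝ} (h : ¬(0 < a ∧ 0 < a * c - b ^ 2)) :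
    bgeDensity t αμ αw (![u, v], (a, b, c)) = 0 := by
  simp only [bgeDensity]
  rw [wishartPDF, if_neg (mt (posDef_symMatrix_iff a b c).1 h), zero_mul]

/-- Positive definiteness is `0 < a` together with a positive Schur complement, so the two cutoffs
encode the support and the formula holds everywhere. -/
theorem bgeDensity_eq {t αμ αw : ℝ} (hαμ : 0 < αμ) (u v a b c : ℝ) :
    bgeDensity t αμ αw (![u, v], (a, b, c))
      = bgeConst t αμ αw * (posPow a ((αw - 2) / 2) * posPow (c - b ^ 2 / a) ((αw - 2) / 2)
        * exp (-(1 / 2) * (αμ * (a * u ^ 2 + 2 * b * (u * v) + c * v ^ 2) + t * (a + c)))) := by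
  rcases le_or_gt a 0 with ha | ha
  · rw [bgeDensity_eq_zero (fun h => ha.not_gt h.1), posPow_of_nonpos ha]; simp
  have e : a * c - b ^ 2 = a * (c - b ^ 2 / a) := by field_simp
  rcases le_or_gt (c - b ^ 2 / a) 0 with hs | hs
  · rw [bgeDensity_eq_zero (fun h => ?_), posPow_of_nonpos hs]
    · simp
    · rw [e] at h
      exact (mul_nonpos_of_nonneg_of_nonpos ha.le hs).not_gt h.2
  · rw [bgeDensity_eq_of_pos hαμ ha (by rw [e]; exact mul_pos ha hs), e,
      mul_rpow ha.le hs.le, posPow_of_pos ha, posPow_of_pos hs]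
    ring

theorem measurable_bgeDensity {t αμ αw : ℝ} (hαμ : 0 < αμ) : Measurable (bgeDensity t αμ αw) := by
  have e : bgeDensity t αμ αw = fun p => bgeConst t αμ αw *
      (posPow p.2.1 ((αw - 2) / 2) * posPow (p.2.2.2 - p.2.2.1 ^ 2 / p.2.1) ((αw - 2) / 2)
        * exp (-(1 / 2) * (αμ * (p.2.1 * p.1 0 ^ 2 + 2 * p.2.2.1 * (p.1 0 * p.1 1)
          + p.2.2.2 * p.1 1 ^ 2) + t * (p.2.1 + p.2.2.2)))) := by
    ext ⟨m, a, b, c⟩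
    rw [← bgeDensity_eq hαμ]
    congr 2
    ext i; fin_cases i <;> rfl
  rw [e]
  have := measurable_posPow ((αw - 2) / 2)
  fun_prop

theorem bgePrior_eq (t αμ αw : ℝ) :
    bgePrior t αμ αw = volume.withDensity fun p => ENNReal.ofReal (bgeDensity t αμ αw p) := rfl

theorem lintegral_meanPrecision {F : (Fin 2 → ℝ) × (ℝ × ℝ × ℝ) → ENNReal} (hF : Measurable F) :
    ∫⁻ p, F p = ∫⁻ a : ℝ, ∫⁻ b : ℝ, ∫⁻ c : ℝ, ∫⁻ v : ℝ, ∫⁻ u : ℝ, F (![u, v], (a, b, c)) := by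
  have inner : ∀ w : ℝ × ℝ × ℝ, ∫⁻ m : Fin 2 → ℝ, F (m, w)
      = ∫⁻ v : ℝ, ∫⁻ u : ℝ, F (![u, v], w) := by
    intro w
    rw [← (volume_preserving_finTwoArrow ℝ).symm.lintegral_comp
      (f := fun m => F (m, w)) (by fun_prop), Measure.volume_eq_prod,
      lintegral_prod_symm' _ (by fun_prop)]
    rfl
  have hm : Measurable fun w : ℝ × ℝ × ℝ => ∫⁻ m : Fin 2 → ℝ, F (m, w) :=
    hF.lintegral_prod_left'
  rw [Measure.volume_eq_prod, lintegral_prod_symm' _ hF, Measure.volume_eq_prod,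
    lintegral_prod _ hm.aemeasurable]
  refine lintegral_congr fun a => ?_
  rw [Measure.volume_eq_prod, lintegral_prod _ (by fun_prop)]
  exact lintegral_congr fun b => lintegral_congr fun c => inner _

/-- Exchange of the two nodes in `(μ, W)`. -/
def swapNodes (p : (Fin 2 → ℝ) × (ℝ × ℝ × ℝ)) : (Fin 2 → ℝ) × (ℝ × ℝ × ℝ) :=
  (![p.1 1, p.1 0], (p.2.2.2, p.2.2.1, p.2.1))

theorem measurePreserving_swapNodes : MeasurePreserving swapNodes volume volume := by
  have h1 : MeasurePreserving (fun m : Fin 2 → ℝ => ![m 1, m 0]) volume volume := by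
    have h := (volume_preserving_finTwoArrow ℝ).symm.comp
      (Measure.measurePreserving_swap.comp (volume_preserving_finTwoArrow ℝ))
    exact h
  have h2 : MeasurePreserving (fun w : ℝ × ℝ × ℝ => (w.2.2, w.2.1, w.1)) volume volume := by
    have h := (volume_preserving_prodAssoc (α₁ := ℝ) (β₁ := ℝ) (γ₁ := ℝ)).comp
      (((Measure.measurePreserving_swap (μ := (volume : Measure ℝ)) (ν := (volume : Measure ℝ))).prod
        (MeasurePreserving.id (volume : Measure ℝ))).comp
        (Measure.measurePreserving_swap (μ := (volume : Measure ℝ))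
          (ν := (volume : Measure (ℝ × ℝ)))))
    exact h
  exact h1.prod h2

theorem bgeDensity_swapNodes {t αμ αw : ℝ} (hαμ : 0 < αμ) (p : (Fin 2 → ℝ) × (ℝ × ℝ × ℝ)) :
    bgeDensity t αμ αw (swapNodes p) = bgeDensity t αμ αw p := by
  obtain ⟨m, a, b, c⟩ := p
  have hm : m = ![m 0, m 1] := by ext i; fin_cases i <;> rfl
  rw [hm]
  change bgeDensity t αμ αw (![m 1, m 0], (c, b, a)) = _
  have hca : c * a - b ^ 2 = a * c - b ^ 2 := by ring
  by_cases h : 0 < a ∧ 0 < a * c - b ^ 2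
  · have hc : 0 < c := by
      by_contra hc
      nlinarith [h.1, h.2, sq_nonneg b]
    rw [bgeDensity_eq_of_pos hαμ hc (by rw [hca]; exact h.2), bgeDensity_eq_of_pos hαμ h.1 h.2, hca]
    congr 2
    ring
  · rw [bgeDensity_eq_zero h, bgeDensity_eq_zero]
    rintro ⟨hc, hd⟩
    refine h ⟨?_, by rw [← hca]; exact hd⟩
    by_contra ha
    nlinarith [sq_nonneg b]

theorem map_withDensity_of_comp_eq {X : Type*} [MeasurableSpace X] {μ : Measure X} {σ : X → X}
    (hσ : MeasurePreserving σ μ μ) {f g : X → ENNReal} (hg : Measurable g)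
    (h : ∀ x, g (σ x) = f x) : (μ.withDensity f).map σ = μ.withDensity g := by
  ext s hs
  rw [Measure.map_apply hσ.measurable hs, withDensity_apply _ (hσ.measurable hs),
    withDensity_apply _ hs, ← hσ.setLIntegral_comp_preimage hs hg]
  simp_rw [h]

/-- Since `T` is a multiple of the identity and the prior mean is zero, exchanging the nodes
preserves the prior. It is therefore enough to integrate against the marginal prior of the second
node, whose variance is simply the inverse Schur complement. -/
theorem map_nodeMeanVar_zero {t αμ αw : ℝ} (hαμ : 0 < αμ) :
    (bgePrior t αμ αw).map (nodeMeanVar 0) = (bgePrior t αμ αw).map (nodeMeanVar 1) := by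
  have e : nodeMeanVar 0 = nodeMeanVar 1 ∘ swapNodes := by
    ext p <;> simp [nodeMeanVar_zero, nodeMeanVar_one, swapNodes, mul_comm]
  rw [e, ← Measure.map_map measurable_nodeMeanVar_one measurePreserving_swapNodes.measurable,
    bgePrior_eq, map_withDensity_of_comp_eq measurePreserving_swapNodes
      (measurable_bgeDensity hαμ).ennreal_ofReal fun p => by rw [bgeDensity_swapNodes hαμ]]

/-! ### The BGe marginal likelihoods in closed form -/

theorem sum_sub_mul_sub {N : ℕ} (y z : Fin N → ℝ) (u v : ℝ) :
    ∑ k, (y k - u) * (z k - v)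
      = ∑ k, y k * z k - v * ∑ k, y k - u * ∑ k, z k + N * (u * v) := by
  simp only [Finset.mul_sum, ← Finset.sum_sub_distrib]
  rw [show (N : ℝ) * (u * v) = ∑ _k : Fin N, u * v by simp, ← Finset.sum_add_distrib]
  exact Finset.sum_congr rfl fun k _ => by ring

/-- The sum of products about the sample means, the latter shrunk towards zero by the prior
sample size `αμ`. -/
noncomputable def shrunkScatter (αμ : ℝ) {N : ℕ} (y z : Fin N → ℝ) : ℝ :=
  ∑ k, y k * z k - (∑ k, y k) * (∑ k, z k) / (N + αμ)

theorem shrunkScatter_quadratic (αμ : ℝ) {N : ℕ} (y z : Fin N → ℝ) (r s : ℝ) :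
    shrunkScatter αμ (fun k => r * y k + s * z k) (fun k => r * y k + s * z k)
      = r ^ 2 * shrunkScatter αμ y y + 2 * (r * s) * shrunkScatter αμ y z
        + s ^ 2 * shrunkScatter αμ z z := by
  have h1 : ∑ k, (r * y k + s * z k) * (r * y k + s * z k)
      = r ^ 2 * ∑ k, y k * y k + 2 * (r * s) * ∑ k, y k * z k + s ^ 2 * ∑ k, z k * z k := by
    simp only [Finset.mul_sum, ← Finset.sum_add_distrib]
    exact Finset.sum_congr rfl fun k _ => by ring
  have h2 : ∑ k, (r * y k + s * z k) = r * ∑ k, y k + s * ∑ k, z k := by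
    simp only [Finset.mul_sum, ← Finset.sum_add_distrib]
  simp only [shrunkScatter, h1, h2]
  ring

theorem shrunkScatter_self_nonneg {αμ : ℝ} (hαμ : 0 < αμ) {N : ℕ} (y : Fin N → ℝ) :
    0 ≤ shrunkScatter αμ y y := by
  have h := sq_sum_le_card_mul_sum_sq (s := (Finset.univ : Finset (Fin N))) (f := y)
  simp only [Finset.card_univ, Fintype.card_fin] at h
  have hκ : 0 < (N : ℝ) + αμ := by positivity
  have hs : 0 ≤ ∑ k, y k ^ 2 := Finset.sum_nonneg fun k _ => sq_nonneg _
  have e : ∑ k, y k * y k = ∑ k, y k ^ 2 := Finset.sum_congr rfl fun k _ => by ring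
  rw [shrunkScatter, e, sub_nonneg, div_le_iff₀ hκ]
  nlinarith

/-- Cauchy–Schwarz: the scatter of `r * y + z` is a nonnegative quadratic polynomial in `r`, so its
discriminant is nonpositive. -/
theorem shrunkScatter_sq_le {αμ : ℝ} (hαμ : 0 < αμ) {N : ℕ} (y z : Fin N → ℝ) :
    shrunkScatter αμ y z ^ 2 ≤ shrunkScatter αμ y y * shrunkScatter αμ z z := by
  have h := discrim_le_zero (a := shrunkScatter αμ y y) (b := 2 * shrunkScatter αμ y z)
    (c := shrunkScatter αμ z z) fun r => by
      have h1 := shrunkScatter_self_nonneg hαμ fun k => r * y k + 1 * z k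
      rw [shrunkScatter_quadratic] at h1
      linarith
  rw [discrim] at h
  nlinarith

/-- The determinant exceeds `t ^ 2` by `t` times the trace of the scatter matrix plus its
determinant, both nonnegative. This deterministic lower bound is what keeps the logarithm
integrable. -/
theorem scatter_det_ge {t αμ : ℝ} (ht : 0 < t) (hαμ : 0 < αμ) {N : ℕ} (y z : Fin N → ℝ) :
    t ^ 2 ≤ (t + shrunkScatter αμ y y) * (t + shrunkScatter αμ z z)
      - shrunkScatter αμ y z ^ 2 := by
  have h1 := shrunkScatter_sq_le hαμ y z
  have h2 := shrunkScatter_self_nonneg hαμ y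
  have h3 := shrunkScatter_self_nonneg hαμ z
  nlinarith [mul_nonneg ht.le h2, mul_nonneg ht.le h3]

theorem bgeDensity_nonneg {t αμ αw : ℝ} (ht : 0 < t) (hαμ : 0 < αμ) (hαw : 3 < αw)
    (p : (Fin 2 → ℝ) × (ℝ × ℝ × ℝ)) : 0 ≤ bgeDensity t αμ αw p := by
  obtain ⟨m, a, b, c⟩ := p
  have hm : m = ![m 0, m 1] := by ext i; fin_cases i <;> rfl
  rw [hm, bgeDensity_eq hαμ]
  have := posPow_nonneg a ((αw - 2) / 2)
  have := posPow_nonneg (c - b ^ 2 / a) ((αw - 2) / 2)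
  have := bgeConst_pos ht hαμ hαw
  positivity

/-- Common frame for both BGe marginal likelihoods: prior density times likelihood only has to be
matched with the normal-Wishart integrand on the support, since the density vanishes elsewhere. -/
theorem integral_bgePrior {t αμ αw : ℝ} (ht : 0 < t) (hαμ : 0 < αμ) (hαw : 3 < αw)
    {f : (Fin 2 → ℝ) × (ℝ × ℝ × ℝ) → ℝ} (hf : Measurable f)
    {C p q κ₁ κ₂ T₁₁ T₁₂ T₂₂ R : ℝ} (hC : 0 < C) (hp : 0 < p + 1)
    (hq : 0 < q + 1 / 2) (hκ₁ : 0 < κ₁) (hκ₂ : 0 < κ₂) (hT : 0 < T₂₂)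
    (hdet : 0 < T₁₁ * T₂₂ - T₁₂ ^ 2) (hR : 0 < R) (h : ℝ → ℝ → ℝ → ℝ) (d : ℝ)
    (hfd : ∀ u v a b c : ℝ, 0 < a → 0 < c - b ^ 2 / a →
      bgeDensity t αμ αw (![u, v], (a, b, c)) * f (![u, v], (a, b, c))
        = C * (a ^ p * (c - b ^ 2 / a) ^ q * exp (-(1 / 2) *
          (κ₁ * a * (u - h a b v) ^ 2 + κ₂ * (c - b ^ 2 / a) * (v - d) ^ 2
          + T₁₁ * a + 2 * T₁₂ * b + T₂₂ * (b ^ 2 / a) + R * (c - b ^ 2 / a))))) :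
    ∫ p, f p ∂(bgePrior t αμ αw) = C * (√(2 * π / κ₁) * √(2 * π / κ₂) * √(2 * π / T₂₂)
          * (Gamma (q + 1 / 2) * (2 / R) ^ (q + 1 / 2))
          * (Gamma (p + 1) * (2 * T₂₂ / (T₁₁ * T₂₂ - T₁₂ ^ 2)) ^ (p + 1))) := by
  have hfd' : ∀ u v a b c : ℝ,
      bgeDensity t αμ αw (![u, v], (a, b, c)) * f (![u, v], (a, b, c))
        = C * (posPow a p * posPow (c - b ^ 2 / a) q * exp (-(1 / 2) *
          (κ₁ * a * (u - h a b v) ^ 2 + κ₂ * (c - b ^ 2 / a) * (v - d) ^ 2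
          + T₁₁ * a + 2 * T₁₂ * b + T₂₂ * (b ^ 2 / a) + R * (c - b ^ 2 / a)))) := by
    intro u v a b c
    rcases le_or_gt a 0 with ha | ha
    · rw [bgeDensity_eq hαμ, posPow_of_nonpos ha, posPow_of_nonpos ha]; ring
    rcases le_or_gt (c - b ^ 2 / a) 0 with hs | hs
    · rw [bgeDensity_eq hαμ, posPow_of_nonpos hs, posPow_of_nonpos hs]; ring
    · rw [hfd u v a b c ha hs, posPow_of_pos ha, posPow_of_pos hs]
  have hdf0 : ∀ x, 0 ≤ bgeDensity t αμ αw x * f x := by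
    rintro ⟨m, a, b, c⟩
    have hm : m = ![m 0, m 1] := by ext i; fin_cases i <;> rfl
    rw [hm, hfd']
    have := posPow_nonneg a p
    have := posPow_nonneg (c - b ^ 2 / a) q
    positivity
  have hmeas := measurable_bgeDensity (t := t) (αw := αw) hαμ
  rw [bgePrior_eq, integral_withDensity_eq_integral_toReal_smul hmeas.ennreal_ofReal
    (ae_of_all _ fun _ => ENNReal.ofReal_lt_top)]
  have hpt : ∀ x, (ENNReal.ofReal (bgeDensity t αμ αw x)).toReal • f x
      = bgeDensity t αμ αw x * f x := by
    intro x
    rw [ENNReal.toReal_ofReal (bgeDensity_nonneg ht hαμ hαw x), smul_eq_mul]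
  simp_rw [hpt]
  rw [integral_eq_lintegral_of_nonneg_ae (ae_of_all _ hdf0)
    (hmeas.mul hf).aestronglyMeasurable, lintegral_meanPrecision (by fun_prop)]
  simp only [hfd']
  simp_rw [ENNReal.ofReal_mul hC.le]
  simp_rw [lintegral_const_mul' _ _ ENNReal.ofReal_ne_top]
  rw [lintegral_normalWishart hp hq hκ₁ hκ₂ hT hdet hR h d, ← ENNReal.ofReal_mul hC.le,
    ENNReal.toReal_ofReal]
  have := Gamma_pos_of_pos hp
  have := Gamma_pos_of_pos hq
  positivity

theorem bgeMarginal_forward {t αμ αw : ℝ} (ht : 0 < t) (hαμ : 0 < αμ) (hαw : 3 < αw) {N : ℕ}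
    (x : Fin N → Fin 2 → ℝ) :
    bgeMarginal t αμ αw x TwoNodeDAG.forward
      = bgeConst t αμ αw / (2 * π) ^ N * (√(2 * π / (N + αμ)) * √(2 * π / (N + αμ))
          * √(2 * π / (t + shrunkScatter αμ (fun k => x k 1) (fun k => x k 1)))
          * (Gamma ((αw - 2) / 2 + N / 2 + 1 / 2)
            * (2 / (t + shrunkScatter αμ (fun k => x k 1) (fun k => x k 1)))
              ^ ((αw - 2) / 2 + N / 2 + 1 / 2))
          * (Gamma ((αw - 2) / 2 + N / 2 + 1)
            * (2 * (t + shrunkScatter αμ (fun k => x k 1) (fun k => x k 1))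
              / ((t + shrunkScatter αμ (fun k => x k 0) (fun k => x k 0))
                * (t + shrunkScatter αμ (fun k => x k 1) (fun k => x k 1))
                - shrunkScatter αμ (fun k => x k 0) (fun k => x k 1) ^ 2))
              ^ ((αw - 2) / 2 + N / 2 + 1))) := by
  have hκ : 0 < (N : ℝ) + αμ := by positivity
  have hN : (0 : ℝ) ≤ N := N.cast_nonneg
  have h1 := shrunkScatter_self_nonneg hαμ fun k => x k 1
  rw [bgeMarginal]
  refine integral_bgePrior ht hαμ hαw ?_ (div_pos (bgeConst_pos ht hαμ hαw) (by positivity))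
    (by linarith) (by linarith) hκ hκ (by linarith)
    ((by positivity : 0 < t ^ 2).trans_le (scatter_det_ge ht hαμ _ _)) (by linarith)
    (fun a b v => (∑ k, x k 0) / (N + αμ) - b / a * (v - (∑ k, x k 1) / (N + αμ)))
    ((∑ k, x k 1) / (N + αμ)) ?_
  · have e : ∀ (p : (Fin 2 → ℝ) × (ℝ × ℝ × ℝ)) (k : Fin N), _ := fun p k =>
      normalPrecisionPDF_symMatrix p.1 (x k) p.2.1 p.2.2.1 p.2.2.2
    simp only [Prod.mk.eta] at e
    simp only [e]
    fun_prop
  · intro u v a b c ha hs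
    have e : a * c - b ^ 2 = a * (c - b ^ 2 / a) := by field_simp
    have hd : 0 < a * c - b ^ 2 := by rw [e]; exact mul_pos ha hs
    rw [bgeDensity_eq_of_pos hαμ ha hd]
    simp only [normalPrecisionPDF_symMatrix, Matrix.cons_val_zero, Matrix.cons_val_one]
    rw [Finset.prod_mul_distrib, Finset.prod_const, Finset.card_univ, Fintype.card_fin,
      ← exp_sum, div_pow, ← rpow_natCast ((a * c - b ^ 2) ^ (1 / 2 : ℝ)), ← rpow_mul hd.le,
      ← Finset.mul_sum, Finset.sum_add_distrib, Finset.sum_add_distrib, ← Finset.mul_sum,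
      ← Finset.mul_sum, ← Finset.mul_sum]
    have s0 := sum_sub_mul_sub (fun k => x k 0) (fun k => x k 0) u u
    have s1 := sum_sub_mul_sub (fun k => x k 0) (fun k => x k 1) u v
    have s2 := sum_sub_mul_sub (fun k => x k 1) (fun k => x k 1) v v
    simp only [← sq] at s0 s2
    rw [s0, s1, s2, show (1 / 2 : ℝ) * N = N / 2 by ring]
    have hpow : (a * c - b ^ 2) ^ ((αw - 2) / 2) * (a * c - b ^ 2) ^ ((N : ℝ) / 2)
        = a ^ ((αw - 2) / 2 + N / 2) * (c - b ^ 2 / a) ^ ((αw - 2) / 2 + N / 2) := by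
      rw [← rpow_add hd, e, mul_rpow ha.le hs.le]
    -- Completing the square in both means: prior and data precisions add to `N + αμ`, and what is
    -- left over are the shrunk scatters.
    have hexp : ∀ S0 S1 S00 S01 S11 : ℝ,
        -(1 / 2) * (αμ * (a * u ^ 2 + 2 * b * (u * v) + c * v ^ 2) + t * (a + c))
        + -(1 / 2) * (a * (S00 - u * S0 - u * S0 + N * u ^ 2)
          + 2 * b * (S01 - v * S0 - u * S1 + N * (u * v))
          + c * (S11 - v * S1 - v * S1 + N * v ^ 2))
        = -(1 / 2) * ((N + αμ) * a * (u - (S0 / (N + αμ) - b / a * (v - S1 / (N + αμ)))) ^ 2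
          + (N + αμ) * (c - b ^ 2 / a) * (v - S1 / (N + αμ)) ^ 2
          + (t + (S00 - S0 * S0 / (N + αμ))) * a + 2 * (S01 - S0 * S1 / (N + αμ)) * b
          + (t + (S11 - S1 * S1 / (N + αμ))) * (b ^ 2 / a)
          + (t + (S11 - S1 * S1 / (N + αμ))) * (c - b ^ 2 / a)) := by
      intro S0 S1 S00 S01 S11
      field_simp
      ring
    calc _ = bgeConst t αμ αw / (2 * π) ^ N
          * ((a * c - b ^ 2) ^ ((αw - 2) / 2) * (a * c - b ^ 2) ^ ((N : ℝ) / 2)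
          * (exp (-(1 / 2) * (αμ * (a * u ^ 2 + 2 * b * (u * v) + c * v ^ 2) + t * (a + c)))
            * exp (-(1 / 2) * (a * (∑ k, x k 0 ^ 2 - u * ∑ k, x k 0 - u * ∑ k, x k 0 + N * u ^ 2)
          + 2 * b * (∑ k, x k 0 * x k 1 - v * ∑ k, x k 0 - u * ∑ k, x k 1 + N * (u * v))
          + c * (∑ k, x k 1 ^ 2 - v * ∑ k, x k 1 - v * ∑ k, x k 1 + N * v ^ 2))))) := by
            ring
      _ = _ := by
        rw [hpow, ← exp_add, hexp]
        simp only [shrunkScatter, sq]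

/-- The likelihood involves only `v` and `s = c - b ^ 2 / a`, as the variance of the second node is
`1 / s`. Hence the data raise only the exponent of `s`, the precision of `v` and the rate `R`; the
remaining parameters stay at their prior values. -/
theorem integral_gaussian_node_one {t αμ αw : ℝ} (ht : 0 < t) (hαμ : 0 < αμ) (hαw : 3 < αw) {N : ℕ}
    (y : Fin N → ℝ) :
    ∫ q, ∏ k, gaussianPDFReal q.1 q.2.toNNReal (y k) ∂((bgePrior t αμ αw).map (nodeMeanVar 1))
      = bgeConst t αμ αw / √(2 * π) ^ N * (√(2 * π / αμ) * √(2 * π / (N + αμ)) * √(2 * π / t)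
          * (Gamma ((αw - 2) / 2 + N / 2 + 1 / 2)
            * (2 / (t + shrunkScatter αμ y y)) ^ ((αw - 2) / 2 + N / 2 + 1 / 2))
          * (Gamma ((αw - 2) / 2 + 1) * (2 * t / (t * t - 0 ^ 2)) ^ ((αw - 2) / 2 + 1))) := by
  have hκ : 0 < (N : ℝ) + αμ := by positivity
  have hN : (0 : ℝ) ≤ N := N.cast_nonneg
  have h1 := shrunkScatter_self_nonneg hαμ y
  have hmeas : Measurable fun q : ℝ × ℝ => ∏ k, gaussianPDFReal q.1 q.2.toNNReal (y k) := by
    unfold gaussianPDFReal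
    fun_prop
  rw [integral_map measurable_nodeMeanVar_one.aemeasurable hmeas.aestronglyMeasurable]
  refine integral_bgePrior ht hαμ hαw (hmeas.comp measurable_nodeMeanVar_one)
    (div_pos (bgeConst_pos ht hαμ hαw) (by positivity))
    (by linarith) (by linarith) hαμ hκ ht (by simpa using mul_pos ht ht) (by linarith)
    (fun a b v => - (b / a * v)) ((∑ k, y k) / (N + αμ)) ?_
  intro u v a b c ha hs
  have e : a * c - b ^ 2 = a * (c - b ^ 2 / a) := by field_simp
  have hd : 0 < a * c - b ^ 2 := by rw [e]; exact mul_pos ha hs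
  rw [bgeDensity_eq_of_pos hαμ ha hd, Function.comp_apply, nodeMeanVar_one]
  simp only [Matrix.cons_val_one, Matrix.cons_val_fin_one]
  have hv : (a * c - b ^ 2)⁻¹ * a = (c - b ^ 2 / a)⁻¹ := by rw [e]; field_simp
  set s := c - b ^ 2 / a with hs_def
  have hg : ∀ k, gaussianPDFReal v (s⁻¹).toNNReal (y k)
      = s ^ (1 / 2 : ℝ) / √(2 * π) * exp (-(1 / 2) * (s * ((y k - v) * (y k - v)))) := by
    intro k
    rw [gaussianPDFReal, coe_toNNReal _ (inv_pos.2 hs).le, ← sqrt_eq_rpow,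
      ← div_eq_mul_inv (2 * π) s, sqrt_div (by positivity), inv_div]
    congr 2
    field_simp
  rw [hv]
  simp_rw [hg]
  rw [Finset.prod_mul_distrib, Finset.prod_const, Finset.card_univ, Fintype.card_fin,
    ← exp_sum, div_pow, ← rpow_natCast (s ^ (1 / 2 : ℝ)), ← rpow_mul hs.le,
    ← Finset.mul_sum, ← Finset.mul_sum, sum_sub_mul_sub, e, mul_rpow ha.le hs.le,
    rpow_add hs, show (1 / 2 : ℝ) * N = N / 2 by ring]
  have hc : c = s + b ^ 2 / a := by rw [hs_def]; ring
  have hexp : ∀ S0 S00 : ℝ,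
      -(1 / 2) * (αμ * (a * u ^ 2 + 2 * b * (u * v) + c * v ^ 2) + t * (a + c))
        + -(1 / 2) * (s * (S00 - v * S0 - v * S0 + N * (v * v)))
      = -(1 / 2) * (αμ * a * (u - -(b / a * v)) ^ 2
          + (N + αμ) * s * (v - S0 / (N + αμ)) ^ 2
          + t * a + 2 * 0 * b + t * (b ^ 2 / a) + (t + (S00 - S0 * S0 / (N + αμ))) * s) := by
    intro S0 S00
    rw [hc]
    field_simp
    ring
  rw [shrunkScatter, ← hexp, exp_add]
  ring

/-- The Bayes denominator cancels; the backward graph matters only through positivity of that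
denominator. -/
theorem logPosteriorRatio_eq {structPrior marginal : TwoNodeDAG → ℝ} (hprior : ∀ G, 0 < structPrior G)
    (hm : ∀ G, 0 < marginal G) :
    logPosteriorRatio structPrior marginal
      = log (structPrior TwoNodeDAG.forward) - log (structPrior TwoNodeDAG.empty)
        + (log (marginal TwoNodeDAG.forward) - log (marginal TwoNodeDAG.empty)) := by
  have hf := mul_pos (hprior TwoNodeDAG.forward) (hm TwoNodeDAG.forward)
  have he := mul_pos (hprior TwoNodeDAG.empty) (hm TwoNodeDAG.empty)
  have hb := mul_pos (hprior TwoNodeDAG.backward) (hm TwoNodeDAG.backward)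
  have hZ := add_pos (add_pos he hf) hb
  rw [logPosteriorRatio, posterior, posterior, div_div_div_cancel_right₀ hZ.ne',
    log_div hf.ne' he.ne', log_mul (hprior _).ne' (hm _).ne', log_mul (hprior _).ne' (hm _).ne']
  ring

/-- Here `T₁, T₂` are the regularized scatters, `D` the determinant and `k = N + αμ`. The powers of
`2π` growing with `N` cancel, as do all factors `k`, and `T₂` drops out of the numerator because
`-1/2 - e + (e + 1/2) = 0`. -/
theorem log_bge_bayesFactor {B k m t T₁ T₂ D G₁ G₂ G₃ e f : ℝ} (N : ℕ) (hB : 0 < B) (hk : 0 < k)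
    (hm : 0 < m) (ht : 0 < t) (hT₁ : 0 < T₁) (hT₂ : 0 < T₂) (hD : 0 < D) (hG₁ : 0 < G₁)
    (hG₂ : 0 < G₂) (hG₃ : 0 < G₃) :
    log (B / (2 * π) ^ N * (√(2 * π / k) * √(2 * π / k) * √(2 * π / T₂)
        * (G₁ * (2 / T₂) ^ e) * (G₂ * (2 * T₂ / D) ^ (e + 1 / 2))))
      - log ((B / √(2 * π) ^ N * (√(2 * π / m) * √(2 * π / k) * √(2 * π / t)
          * (G₁ * (2 / T₁) ^ e) * (G₃ * (2 * t / (t * t - 0 ^ 2)) ^ f)))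
        * (B / √(2 * π) ^ N * (√(2 * π / m) * √(2 * π / k) * √(2 * π / t)
          * (G₁ * (2 / T₂) ^ e) * (G₃ * (2 * t / (t * t - 0 ^ 2)) ^ f))))
      = (-log B - 3 / 2 * log (2 * π) + log m + log t + log 2 / 2 - 2 * log G₃
          - 2 * (f * (log 2 - log t)))
        + (log G₂ - log G₁) + e * (log T₁ + log T₂) - (e + 1 / 2) * log D := by
  have hπ : 0 < 2 * π := by positivity
  generalize 2 * π = w at *
  have h2t : 2 * t / (t * t - 0 ^ 2) = 2 / t := by field_simp; simp
  have lA : ∀ T, 0 < T → log (B / √w ^ N * (√(w / m) * √(w / k) * √(w / t)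
          * (G₁ * (2 / T) ^ e) * (G₃ * (2 / t) ^ f)))
      = log B - N * (log w / 2) + ((log w - log m) / 2 + (log w - log k) / 2
        + (log w - log t) / 2 + (log G₁ + e * (log 2 - log T))
        + (log G₃ + f * (log 2 - log t))) := by
    intro T hT
    rw [log_mul (by positivity) (by positivity), log_div (by positivity) (by positivity), log_pow,
      log_mul (by positivity) (by positivity), log_mul (by positivity) (by positivity),
      log_mul (by positivity) (by positivity), log_mul (by positivity) (by positivity),
      log_mul (by positivity) (by positivity), log_mul (by positivity) (by positivity),
      log_sqrt (by positivity), log_sqrt (by positivity), log_sqrt (by positivity),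
      log_sqrt (by positivity), log_rpow (by positivity), log_rpow (by positivity),
      log_div hπ.ne' hm.ne', log_div hπ.ne' hk.ne', log_div hπ.ne' ht.ne',
      log_div two_ne_zero hT.ne', log_div two_ne_zero ht.ne']
  have hA : ∀ T, 0 < T → B / √w ^ N * (√(w / m) * √(w / k) * √(w / t)
          * (G₁ * (2 / T) ^ e) * (G₃ * (2 / t) ^ f)) ≠ 0 := fun T hT => by positivity
  have lM : log (B / w ^ N * (√(w / k) * √(w / k) * √(w / T₂)
        * (G₁ * (2 / T₂) ^ e) * (G₂ * (2 * T₂ / D) ^ (e + 1 / 2))))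
      = log B - N * log w + ((log w - log k) / 2 + (log w - log k) / 2
        + (log w - log T₂) / 2 + (log G₁ + e * (log 2 - log T₂))
        + (log G₂ + (e + 1 / 2) * (log (2 * T₂) - log D))) := by
    rw [log_mul (by positivity) (by positivity), log_div (by positivity) (by positivity), log_pow,
      log_mul (by positivity) (by positivity), log_mul (by positivity) (by positivity),
      log_mul (by positivity) (by positivity), log_mul (by positivity) (by positivity),
      log_mul (by positivity) (by positivity), log_mul (by positivity) (by positivity),
      log_sqrt (by positivity), log_sqrt (by positivity),
      log_rpow (by positivity), log_rpow (by positivity),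
      log_div hπ.ne' hk.ne', log_div hπ.ne' hT₂.ne',
      log_div two_ne_zero hT₂.ne', log_div (by positivity) hD.ne']
  rw [h2t, log_mul (hA T₁ hT₁) (hA T₂ hT₂), lA T₁ hT₁, lA T₂ hT₂, lM, log_mul two_ne_zero hT₂.ne']
  ring

/-- The witness `c₀` collects everything independent of `N` and the data: structure prior,
`bgeConst` and prior Gamma factors. Its value never matters. -/
theorem bge_logPosteriorRatio {structPrior : TwoNodeDAG → ℝ} (hprior : ∀ G, 0 < structPrior G)
    {t αμ αw : ℝ} (ht : 0 < t) (hαμ : 0 < αμ) (hαw : 3 < αw) :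
    ∃ c₀ : ℝ, ∀ (N : ℕ) (x : Fin N → Fin 2 → ℝ),
      logPosteriorRatio structPrior (bgeMarginal t αμ αw x)
        = c₀ + (log (Gamma ((N + αw) / 2)) - log (Gamma ((N + αw) / 2 - 1 / 2)))
          + (N + αw - 1) / 2 * (log (t + shrunkScatter αμ (fun k => x k 0) (fun k => x k 0))
            + log (t + shrunkScatter αμ (fun k => x k 1) (fun k => x k 1)))
          - (N + αw) / 2 * log ((t + shrunkScatter αμ (fun k => x k 0) (fun k => x k 0))
            * (t + shrunkScatter αμ (fun k => x k 1) (fun k => x k 1))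
            - shrunkScatter αμ (fun k => x k 0) (fun k => x k 1) ^ 2) := by
  refine ⟨log (structPrior TwoNodeDAG.forward) - log (structPrior TwoNodeDAG.empty)
    + (-log (bgeConst t αμ αw) - 3 / 2 * log (2 * π) + log αμ + log t + log 2 / 2
      - 2 * log (Gamma ((αw - 2) / 2 + 1)) - 2 * (((αw - 2) / 2 + 1) * (log 2 - log t))),
    fun N x => ?_⟩
  have hN : (0 : ℝ) ≤ N := N.cast_nonneg
  have hκ : 0 < (N : ℝ) + αμ := by positivity
  have hB := bgeConst_pos ht hαμ hαw
  have h0 := shrunkScatter_self_nonneg hαμ fun k => x k 0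
  have h1 := shrunkScatter_self_nonneg hαμ fun k => x k 1
  have hT₀ : 0 < t + shrunkScatter αμ (fun k => x k 0) (fun k => x k 0) := by linarith
  have hT₁ : 0 < t + shrunkScatter αμ (fun k => x k 1) (fun k => x k 1) := by linarith
  have hD := (by positivity : 0 < t ^ 2).trans_le
    (scatter_det_ge ht hαμ (fun k => x k 0) (fun k => x k 1))
  have hG₁ : 0 < Gamma ((αw - 2) / 2 + N / 2 + 1 / 2) := Gamma_pos_of_pos (by linarith)
  have hG₂ : 0 < Gamma ((αw - 2) / 2 + N / 2 + 1) := Gamma_pos_of_pos (by linarith)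
  have hG₃ : 0 < Gamma ((αw - 2) / 2 + 1) := Gamma_pos_of_pos (by linarith)
  -- S-finiteness suffices to factor the integral over the product prior; the total mass of the
  -- prior is not needed.
  have : SFinite (bgePrior t αμ αw) := by rw [bgePrior]; infer_instance
  have hempty : bgeMarginal t αμ αw x TwoNodeDAG.empty
      = (∫ q, ∏ k, gaussianPDFReal q.1 q.2.toNNReal (x k 0)
            ∂((bgePrior t αμ αw).map (nodeMeanVar 1)))
        * ∫ q, ∏ k, gaussianPDFReal q.1 q.2.toNNReal (x k 1)
            ∂((bgePrior t αμ αw).map (nodeMeanVar 1)) := by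
    rw [bgeMarginal, bgePriorEmpty, map_nodeMeanVar_zero hαμ, ← integral_prod_mul]
    simp_rw [Finset.prod_mul_distrib]
  rw [integral_gaussian_node_one ht hαμ hαw, integral_gaussian_node_one ht hαμ hαw] at hempty
  have hfw := bgeMarginal_forward ht hαμ hαw x
  have he : (αw - 2) / 2 + (N : ℝ) / 2 + 1 = (αw - 2) / 2 + N / 2 + 1 / 2 + 1 / 2 := by ring
  have hπt : 0 < 2 * t / (t * t - 0 ^ 2) := by
    rw [show t * t - 0 ^ 2 = t * t by ring]; positivity
  have hE0 : 0 < bgeMarginal t αμ αw x TwoNodeDAG.empty := by rw [hempty]; positivity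
  have hF0 : 0 < bgeMarginal t αμ αw x TwoNodeDAG.forward := by rw [hfw]; positivity
  rw [logPosteriorRatio_eq hprior fun G => by cases G; exacts [hE0, hF0, hF0], hempty, hfw, he,
    log_bge_bayesFactor N hB hκ hαμ ht hT₀ hT₁ hD hG₁ (he ▸ hG₂) hG₃,
    show (αw - 2) / 2 + (N : ℝ) / 2 + 1 / 2 + 1 / 2 = (N + αw) / 2 by ring,
    show (αw - 2) / 2 + (N : ℝ) / 2 + 1 / 2 = (N + αw) / 2 - 1 / 2 by ring]
  ring

/-- Midpoint log-convexity of Gamma on `[a - 1/2, a + 1/2]` gives the upper bound `log (a - 1/2) /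
2`, and on `[a - 1, a]` the lower bound `log (a - 1) / 2`, which is nonnegative for `a ≥ 2`. -/
theorem log_Gamma_sub_log_Gamma_half {a : ℝ} (ha : 2 ≤ a) :
    0 ≤ log (Gamma a) - log (Gamma (a - 1 / 2))
      ∧ log (Gamma a) - log (Gamma (a - 1 / 2)) ≤ log a := by
  have hc := convexOn_log_Gamma.2
  have h1 := hc (x := a - 1 / 2) (Set.mem_Ioi.2 (by linarith)) (y := a + 1 / 2)
    (Set.mem_Ioi.2 (by linarith)) (a := 1 / 2) (b := 1 / 2) (by norm_num) (by norm_num)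
    (by norm_num)
  have h2 := hc (x := a - 1) (Set.mem_Ioi.2 (by linarith)) (y := a)
    (Set.mem_Ioi.2 (by linarith)) (a := 1 / 2) (b := 1 / 2) (by norm_num) (by norm_num)
    (by norm_num)
  simp only [smul_eq_mul, Function.comp_apply] at h1 h2
  rw [show 1 / 2 * (a - 1 / 2) + 1 / 2 * (a + 1 / 2) = a by ring,
    show a + 1 / 2 = a - 1 / 2 + 1 by ring, Gamma_add_one (by linarith),
    log_mul (by linarith) (Gamma_pos_of_pos (by linarith)).ne'] at h1
  have e : Gamma a = (a - 1) * Gamma (a - 1) := by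
    rw [← Gamma_add_one (by linarith)]; congr 1; ring
  have e' : log (Gamma a) = log (a - 1) + log (Gamma (a - 1)) := by
    rw [e, log_mul (by linarith) (Gamma_pos_of_pos (by linarith)).ne']
  rw [show 1 / 2 * (a - 1) + 1 / 2 * a = a - 1 / 2 by ring] at h2
  have h3 : 0 ≤ log (a - 1) := log_nonneg (by linarith)
  have h4 : log (a - 1 / 2) ≤ log a := log_le_log (by linarith) (by linarith)
  have h5 : 0 ≤ log a := log_nonneg (by linarith)
  constructor <;> linarith

/-! ### The limit under the BGe score -/

/-- First and second order monomials in the two variables. -/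
def bgeFeature : Fin 5 → (Fin 2 → ℝ) → ℝ :=
  ![fun z => z 0 * z 0, fun z => z 0 * z 1, fun z => z 1 * z 1, fun z => z 0, fun z => z 1]

/-- The mean log posterior ratio as a function of the sample means of `bgeFeature`. -/
noncomputable def bgeRate (c₀ t αμ αw : ℝ) (N : ℕ) (m : Fin 5 → ℝ) : ℝ :=
  (c₀ + (log (Gamma ((N + αw) / 2)) - log (Gamma ((N + αw) / 2 - 1 / 2))) - log N) / N
    + (N + αw - 1) / (2 * N) * (log (t / N + (m 0 - N / (N + αμ) * (m 3 * m 3)))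
      + log (t / N + (m 2 - N / (N + αμ) * (m 4 * m 4))))
    - (N + αw) / (2 * N) * log ((t / N + (m 0 - N / (N + αμ) * (m 3 * m 3)))
      * (t / N + (m 2 - N / (N + αμ) * (m 4 * m 4))) - (m 1 - N / (N + αμ) * (m 3 * m 4)) ^ 2)

theorem shrunkScatter_eq_sampleMean {αμ : ℝ} (hαμ : 0 < αμ) {N : ℕ} (hN : 0 < N)
    (y z : Fin N → ℝ) :
    shrunkScatter αμ y z
      = N * ((∑ k, y k * z k) / N - N / (N + αμ) * ((∑ k, y k) / N * ((∑ k, z k) / N))) := by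
  have hN' : (0 : ℝ) < N := Nat.cast_pos.2 hN
  rw [shrunkScatter]
  field_simp

theorem abs_log_le {x lo up : ℝ} (hlo : 0 < lo) (h1 : lo ≤ x) (h2 : x ≤ up) :
    |log x| ≤ |log lo| + up := by
  have hx := hlo.trans_le h1
  have h3 := log_le_log hlo h1
  have h4 := log_le_sub_one_of_pos hx
  rw [abs_le]
  constructor
  · linarith [neg_abs_le (log lo)]
  · linarith [abs_nonneg (log lo)]

/-- Each regularized scatter is `N` times, and the determinant `N ^ 2` times, its normalized
version. Extracting these factors from the logarithms leaves `(N + αw - 1) * log N - (N + αw) * log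
N = -log N`, the correction in `bgeRate`. -/
theorem bgeRate_eq {t αμ αw : ℝ} (ht : 0 < t) (hαμ : 0 < αμ) (c₀ : ℝ) {N : ℕ} (hN : 0 < N)
    (x : Fin N → Fin 2 → ℝ) :
    1 / (N : ℝ) * (c₀ + (log (Gamma ((N + αw) / 2)) - log (Gamma ((N + αw) / 2 - 1 / 2)))
          + (N + αw - 1) / 2 * (log (t + shrunkScatter αμ (fun k => x k 0) (fun k => x k 0))
            + log (t + shrunkScatter αμ (fun k => x k 1) (fun k => x k 1)))
          - (N + αw) / 2 * log ((t + shrunkScatter αμ (fun k => x k 0) (fun k => x k 0))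
            * (t + shrunkScatter αμ (fun k => x k 1) (fun k => x k 1))
            - shrunkScatter αμ (fun k => x k 0) (fun k => x k 1) ^ 2))
      = bgeRate c₀ t αμ αw N (sampleMean bgeFeature x) := by
  have hN' : (0 : ℝ) < N := Nat.cast_pos.2 hN
  have h0 := shrunkScatter_self_nonneg hαμ fun k => x k 0
  have h1 := shrunkScatter_self_nonneg hαμ fun k => x k 1
  have hD := (by positivity : 0 < t ^ 2).trans_le
    (scatter_det_ge ht hαμ (fun k => x k 0) (fun k => x k 1))
  simp only [bgeRate, sampleMean, bgeFeature, Matrix.cons_val]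
  rw [shrunkScatter_eq_sampleMean hαμ hN] at h0 h1
  simp only [shrunkScatter_eq_sampleMean hαμ hN] at hD
  simp only [shrunkScatter_eq_sampleMean hαμ hN]
  set a := (∑ k, x k 0 * x k 0) / (N : ℝ)
    - N / (N + αμ) * ((∑ k, x k 0) / N * ((∑ k, x k 0) / N))
  set b := (∑ k, x k 0 * x k 1) / (N : ℝ)
    - N / (N + αμ) * ((∑ k, x k 0) / N * ((∑ k, x k 1) / N))
  set c := (∑ k, x k 1 * x k 1) / (N : ℝ)
    - N / (N + αμ) * ((∑ k, x k 1) / N * ((∑ k, x k 1) / N))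
  have ea : t + N * a = N * (t / N + a) := by field_simp
  have ec : t + N * c = N * (t / N + c) := by field_simp
  have ha : 0 < t / N + a := pos_of_mul_pos_right (by rw [← ea]; linarith) hN'.le
  have hc : 0 < t / N + c := pos_of_mul_pos_right (by rw [← ec]; linarith) hN'.le
  have ed : (t + N * a) * (t + N * c) - (N * b) ^ 2
      = N ^ 2 * ((t / N + a) * (t / N + c) - b ^ 2) := by rw [ea, ec]; ring
  have hd : 0 < (t / N + a) * (t / N + c) - b ^ 2 :=
    pos_of_mul_pos_right (by rw [← ed]; exact hD) (by positivity : (0 : ℝ) ≤ (N : ℝ) ^ 2)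
  rw [ed, ea, ec, log_mul hN'.ne' ha.ne', log_mul hN'.ne' hc.ne', log_mul (by positivity) hd.ne',
    log_pow]
  field_simp
  push_cast
  ring

/-- The lower bounds `t / N` cost `log N`, the upper bounds are linear in the second moments, and
`d` is squeezed between `(t / N) ^ 2` and `u * v`. The coefficients of the logarithms stay below
`αw` because `N ≥ 1` and `αw > 3`. The outcome has the shape required by
`tendsto_integral_sampleMean`. -/
theorem abs_logScatter_rate_le {t αw c₀ : ℝ} (ht : 0 < t) (hαw : 3 < αw) {N : ℕ} (hN : 0 < N)
    {u v d S : ℝ} (hS : 0 ≤ S) (hu : t / N ≤ u) (hu' : u ≤ t + S) (hv : t / N ≤ v)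
    (hv' : v ≤ t + S) (hd : (t / N) ^ 2 ≤ d) (hd' : d ≤ u * v) :
    |(c₀ + (log (Gamma ((N + αw) / 2)) - log (Gamma ((N + αw) / 2 - 1 / 2))) - log N) / N
        + (N + αw - 1) / (2 * N) * (log u + log v) - (N + αw) / (2 * N) * log d|
      ≤ ((|c₀| + αw + 2) + 4 * αw * (|log t| + t + 2)) * (1 + log N + S) := by
  have hN' : (0 : ℝ) < N := Nat.cast_pos.2 hN
  have hN1 : (1 : ℝ) ≤ N := Nat.one_le_cast.2 hN
  have hlogN := log_nonneg hN1
  have htN0 : 0 < t / N := by positivity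
  have hupos : 0 < u := htN0.trans_le hu
  have hvpos : 0 < v := htN0.trans_le hv
  have hdpos : 0 < d := (by positivity : 0 < (t / N) ^ 2).trans_le hd
  have ltN : |log (t / N)| ≤ |log t| + log N := by
    rw [log_div ht.ne' hN'.ne']
    have := abs_sub (log t) (log N)
    rwa [abs_of_nonneg hlogN] at this
  have lu : |log u| ≤ |log t| + log N + (t + S) :=
    (abs_log_le htN0 hu hu').trans (by linarith)
  have lv : |log v| ≤ |log t| + log N + (t + S) :=
    (abs_log_le htN0 hv hv').trans (by linarith)
  have ld : |log d| ≤ 2 * (|log t| + log N + (t + S)) := by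
    have up := log_le_log hdpos hd'
    have low := log_le_log (by positivity) hd
    rw [log_mul hupos.ne' hvpos.ne'] at up
    rw [log_pow] at low
    have h1 := neg_abs_le (log (t / N))
    have h2 := le_abs_self (log u)
    have h3 := le_abs_self (log v)
    rw [abs_le]
    push_cast at low
    constructor <;> linarith
  obtain ⟨g0, g1⟩ := log_Gamma_sub_log_Gamma_half (a := (N + αw) / 2) (by linarith)
  have g2 : log (((N : ℝ) + αw) / 2) ≤ (N + αw) / 2 - 1 :=
    log_le_sub_one_of_pos (by linarith)
  have hlogN2 : log (N : ℝ) ≤ N - 1 := log_le_sub_one_of_pos hN'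
  have hαN : αw * 1 ≤ αw * N := mul_le_mul_of_nonneg_left hN1 (by linarith)
  have t1 : |(c₀ + (log (Gamma ((N + αw) / 2)) - log (Gamma ((N + αw) / 2 - 1 / 2)))
      - log N) / N| ≤ |c₀| + αw + 2 := by
    rw [abs_div, abs_of_pos hN', div_le_iff₀ hN']
    have hc₀ := abs_nonneg c₀
    have h1 := le_abs_self c₀
    have h2 := neg_abs_le c₀
    have h3 : |c₀| * 1 ≤ |c₀| * N := mul_le_mul_of_nonneg_left hN1 hc₀
    rw [abs_le]
    constructor <;> linarith
  have hk1 : |(N + αw - 1) / (2 * N)| ≤ αw := by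
    rw [abs_of_nonneg (div_nonneg (by linarith) (by linarith)), div_le_iff₀ (by linarith)]
    nlinarith
  have hk2 : |(N + αw) / (2 * N)| ≤ αw := by
    rw [abs_of_nonneg (div_nonneg (by linarith) (by linarith)), div_le_iff₀ (by linarith)]
    nlinarith
  have t2 : |(N + αw - 1) / (2 * N) * (log u + log v)|
      ≤ αw * (2 * (|log t| + log N + (t + S))) := by
    rw [abs_mul]
    exact mul_le_mul hk1 ((abs_add_le _ _).trans (by linarith)) (abs_nonneg _) (by linarith)
  have t3 : |(N + αw) / (2 * N) * log d| ≤ αw * (2 * (|log t| + log N + (t + S))) := by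
    rw [abs_mul]
    exact mul_le_mul hk2 ld (abs_nonneg _) (by linarith)
  have hL := abs_nonneg (log t)
  calc _ ≤ (|c₀| + αw + 2) + αw * (2 * (|log t| + log N + (t + S)))
        + αw * (2 * (|log t| + log N + (t + S))) :=
      (abs_sub _ _).trans (add_le_add ((abs_add_le _ _).trans (add_le_add t1 t2)) t3)
    _ = (|c₀| + αw + 2) * 1 + 4 * αw * (|log t| + t + (log N + S)) := by ring
    _ ≤ (|c₀| + αw + 2) * (1 + log N + S)
        + 4 * αw * ((|log t| + t + 2) * (1 + log N + S)) := by
      have h5 : 0 ≤ |log t| + t := by linarith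
      have h6 : 0 ≤ log N + S := by linarith
      gcongr
      · linarith
      · nlinarith [mul_nonneg h5 h6]
    _ = _ := by ring

theorem abs_bgeRate_le {t αμ αw : ℝ} (ht : 0 < t) (hαμ : 0 < αμ) (hαw : 3 < αw) (c₀ : ℝ) {N : ℕ}
    (hN : 0 < N) (x : Fin N → Fin 2 → ℝ) :
    |bgeRate c₀ t αμ αw N (sampleMean bgeFeature x)|
      ≤ ((|c₀| + αw + 2) + 4 * αw * (|log t| + t + 2))
        * (1 + log N + ∑ j, |sampleMean bgeFeature x j|) := by
  have hN' : (0 : ℝ) < N := Nat.cast_pos.2 hN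
  have hN1 : (1 : ℝ) ≤ N := Nat.one_le_cast.2 hN
  have h0 := shrunkScatter_self_nonneg hαμ fun k => x k 0
  have h1 := shrunkScatter_self_nonneg hαμ fun k => x k 1
  have hD := scatter_det_ge ht hαμ (fun k => x k 0) (fun k => x k 1)
  have hp0 : 0 ≤ (∑ k, x k 0 * x k 0) / (N : ℝ) :=
    div_nonneg (Finset.sum_nonneg fun k _ => mul_self_nonneg _) hN'.le
  have hp2 : 0 ≤ (∑ k, x k 1 * x k 1) / (N : ℝ) :=
    div_nonneg (Finset.sum_nonneg fun k _ => mul_self_nonneg _) hN'.le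
  have hS : (∑ k, x k 0 * x k 0) / (N : ℝ) + (∑ k, x k 1 * x k 1) / N
      ≤ ∑ j, |sampleMean bgeFeature x j| := by
    rw [Fin.sum_univ_five]
    have := le_abs_self (sampleMean bgeFeature x 0)
    have := le_abs_self (sampleMean bgeFeature x 2)
    have := abs_nonneg (sampleMean bgeFeature x 1)
    have := abs_nonneg (sampleMean bgeFeature x 3)
    have := abs_nonneg (sampleMean bgeFeature x 4)
    have e0 : sampleMean bgeFeature x 0 = (∑ k, x k 0 * x k 0) / N := rfl
    have e2 : sampleMean bgeFeature x 2 = (∑ k, x k 1 * x k 1) / N := rfl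
    linarith
  have htN : t / N ≤ t := div_le_self ht.le hN1
  have hr : 0 ≤ (N : ℝ) / (N + αμ) := by positivity
  have q0 := mul_nonneg hr (mul_self_nonneg ((∑ k, x k 0) / (N : ℝ)))
  have q1 := mul_nonneg hr (mul_self_nonneg ((∑ k, x k 1) / (N : ℝ)))
  have b0 : (∑ k, x k 0 * x k 0) / (N : ℝ)
      - N / (N + αμ) * ((∑ k, x k 0) / N * ((∑ k, x k 0) / N))
      ≤ ∑ j, |sampleMean bgeFeature x j| := by linarith
  have b2 : (∑ k, x k 1 * x k 1) / (N : ℝ)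
      - N / (N + αμ) * ((∑ k, x k 1) / N * ((∑ k, x k 1) / N))
      ≤ ∑ j, |sampleMean bgeFeature x j| := by linarith
  rw [shrunkScatter_eq_sampleMean hαμ hN] at h0 h1
  simp only [shrunkScatter_eq_sampleMean hαμ hN] at hD
  have h0' := nonneg_of_mul_nonneg_right h0 hN'
  have h1' := nonneg_of_mul_nonneg_right h1 hN'
  refine abs_logScatter_rate_le ht hαw hN (by linarith) ?_ ?_ ?_ ?_ ?_ ?_
  · exact le_add_of_nonneg_right h0'
  · exact add_le_add htN b0
  · exact le_add_of_nonneg_right h1'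
  · exact add_le_add htN b2
  · simp only [sampleMean, bgeFeature, Matrix.cons_val]
    rw [div_pow, div_le_iff₀ (by positivity)]
    refine hD.trans_eq ?_
    field_simp
  · exact sub_le_self _ (sq_nonneg _)

/-- The regularization `t / N` and the shrinkage disappear, both logarithm coefficients tend to `1 /
2`, and the Gamma ratio is `O(log N)`. Positivity at the limit point makes the logarithms continuous
there. -/
theorem tendsto_bgeRate {t αμ αw : ℝ} (hαw : 3 < αw) (c₀ : ℝ)
    {e : Fin 5 → ℝ} (h0 : 0 < e 0 - e 3 * e 3) (h1 : 0 < e 2 - e 4 * e 4)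
    (hd : 0 < (e 0 - e 3 * e 3) * (e 2 - e 4 * e 4) - (e 1 - e 3 * e 4) ^ 2) :
    Tendsto (fun p : ℕ × (Fin 5 → ℝ) => bgeRate c₀ t αμ αw p.1 p.2) (atTop ×ˢ 𝓝 e)
      (𝓝 (1 / 2 * log ((e 0 - e 3 * e 3) * (e 2 - e 4 * e 4)
        / ((e 0 - e 3 * e 3) * (e 2 - e 4 * e 4) - (e 1 - e 3 * e 4) ^ 2)))) := by
  have hcoord : ∀ j, Tendsto (fun p : ℕ × (Fin 5 → ℝ) => p.2 j) (atTop ×ˢ 𝓝 e) (𝓝 (e j)) :=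
    fun j => ((continuous_apply j).tendsto e).comp tendsto_snd
  have hfst : ∀ {f : ℕ → ℝ} {l : ℝ}, Tendsto f atTop (𝓝 l) →
      Tendsto (fun p : ℕ × (Fin 5 → ℝ) => f p.1) (atTop ×ˢ 𝓝 e) (𝓝 l) :=
    fun h => h.comp tendsto_fst
  have hinv : Tendsto (fun N : ℕ => (1 : ℝ) / N) atTop (𝓝 0) := tendsto_one_div_atTop_nhds_zero_nat
  have htN : Tendsto (fun N : ℕ => t / (N : ℝ)) atTop (𝓝 0) := tendsto_const_div_atTop_nhds_zero_nat t
  have hr : Tendsto (fun N : ℕ => (N : ℝ) / (N + αμ)) atTop (𝓝 1) :=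
    tendsto_natCast_div_add_atTop αμ
  have hlog : Tendsto (fun N : ℕ => log N / N) atTop (𝓝 0) := by
    have := (Real.isLittleO_log_id_atTop.tendsto_div_nhds_zero).comp
      (tendsto_natCast_atTop_atTop (R := ℝ))
    simpa [Function.comp_def] using this
  have hhalf : Tendsto (fun N : ℕ => ((N : ℝ) + αw) / (2 * N)) atTop (𝓝 (1 / 2)) := by
    have h := (hinv.const_mul (αw / 2)).const_add (1 / 2)
    rw [mul_zero, add_zero] at h
    refine h.congr' ?_
    filter_upwards [eventually_gt_atTop 0] with N hN
    have : (0 : ℝ) < N := Nat.cast_pos.2 hN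
    field_simp
  have hhalf' : Tendsto (fun N : ℕ => ((N : ℝ) + αw - 1) / (2 * N)) atTop (𝓝 (1 / 2)) := by
    have h := hhalf.sub (hinv.const_mul (1 / 2))
    rw [mul_zero, sub_zero] at h
    refine h.congr fun N => ?_
    ring
  have hΔ : Tendsto (fun N : ℕ => (log (Gamma ((N + αw) / 2))
      - log (Gamma ((N + αw) / 2 - 1 / 2))) / N) atTop (𝓝 0) := by
    have hup : Tendsto (fun N : ℕ => log N / N + αw * (1 / N)) atTop (𝓝 0) := by
      simpa using hlog.add (hinv.const_mul αw)
    refine tendsto_of_tendsto_of_tendsto_of_le_of_le' tendsto_const_nhds hup ?_ ?_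
    · filter_upwards [eventually_gt_atTop 0] with N hN
      have hN1 : (1 : ℝ) ≤ N := Nat.one_le_cast.2 hN
      exact div_nonneg (log_Gamma_sub_log_Gamma_half (by linarith)).1 (by linarith)
    · filter_upwards [eventually_gt_atTop 0] with N hN
      have hN1 : (1 : ℝ) ≤ N := Nat.one_le_cast.2 hN
      have hN0 : (0 : ℝ) < N := by linarith
      have h2 := (log_Gamma_sub_log_Gamma_half (a := (N + αw) / 2) (by linarith)).2
      have h3 : log (((N : ℝ) + αw) / 2) ≤ log N + αw := by
        have h4 : log (((N : ℝ) + αw) / 2) ≤ log (N * (1 + αw)) :=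
          log_le_log (by linarith) (by nlinarith)
        rw [log_mul hN0.ne' (by linarith)] at h4
        have h5 := log_le_sub_one_of_pos (by linarith : 0 < 1 + αw)
        linarith
      calc _ ≤ (log N + αw) / N := by gcongr; linarith
        _ = _ := by ring
  have hc : Tendsto (fun N : ℕ => (c₀ + (log (Gamma ((N + αw) / 2))
      - log (Gamma ((N + αw) / 2 - 1 / 2))) - log N) / N) atTop (𝓝 0) := by
    have h := ((hinv.const_mul c₀).add hΔ).sub hlog
    simp only [mul_zero, add_zero, sub_zero] at h
    refine h.congr fun N => ?_
    ring
  have ha := (hfst htN).add ((hcoord 0).sub ((hfst hr).mul ((hcoord 3).mul (hcoord 3))))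
  have hb := (hcoord 1).sub ((hfst hr).mul ((hcoord 3).mul (hcoord 4)))
  have hcc := (hfst htN).add ((hcoord 2).sub ((hfst hr).mul ((hcoord 4).mul (hcoord 4))))
  have hdd := (ha.mul hcc).sub (hb.pow 2)
  rw [one_mul, zero_add] at ha hcc
  simp only [one_mul, zero_add] at hdd
  have h := ((hfst hc).add ((hfst hhalf').mul ((ha.log h0.ne').add (hcc.log h1.ne')))).sub
    ((hfst hhalf).mul (hdd.log hd.ne'))
  have hl : 1 / 2 * log ((e 0 - e 3 * e 3) * (e 2 - e 4 * e 4)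
        / ((e 0 - e 3 * e 3) * (e 2 - e 4 * e 4) - (e 1 - e 3 * e 4) ^ 2))
      = 0 + 1 / 2 * (log (e 0 - e 3 * e 3) + log (e 2 - e 4 * e 4))
        - 1 / 2 * log ((e 0 - e 3 * e 3) * (e 2 - e 4 * e 4) - (e 1 - e 3 * e 4) ^ 2) := by
    rw [log_div (mul_pos h0 h1).ne' hd.ne', log_mul h0.ne' h1.ne']
    ring
  rw [hl]
  exact h

theorem measurable_bgeFeature (j : Fin 5) : Measurable (bgeFeature j) := by
  fin_cases j
  · exact (by fun_prop : Measurable fun z : Fin 2 → ℝ => z 0 * z 0)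
  · exact (by fun_prop : Measurable fun z : Fin 2 → ℝ => z 0 * z 1)
  · exact (by fun_prop : Measurable fun z : Fin 2 → ℝ => z 1 * z 1)
  · exact (by fun_prop : Measurable fun z : Fin 2 → ℝ => z 0)
  · exact (by fun_prop : Measurable fun z : Fin 2 → ℝ => z 1)

theorem measurable_bgeRate (c₀ t αμ αw : ℝ) (N : ℕ) :
    Measurable fun x : Fin N → Fin 2 → ℝ => bgeRate c₀ t αμ αw N (sampleMean bgeFeature x) := by
  have h : ∀ j, Measurable fun x : Fin N → Fin 2 → ℝ => sampleMean bgeFeature x j := by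
    intro j
    have hj := measurable_bgeFeature j
    unfold sampleMean
    fun_prop
  unfold bgeRate
  have := h 0
  have := h 1
  have := h 2
  have := h 3
  have := h 4
  fun_prop

theorem tendsto_rBGe {structPrior : TwoNodeDAG → ℝ} (hprior : ∀ G, 0 < structPrior G)
    {t αμ αw : ℝ} (ht : 0 < t) (hαμ : 0 < αμ) (hαw : 3 < αw) (Q : Measure (Fin 2 → ℝ))
    [IsProbabilityMeasure Q] (hQ : ∀ j, MemLp (bgeFeature j) 2 Q)
    {S₀₀ S₀₁ S₁₁ : ℝ} (hS₀₀ : S₀₀ = ∫ z, z 0 * z 0 ∂Q - (∫ z, z 0 ∂Q) * ∫ z, z 0 ∂Q)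
    (hS₀₁ : S₀₁ = ∫ z, z 0 * z 1 ∂Q - (∫ z, z 0 ∂Q) * ∫ z, z 1 ∂Q)
    (hS₁₁ : S₁₁ = ∫ z, z 1 * z 1 ∂Q - (∫ z, z 1 ∂Q) * ∫ z, z 1 ∂Q)
    (h0 : 0 < S₀₀) (h1 : 0 < S₁₁) (hd : 0 < S₀₀ * S₁₁ - S₀₁ ^ 2) :
    (∀ N : ℕ, Integrable (fun x : Fin N → Fin 2 → ℝ =>
        logPosteriorRatio structPrior (bgeMarginal t αμ αw x)) (Measure.pi fun _ => Q))
      ∧ Tendsto (rBGe structPrior t αμ αw Q) atTop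
          (𝓝 (1 / 2 * log (S₀₀ * S₁₁ / (S₀₀ * S₁₁ - S₀₁ ^ 2)))) := by
  obtain ⟨c₀, hc₀⟩ := bge_logPosteriorRatio hprior ht hαμ hαw
  obtain ⟨K, hK0, hK⟩ : ∃ K, 0 ≤ K ∧ ∀ N : ℕ, 0 < N → ∀ x : Fin N → Fin 2 → ℝ,
      |bgeRate c₀ t αμ αw N (sampleMean bgeFeature x)|
        ≤ K * (1 + log N + ∑ j, |sampleMean bgeFeature x j|) :=
    ⟨_, by positivity, fun N hN x => abs_bgeRate_le ht hαμ hαw c₀ hN x⟩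
  have hrate : ∀ N : ℕ, 0 < N → ∀ x : Fin N → Fin 2 → ℝ,
      1 / (N : ℝ) * logPosteriorRatio structPrior (bgeMarginal t αμ αw x)
        = bgeRate c₀ t αμ αw N (sampleMean bgeFeature x) := fun N hN x => by
    rw [hc₀, bgeRate_eq ht hαμ c₀ hN]
  have hint : ∀ N : ℕ, 0 < N → Integrable (fun x : Fin N → Fin 2 → ℝ =>
      bgeRate c₀ t αμ αw N (sampleMean bgeFeature x)) (Measure.pi fun _ => Q) := fun N hN =>
    integrable_of_le_sampleMean hQ (measurable_bgeRate c₀ t αμ αw N).aestronglyMeasurable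
      (C := K * (1 + log N)) (K := K) fun x => (hK N hN x).trans_eq (by ring)
  refine ⟨fun N => ?_, ?_⟩
  · rcases N.eq_zero_or_pos with rfl | hN
    -- For `N = 0` there is only one data set, so the integrand is constant.
    · have e : (fun x : Fin 0 → Fin 2 → ℝ =>
          logPosteriorRatio structPrior (bgeMarginal t αμ αw x))
          = fun _ => logPosteriorRatio structPrior
            (bgeMarginal t αμ αw (default : Fin 0 → Fin 2 → ℝ)) := by
        ext x; rw [Subsingleton.elim x default]
      rw [e]
      exact integrable_const _
    · have hN' : (N : ℝ) ≠ 0 := (Nat.cast_pos.2 hN).ne'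
      refine ((hint N hN).const_mul (N : ℝ)).congr (ae_of_all _ fun x => ?_)
      simp only
      rw [← hrate N hN x]
      field_simp
  · subst hS₀₀ hS₀₁ hS₁₁
    have hlim := tendsto_bgeRate (t := t) (αμ := αμ) hαw c₀ (e := fun j => ∫ z, bgeFeature j z ∂Q) h0 h1 hd
    have h := tendsto_integral_sampleMean hQ hlim hK0 hK hint
    refine h.congr' ?_
    filter_upwards [eventually_gt_atTop 0] with N hN
    rw [rBGe, ← integral_const_mul]
    exact integral_congr_ae (ae_of_all _ fun x => (hrate N hN x).symm)

/-! ### The BDe marginal likelihoods in closed form -/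

/-- The normalizing constant in the Dirichlet density. -/
noncomputable def dirichletConst (α : Fin 4 → ℝ) : ℝ := Gamma (∑ i, α i) / ∏ i, Gamma (α i)

theorem dirichletConst_pos {α : Fin 4 → ℝ} (hα : ∀ i, 0 < α i) : 0 < dirichletConst α :=
  div_pos (Gamma_pos_of_pos (Finset.sum_pos (fun i _ => hα i) Finset.univ_nonempty))
    (Finset.prod_pos fun i _ => Gamma_pos_of_pos (hα i))

theorem dirichletPDF_eq (α : Fin 4 → ℝ) (x y z : ℝ) :
    dirichletPDF α (x, y, z) = dirichletConst α * (posPow x (α 0 - 1) * posPow y (α 1 - 1)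
      * posPow z (α 2 - 1) * posPow (1 - (x + y) - z) (α 3 - 1)) := by
  have e : 1 - x - y - z = 1 - (x + y) - z := by ring
  by_cases h : ∀ c, 0 < cellProb (x, y, z) c
  · have h0 : 0 < x := h (true, true)
    have h1 : 0 < y := h (true, false)
    have h2 : 0 < z := h (false, true)
    have h3 : 0 < 1 - (x + y) - z := e ▸ h (false, false)
    rw [dirichletPDF, if_pos h, posPow_of_pos h0, posPow_of_pos h1, posPow_of_pos h2,
      posPow_of_pos h3]
    simp only [cellProb, dirichletConst, e]
  · rw [dirichletPDF, if_neg h]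
    have : x ≤ 0 ∨ y ≤ 0 ∨ z ≤ 0 ∨ 1 - (x + y) - z ≤ 0 := by
      by_contra! hn
      obtain ⟨h0, h1, h2, h3⟩ := hn
      refine h fun c => ?_
      rcases c with ⟨_ | _, _ | _⟩
      · exact h3.trans_eq e.symm
      · exact h2
      · exact h1
      · exact h0
    rcases this with h | h | h | h <;> simp [posPow_of_nonpos h]

theorem measurable_dirichletPDF (α : Fin 4 → ℝ) : Measurable (dirichletPDF α) := by
  have e : dirichletPDF α = fun θ => dirichletConst α * (posPow θ.1 (α 0 - 1)
      * posPow θ.2.1 (α 1 - 1) * posPow θ.2.2 (α 2 - 1)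
      * posPow (1 - (θ.1 + θ.2.1) - θ.2.2) (α 3 - 1)) := by
    ext ⟨x, y, z⟩; exact dirichletPDF_eq α x y z
  rw [e]
  have := measurable_posPow (α 0 - 1)
  have := measurable_posPow (α 1 - 1)
  have := measurable_posPow (α 2 - 1)
  have := measurable_posPow (α 3 - 1)
  fun_prop

theorem dirichletPDF_nonneg {α : Fin 4 → ℝ} (hα : ∀ i, 0 < α i) (θ : ℝ × ℝ × ℝ) :
    0 ≤ dirichletPDF α θ := by
  obtain ⟨x, y, z⟩ := θ
  rw [dirichletPDF_eq]
  have := dirichletConst_pos hα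
  have := posPow_nonneg x (α 0 - 1)
  have := posPow_nonneg y (α 1 - 1)
  have := posPow_nonneg z (α 2 - 1)
  have := posPow_nonneg (1 - (x + y) - z) (α 3 - 1)
  positivity

/-- Counterpart of `integral_bgePrior`: only the integrand on the open simplex has to be matched,
because the cutoffs annihilate everything else. -/
theorem integral_bdePrior {α : Fin 4 → ℝ} (hα : ∀ i, 0 < α i) {F : ℝ × ℝ × ℝ → ℝ}
    (hF : Measurable F) {a b c d e f : ℝ} (ha : 0 < a) (hb : 0 < b) (hc : 0 < c) (hd : 0 < d)
    (he : 0 ≤ e) (hf : 0 ≤ f)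
    (hFd : ∀ x y z : ℝ, 0 < x → 0 < y → 0 < z → 0 < 1 - (x + y) - z →
      x ^ (α 0 - 1) * y ^ (α 1 - 1) * z ^ (α 2 - 1) * (1 - (x + y) - z) ^ (α 3 - 1) * F (x, y, z)
        = x ^ (a - 1) * y ^ (b - 1) * (x + y) ^ e * (1 - (x + y)) ^ f
          * (z ^ (c - 1) * (1 - (x + y) - z) ^ (d - 1))) :
    ∫ θ, F θ ∂(bdePrior α)
      = dirichletConst α * (beta a b * beta c d * beta (a + b + e) (c + d + f)) := by
  have hC := dirichletConst_pos hα
  have hFd' : ∀ x y z : ℝ, dirichletPDF α (x, y, z) * F (x, y, z) = dirichletConst α *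
      (posPow x (a - 1) * posPow y (b - 1) * posPow (x + y) e * posPow (1 - (x + y)) f
        * (posPow z (c - 1) * posPow (1 - (x + y) - z) (d - 1))) := by
    intro x y z
    rw [dirichletPDF_eq]
    rcases le_or_gt x 0 with hx | hx
    · simp [posPow_of_nonpos hx]
    rcases le_or_gt y 0 with hy | hy
    · simp [posPow_of_nonpos hy]
    rcases le_or_gt z 0 with hz | hz
    · simp [posPow_of_nonpos hz]
    rcases le_or_gt (1 - (x + y) - z) 0 with hw | hw
    · simp [posPow_of_nonpos hw]
    have h1 : 0 < x + y := by linarith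
    have h2 : 0 < 1 - (x + y) := by linarith
    simp only [posPow_of_pos hx, posPow_of_pos hy, posPow_of_pos hz, posPow_of_pos hw,
      posPow_of_pos h1, posPow_of_pos h2]
    rw [mul_assoc, hFd x y z hx hy hz hw]
  have h0 : ∀ θ, 0 ≤ dirichletPDF α θ * F θ := by
    rintro ⟨x, y, z⟩
    rw [hFd']
    have := posPow_nonneg x (a - 1)
    have := posPow_nonneg y (b - 1)
    have := posPow_nonneg z (c - 1)
    have := posPow_nonneg (1 - (x + y) - z) (d - 1)
    have := posPow_nonneg (x + y) e
    have := posPow_nonneg (1 - (x + y)) f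
    positivity
  have hm := measurable_dirichletPDF α
  rw [bdePrior, integral_withDensity_eq_integral_toReal_smul hm.ennreal_ofReal
    (ae_of_all _ fun _ => ENNReal.ofReal_lt_top)]
  have hpt : ∀ θ, (ENNReal.ofReal (dirichletPDF α θ)).toReal • F θ = dirichletPDF α θ * F θ := by
    intro θ
    rw [ENNReal.toReal_ofReal (dirichletPDF_nonneg hα θ), smul_eq_mul]
  simp_rw [hpt]
  rw [integral_eq_lintegral_of_nonneg_ae (ae_of_all _ h0) (hm.mul hF).aestronglyMeasurable,
    Measure.volume_eq_prod, lintegral_prod _ (by fun_prop)]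
  have hin : ∀ x : ℝ, ∫⁻ w : ℝ × ℝ, ENNReal.ofReal (dirichletPDF α (x, w) * F (x, w))
      = ∫⁻ y : ℝ, ∫⁻ z : ℝ, ENNReal.ofReal (dirichletPDF α (x, y, z) * F (x, y, z)) := fun x => by
    rw [Measure.volume_eq_prod, lintegral_prod _ (by fun_prop)]
  simp_rw [hin, hFd', ENNReal.ofReal_mul hC.le]
  simp_rw [lintegral_const_mul' _ _ ENNReal.ofReal_ne_top]
  rw [lintegral_dirichlet ha hb hc hd he hf, ← ENNReal.ofReal_mul hC.le, ENNReal.toReal_ofReal]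
  have := beta_pos ha hb
  have := beta_pos hc hd
  have := beta_pos (show 0 < a + b + e by linarith) (show 0 < c + d + f by linarith)
  positivity

/-- The number of samples in the cell `c`. -/
def cellCount {N : ℕ} (x : Fin N → Bool × Bool) (c : Bool × Bool) : ℕ :=
  (Finset.univ.filter fun k => x k = c).card

theorem prod_eq_prod_pow_cellCount {N : ℕ} (x : Fin N → Bool × Bool) (g : Bool × Bool → ℝ) :
    ∏ k, g (x k) = g (true, true) ^ cellCount x (true, true)
      * g (true, false) ^ cellCount x (true, false)
      * g (false, true) ^ cellCount x (false, true)
      * g (false, false) ^ cellCount x (false, false) := by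
  rw [← Finset.prod_fiberwise' Finset.univ x g]
  simp only [Finset.prod_const, Fintype.prod_prod_type, Fintype.prod_bool, cellCount]
  ring

theorem sum_cellCount {N : ℕ} (x : Fin N → Bool × Bool) :
    cellCount x (true, true) + cellCount x (true, false) + cellCount x (false, true)
      + cellCount x (false, false) = N := by
  have h := Finset.card_eq_sum_card_fiberwise (f := x) (s := Finset.univ) (t := Finset.univ)
    (fun _ _ => by simp)
  simp only [Finset.card_univ, Fintype.card_fin, Fintype.sum_prod_type, Fintype.sum_bool] at h
  unfold cellCount
  omega

/-- The Gamma values of the two partial totals cancel, which turns the nested Beta integrals into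
the symmetric Dirichlet constant. -/
theorem beta_mul_beta_mul_beta {a b c d : ℝ} (ha : 0 < a) (hb : 0 < b) (hc : 0 < c) (hd : 0 < d) :
    beta a b * beta c d * beta (a + b + 0) (c + d + 0)
      = Gamma a * Gamma b * Gamma c * Gamma d / Gamma (a + b + c + d) := by
  have := Gamma_pos_of_pos (add_pos ha hb)
  have := Gamma_pos_of_pos (add_pos hc hd)
  simp only [beta, add_zero, ← add_assoc]
  field_simp

theorem bdeMarginal_forward {α : Fin 4 → ℝ} (hα : ∀ i, 0 < α i) {N : ℕ}
    (x : Fin N → Bool × Bool) :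
    bdeMarginal α x TwoNodeDAG.forward = dirichletConst α *
      (Gamma (α 0 + cellCount x (true, true)) * Gamma (α 1 + cellCount x (true, false))
        * Gamma (α 2 + cellCount x (false, true)) * Gamma (α 3 + cellCount x (false, false))
        / Gamma (α 0 + α 1 + α 2 + α 3 + N)) := by
  have hp : ∀ i (n : ℕ), 0 < α i + n := fun i n => by have := hα i; positivity
  rw [bdeMarginal]
  simp_rw [prod_eq_prod_pow_cellCount]
  rw [integral_bdePrior hα (e := 0) (f := 0) ?_ (hp 0 (cellCount x (true, true)))
    (hp 1 (cellCount x (true, false))) (hp 2 (cellCount x (false, true)))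
    (hp 3 (cellCount x (false, false))) le_rfl le_rfl ?_,
    beta_mul_beta_mul_beta (hp 0 _) (hp 1 _) (hp 2 _) (hp 3 _)]
  · congr 3
    have hs : (cellCount x (true, true) + cellCount x (true, false) + cellCount x (false, true)
        + cellCount x (false, false) : ℝ) = N := by exact_mod_cast sum_cellCount x
    linarith
  · simp only [cellProb]
    fun_prop
  · intro u v w hu hv hw hr
    simp only [cellProb, rpow_zero, mul_one]
    have hr' : 1 - u - v - w = 1 - (u + v) - w := by ring
    rw [hr', show α 0 + (cellCount x (true, true) : ℝ) - 1 = α 0 - 1 + cellCount x (true, true)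
      by ring, show α 1 + (cellCount x (true, false) : ℝ) - 1 = α 1 - 1 + cellCount x (true, false)
      by ring, show α 2 + (cellCount x (false, true) : ℝ) - 1 = α 2 - 1 + cellCount x (false, true)
      by ring, show α 3 + (cellCount x (false, false) : ℝ) - 1
      = α 3 - 1 + cellCount x (false, false) by ring, rpow_add_natCast hu.ne',
      rpow_add_natCast hv.ne', rpow_add_natCast hw.ne', rpow_add_natCast hr.ne']
    ring

theorem measurable_successProb₁ : Measurable successProb₁ := by
  unfold successProb₁
  simp only [cellProb]
  fun_prop

/-- The margin is the total `x + y`, so the success and failure counts enter as the free exponents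
`e` and `f` of the Dirichlet integral. -/
theorem integral_pow_successProb₁ {α : Fin 4 → ℝ} (hα : ∀ i, 0 < α i) (n m : ℕ) :
    ∫ q, q ^ n * (1 - q) ^ m ∂((bdePrior α).map successProb₁)
      = dirichletConst α * (beta (α 0) (α 1) * beta (α 2) (α 3)
        * beta (α 0 + α 1 + n) (α 2 + α 3 + m)) := by
  rw [integral_map measurable_successProb₁.aemeasurable (by fun_prop)]
  refine integral_bdePrior hα ?_ (hα 0) (hα 1) (hα 2) (hα 3) n.cast_nonneg m.cast_nonneg ?_
  · have := measurable_successProb₁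
    fun_prop
  · intro u v w hu hv hw hr
    simp only [successProb₁, cellProb, rpow_natCast]
    ring

/-- Exchanging the cells `(1,0)` and `(0,1)` interchanges the margins and permutes the Dirichlet
parameters, so one margin computation serves both. -/
theorem map_successProb₂ (α : Fin 4 → ℝ) :
    (bdePrior α).map successProb₂ = (bdePrior ![α 0, α 2, α 1, α 3]).map successProb₁ := by
  have hσ : MeasurePreserving (fun θ : ℝ × ℝ × ℝ => (θ.1, θ.2.2, θ.2.1)) volume volume :=
    (MeasurePreserving.id (volume : Measure ℝ)).prod
      (Measure.measurePreserving_swap (μ := (volume : Measure ℝ)) (ν := (volume : Measure ℝ)))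
  have e : successProb₂ = successProb₁ ∘ fun θ : ℝ × ℝ × ℝ => (θ.1, θ.2.2, θ.2.1) := rfl
  rw [e, ← Measure.map_map measurable_successProb₁ hσ.measurable, bdePrior, bdePrior,
    map_withDensity_of_comp_eq hσ (measurable_dirichletPDF ![α 0, α 2, α 1, α 3]).ennreal_ofReal]
  rintro ⟨u, v, w⟩
  congr 1
  simp only [dirichletPDF_eq, dirichletConst, Fin.sum_univ_four, Fin.prod_univ_four,
    Matrix.cons_val]
  rw [show α 0 + α 2 + α 1 + α 3 = α 0 + α 1 + α 2 + α 3 by ring,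
    show 1 - (u + w) - v = 1 - (u + v) - w by ring]
  ring

theorem bde_logPosteriorRatio {structPrior : TwoNodeDAG → ℝ} (hprior : ∀ G, 0 < structPrior G)
    {α : Fin 4 → ℝ} (hα : ∀ i, 0 < α i) :
    ∃ c₀ : ℝ, ∀ (N : ℕ) (x : Fin N → Bool × Bool),
      logPosteriorRatio structPrior (bdeMarginal α x)
        = c₀ + (log (Gamma (α 0 + cellCount x (true, true)))
            + log (Gamma (α 1 + cellCount x (true, false)))
            + log (Gamma (α 2 + cellCount x (false, true)))
            + log (Gamma (α 3 + cellCount x (false, false)))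
            + log (Gamma (α 0 + α 1 + α 2 + α 3 + N))
            - log (Gamma (α 0 + α 1
              + (cellCount x (true, true) + cellCount x (true, false) : ℕ)))
            - log (Gamma (α 2 + α 3
              + (cellCount x (false, true) + cellCount x (false, false) : ℕ)))
            - log (Gamma (α 0 + α 2
              + (cellCount x (true, true) + cellCount x (false, true) : ℕ)))
            - log (Gamma (α 1 + α 3
              + (cellCount x (true, false) + cellCount x (false, false) : ℕ)))) := by
  set α' : Fin 4 → ℝ := ![α 0, α 2, α 1, α 3] with hα'
  have hα'pos : ∀ i, 0 < α' i := by
    intro i; fin_cases i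
    exacts [hα 0, hα 2, hα 1, hα 3]
  refine ⟨log (structPrior TwoNodeDAG.forward) - log (structPrior TwoNodeDAG.empty)
    + (log (dirichletConst α) - log (dirichletConst α) - log (dirichletConst α')
      - log (beta (α 0) (α 1)) - log (beta (α 2) (α 3))
      - log (beta (α 0) (α 2)) - log (beta (α 1) (α 3))), fun N x => ?_⟩
  have : SFinite (bdePrior α) := by rw [bdePrior]; infer_instance
  have : SFinite (bdePrior α') := by rw [bdePrior]; infer_instance
  have hs := sum_cellCount x
  have hfw := bdeMarginal_forward hα x
  have hempty : bdeMarginal α x TwoNodeDAG.empty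
      = (∫ q, q ^ (cellCount x (true, true) + cellCount x (true, false))
            * (1 - q) ^ (cellCount x (false, true) + cellCount x (false, false))
            ∂((bdePrior α).map successProb₁))
        * ∫ q, q ^ (cellCount x (true, true) + cellCount x (false, true))
            * (1 - q) ^ (cellCount x (true, false) + cellCount x (false, false))
            ∂((bdePrior α').map successProb₁) := by
    rw [bdeMarginal, bdePriorEmpty, map_successProb₂, ← integral_prod_mul]
    refine integral_congr_ae (ae_of_all _ fun q => ?_)
    simp only
    rw [prod_eq_prod_pow_cellCount x fun c =>
      (if c.1 then q.1 else 1 - q.1) * (if c.2 then q.2 else 1 - q.2)]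
    simp only [if_true, Bool.false_eq_true, if_false, mul_pow, pow_add]
    ring
  generalize cellCount x (true, true) = n₀ at *
  generalize cellCount x (true, false) = n₁ at *
  generalize cellCount x (false, true) = n₂ at *
  generalize cellCount x (false, false) = n₃ at *
  rw [integral_pow_successProb₁ hα, integral_pow_successProb₁ hα'pos] at hempty
  have hC := dirichletConst_pos hα
  have hC' := dirichletConst_pos hα'pos
  have a0 := hα 0
  have a1 := hα 1
  have a2 := hα 2
  have a3 := hα 3
  have v0 : α' 0 = α 0 := rfl
  have v1 : α' 1 = α 2 := rfl
  have v2 : α' 2 = α 1 := rfl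
  have v3 : α' 3 = α 3 := rfl
  rw [v0, v1, v2, v3] at hempty
  have b1 := beta_pos a0 a1
  have b2 := beta_pos a2 a3
  have b3 := beta_pos a0 a2
  have b4 := beta_pos a1 a3
  have g0 : 0 < Gamma (α 0 + n₀) := Gamma_pos_of_pos (by positivity)
  have g1 : 0 < Gamma (α 1 + n₁) := Gamma_pos_of_pos (by positivity)
  have g2 : 0 < Gamma (α 2 + n₂) := Gamma_pos_of_pos (by positivity)
  have g3 : 0 < Gamma (α 3 + n₃) := Gamma_pos_of_pos (by positivity)
  have g4 : 0 < Gamma (α 0 + α 1 + α 2 + α 3 + N) := Gamma_pos_of_pos (by positivity)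
  have g5 : 0 < Gamma (α 0 + α 1 + (n₀ + n₁ : ℕ)) := Gamma_pos_of_pos (by positivity)
  have g6 : 0 < Gamma (α 2 + α 3 + (n₂ + n₃ : ℕ)) := Gamma_pos_of_pos (by positivity)
  have g7 : 0 < Gamma (α 0 + α 2 + (n₀ + n₂ : ℕ)) := Gamma_pos_of_pos (by positivity)
  have g8 : 0 < Gamma (α 1 + α 3 + (n₁ + n₃ : ℕ)) := Gamma_pos_of_pos (by positivity)
  have s1 : α 0 + α 1 + (n₀ + n₁ : ℕ) + (α 2 + α 3 + (n₂ + n₃ : ℕ))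
      = α 0 + α 1 + α 2 + α 3 + N := by rw [← hs]; push_cast; ring
  have s2 : α 0 + α 2 + (n₀ + n₂ : ℕ) + (α 1 + α 3 + (n₁ + n₃ : ℕ))
      = α 0 + α 1 + α 2 + α 3 + N := by rw [← hs]; push_cast; ring
  rw [beta.eq_def (α 0 + α 1 + _), beta.eq_def (α 0 + α 2 + _), s1, s2] at hempty
  have hE0 : 0 < bdeMarginal α x TwoNodeDAG.empty := by rw [hempty]; positivity
  have hF0 : 0 < bdeMarginal α x TwoNodeDAG.forward := by rw [hfw]; positivity
  have hA : ∀ {C B B' G G' H : ℝ}, 0 < C → 0 < B → 0 < B' → 0 < G → 0 < G' → 0 < H →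
      0 < C * (B * B' * (G * G' / H)) ∧ log (C * (B * B' * (G * G' / H)))
        = log C + (log B + log B' + (log G + log G' - log H)) := by
    intro C B B' G G' H h1 h2 h3 h4 h5 h6
    refine ⟨by positivity, ?_⟩
    rw [log_mul h1.ne' (by positivity), log_mul (by positivity) (by positivity),
      log_mul h2.ne' h3.ne', log_div (by positivity) h6.ne', log_mul h4.ne' h5.ne']
  obtain ⟨p1, l1⟩ := hA hC b1 b2 g5 g6 g4
  obtain ⟨p2, l2⟩ := hA hC' b3 b4 g7 g8 g4
  rw [logPosteriorRatio_eq hprior fun G => by cases G; exacts [hE0, hF0, hF0], hempty, hfw,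
    log_mul p1.ne' p2.ne', l1, l2, log_mul hC.ne' (by positivity), log_div (by positivity) g4.ne',
    log_mul (by positivity) g3.ne', log_mul (by positivity) g2.ne', log_mul g0.ne' g1.ne']
  ring

/-! ### The limit under the BDe score -/

/-- Crude Stirling by telescoping. The increment of the error `δ` is `log (a + n) - log (n + 1)`
plus `1 - n * (log (n + 1) - log n)`, each `O(1 / (n + 1))`; the harmonic sum is bounded by a
logarithm. -/
theorem exists_abs_log_Gamma_add_natCast_le {a : ℝ} (ha : 0 < a) :
    ∃ C, 0 ≤ C ∧ ∀ n : ℕ, |log (Gamma (a + n)) - (n * log n - n)| ≤ C * (1 + log (n + 1)) := by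
  -- Large enough for both signs: the increments are at most `(a - 1) + 1` from above and `1 + 1 /
  -- a` from below, over `n + 1`.
  set K : ℝ := a + 2 + 1 / a with hK
  have hia : 0 < 1 / a := by positivity
  set δ : ℕ → ℝ := fun n => log (Gamma (a + n)) - (n * log n - n) with hδ
  have step : ∀ n : ℕ, |δ (n + 1) - δ n| ≤ K / (n + 1) := by
    intro n
    have hn : (0 : ℝ) ≤ n := n.cast_nonneg
    have hG := Gamma_pos_of_pos (show 0 < a + n by positivity)
    have e : δ (n + 1) - δ n = log (a + n) - (n + 1) * log (n + 1) + n * log n + 1 := by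
      simp only [hδ]
      push_cast
      rw [show a + ((n : ℝ) + 1) = a + n + 1 by ring, Gamma_add_one (by positivity),
        log_mul (by positivity) hG.ne']
      ring
    have u1 : log (a + n) - log (n + 1) ≤ (a - 1) / (n + 1) := by
      rw [← log_div (by positivity) (by positivity)]
      refine (log_le_sub_one_of_pos (by positivity)).trans_eq ?_
      field_simp
      ring
    have u2 : log (n + 1) - log (a + n) ≤ (1 - a) / (a + n) := by
      rw [← log_div (by positivity) (by positivity)]
      refine (log_le_sub_one_of_pos (by positivity)).trans_eq ?_
      field_simp
      ring
    have u3 : (1 - a) / (a + n) ≤ (1 + 1 / a) / (n + 1) := by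
      rw [div_le_div_iff₀ (by positivity) (by positivity)]
      have h1 : 1 / a * (a + n) = 1 + n / a := by field_simp
      have h2 : 0 ≤ (n : ℝ) / a := by positivity
      nlinarith
    -- At `n = 0` the product vanishes and the upper bound is the equality `1 = 1`.
    have w : 0 ≤ 1 - n * (log (n + 1) - log n) ∧ 1 - n * (log (n + 1) - log n) ≤ 1 / (n + 1) := by
      rcases n.eq_zero_or_pos with rfl | hpos
      · simp
      have hn' : (0 : ℝ) < n := Nat.cast_pos.2 hpos
      have h1 : log ((n : ℝ) + 1) - log n ≤ 1 / n := by
        rw [← log_div (by positivity) hn'.ne']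
        refine (log_le_sub_one_of_pos (by positivity)).trans_eq ?_
        field_simp
        ring
      have h2 : log (n : ℝ) - log (n + 1) ≤ -(1 / (n + 1)) := by
        rw [← log_div hn'.ne' (by positivity)]
        refine (log_le_sub_one_of_pos (by positivity)).trans_eq ?_
        field_simp
        ring
      constructor
      · have := mul_le_mul_of_nonneg_left h1 hn
        rw [mul_one_div_cancel hn'.ne'] at this
        linarith
      · have := mul_le_mul_of_nonneg_left h2 hn
        have e2 : (n : ℝ) * -(1 / (n + 1)) = 1 / (n + 1) - 1 := by field_simp; ring
        linarith
    have e3 : K / (n + 1) = (a - 1) / (n + 1) + 1 / (n + 1) + (2 + 1 / a) / (n + 1) := by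
      rw [hK]; ring
    have e4 : K / (n + 1) = (1 + 1 / a) / (n + 1) + (a + 1) / (n + 1) := by
      rw [hK]; ring
    have p1 : 0 ≤ (2 + 1 / a) / ((n : ℝ) + 1) := by positivity
    have p2 : 0 ≤ (a + 1) / ((n : ℝ) + 1) := by positivity
    rw [e, abs_le]
    constructor
    · linarith [w.1, w.2]
    · linarith [w.1, w.2]
  have hK0 : 0 < K := by positivity
  have main : ∀ n : ℕ, |δ n| ≤ |δ 0| + 2 * K * log (n + 1) := by
    intro n
    induction n with
    | zero => simp
    | succ n ih =>
      have hn : (0 : ℝ) ≤ n := n.cast_nonneg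
      have h1 : |δ (n + 1)| ≤ |δ n| + |δ (n + 1) - δ n| := by
        have := abs_add_le (δ n) (δ (n + 1) - δ n)
        simpa using this
      have h2 : log ((n : ℝ) + 1) - log (n + 1 + 1) ≤ -(1 / (n + 1 + 1)) := by
        rw [← log_div (by positivity) (by positivity)]
        refine (log_le_sub_one_of_pos (by positivity)).trans_eq ?_
        field_simp
        ring
      -- The factor two pays for replacing `n + 1` by `n + 2`, so that the term is dominated by `2 *
      -- K * (log (n + 2) - log (n + 1))`.
      have h3 : K / (n + 1) ≤ 2 * K * (1 / ((n : ℝ) + 1 + 1)) := by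
        rw [mul_one_div, div_le_div_iff₀ (by positivity) (by positivity)]
        nlinarith
      have h4 := step n
      have h5 := mul_le_mul_of_nonneg_left h2 (by positivity : 0 ≤ 2 * K)
      push_cast
      linarith
  refine ⟨|δ 0| + 2 * K, by positivity, fun n => (main n).trans ?_⟩
  have hl : 0 ≤ log ((n : ℝ) + 1) := log_nonneg (by linarith [(n.cast_nonneg : (0 : ℝ) ≤ n)])
  nlinarith [mul_nonneg (abs_nonneg (δ 0)) hl]

/-- The mutual information of a pair of binary variables, from its cell probabilities. -/
noncomputable def mutualInfo (m : Bool × Bool → ℝ) : ℝ :=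
  negMulLog (m (true, true) + m (true, false)) + negMulLog (m (false, true) + m (false, false))
    + negMulLog (m (true, true) + m (false, true)) + negMulLog (m (true, false) + m (false, false))
    - negMulLog (m (true, true)) - negMulLog (m (true, false)) - negMulLog (m (false, true))
    - negMulLog (m (false, false))

theorem continuous_mutualInfo : Continuous mutualInfo := by
  unfold mutualInfo
  have := continuous_negMulLog
  fun_prop

/-- The indicators of the four cells. -/
def cellFeature (c : Bool × Bool) (z : Bool × Bool) : ℝ := if z = c then 1 else 0

theorem sampleMean_cellFeature {N : ℕ} (x : Fin N → Bool × Bool) (c : Bool × Bool) :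
    sampleMean cellFeature x c = cellCount x c / N := by
  simp [sampleMean, cellFeature, cellCount]

theorem natCast_mul_log {N : ℕ} (hN : 0 < N) (n : ℕ) :
    (n : ℝ) * log n = -(N * negMulLog (n / N)) + n * log N := by
  have hN' : (0 : ℝ) < N := Nat.cast_pos.2 hN
  rcases n.eq_zero_or_pos with rfl | hn
  · simp
  have hn' : (0 : ℝ) < n := Nat.cast_pos.2 hn
  rw [negMulLog, log_div hn'.ne' hN'.ne']
  field_simp
  ring

/-- Stirling rescaled by the sample size: the entropy term appears with the frequency `n / N`, and
the error bound depends on `N` alone, hence is uniform over data sets. -/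
theorem exists_log_Gamma_add_natCast_eq {a : ℝ} (ha : 0 < a) :
    ∃ C, 0 ≤ C ∧ ∀ N n : ℕ, 0 < N → n ≤ N → ∃ E, |E| ≤ C * (1 + log (N + 1)) ∧
      log (Gamma (a + n)) = -(N * negMulLog (n / N)) + n * log N - n + E := by
  obtain ⟨C, hC, h⟩ := exists_abs_log_Gamma_add_natCast_le ha
  refine ⟨C, hC, fun N n hN hn => ⟨log (Gamma (a + n)) - (n * log n - n), (h n).trans ?_, ?_⟩⟩
  · have : (n : ℝ) ≤ N := Nat.cast_le.2 hn
    have : log ((n : ℝ) + 1) ≤ log (N + 1) := log_le_log (by positivity) (by linarith)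
    gcongr
  · rw [natCast_mul_log hN]
    ring

/-- The entropy terms of the nine Gamma factors add up to `N` times the empirical mutual
information. The terms linear in the counts cancel, since the cells and the grand total contribute
`N + N` and the four margin counts `2 * N`. Only `c₀` and the Stirling errors survive. -/
theorem exists_abs_bdeRate_sub_le {structPrior : TwoNodeDAG → ℝ} (hprior : ∀ G, 0 < structPrior G)
    {α : Fin 4 → ℝ} (hα : ∀ i, 0 < α i) :
    ∃ C, ∀ N : ℕ, 0 < N → ∀ x : Fin N → Bool × Bool,
      |1 / (N : ℝ) * logPosteriorRatio structPrior (bdeMarginal α x)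
        - mutualInfo (sampleMean cellFeature x)| ≤ C * (1 + log (N + 1)) / N := by
  obtain ⟨c₀, hc₀⟩ := bde_logPosteriorRatio hprior hα
  have a0 := hα 0
  have a1 := hα 1
  have a2 := hα 2
  have a3 := hα 3
  obtain ⟨C0, p0, h0⟩ := exists_log_Gamma_add_natCast_eq a0
  obtain ⟨C1, p1, h1⟩ := exists_log_Gamma_add_natCast_eq a1
  obtain ⟨C2, p2, h2⟩ := exists_log_Gamma_add_natCast_eq a2
  obtain ⟨C3, p3, h3⟩ := exists_log_Gamma_add_natCast_eq a3
  obtain ⟨C4, p4, h4⟩ := exists_log_Gamma_add_natCast_eq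
    (show 0 < α 0 + α 1 + α 2 + α 3 by positivity)
  obtain ⟨C5, p5, h5⟩ := exists_log_Gamma_add_natCast_eq (add_pos a0 a1)
  obtain ⟨C6, p6, h6⟩ := exists_log_Gamma_add_natCast_eq (add_pos a2 a3)
  obtain ⟨C7, p7, h7⟩ := exists_log_Gamma_add_natCast_eq (add_pos a0 a2)
  obtain ⟨C8, p8, h8⟩ := exists_log_Gamma_add_natCast_eq (add_pos a1 a3)
  refine ⟨|c₀| + C0 + C1 + C2 + C3 + C4 + C5 + C6 + C7 + C8, fun N hN x => ?_⟩
  have hN' : (0 : ℝ) < N := Nat.cast_pos.2 hN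
  have hL : 0 ≤ log ((N : ℝ) + 1) := log_nonneg (by linarith)
  have hs := sum_cellCount x
  have hsR : (cellCount x (true, true) + cellCount x (true, false) + cellCount x (false, true)
    + cellCount x (false, false) : ℝ) = N := by exact_mod_cast hs
  obtain ⟨E0, k0, e0⟩ := h0 N (cellCount x (true, true)) hN (by omega)
  obtain ⟨E1, k1, e1⟩ := h1 N (cellCount x (true, false)) hN (by omega)
  obtain ⟨E2, k2, e2⟩ := h2 N (cellCount x (false, true)) hN (by omega)
  obtain ⟨E3, k3, e3⟩ := h3 N (cellCount x (false, false)) hN (by omega)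
  obtain ⟨E4, k4, e4⟩ := h4 N N hN le_rfl
  obtain ⟨E5, k5, e5⟩ := h5 N (cellCount x (true, true) + cellCount x (true, false)) hN (by omega)
  obtain ⟨E6, k6, e6⟩ := h6 N (cellCount x (false, true) + cellCount x (false, false)) hN (by omega)
  obtain ⟨E7, k7, e7⟩ := h7 N (cellCount x (true, true) + cellCount x (false, true)) hN (by omega)
  obtain ⟨E8, k8, e8⟩ := h8 N (cellCount x (true, false) + cellCount x (false, false)) hN (by omega)
  have hself : negMulLog ((N : ℝ) / N) = 0 := by rw [div_self hN'.ne', negMulLog_one]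
  have key : 1 / (N : ℝ) * logPosteriorRatio structPrior (bdeMarginal α x)
      - mutualInfo (sampleMean cellFeature x)
      = (c₀ + E0 + E1 + E2 + E3 + E4 - E5 - E6 - E7 - E8) / N := by
    rw [hc₀, e0, e1, e2, e3, e4, e5, e6, e7, e8, hself]
    simp only [mutualInfo, sampleMean_cellFeature, ← add_div, ← Nat.cast_add]
    field_simp
    push_cast
    linear_combination (1 - log (N : ℝ)) * hsR
  rw [key, abs_div, abs_of_pos hN']
  gcongr
  have hc1 := le_abs_self c₀
  have hc2 := neg_abs_le c₀
  have hc3 := mul_nonneg (abs_nonneg c₀) hL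
  rw [abs_le] at *
  constructor <;> linarith [k0.1, k0.2, k1.1, k1.2, k2.1, k2.2, k3.1, k3.2, k4.1, k4.2, k5.1, k5.2,
    k6.1, k6.2, k7.1, k7.2, k8.1, k8.2]

/-- The rate is uniformly close to the empirical mutual information, which is continuous in the cell
frequencies. Finiteness of the sample space makes every integrability condition automatic. -/
theorem tendsto_rBDe {structPrior : TwoNodeDAG → ℝ} (hprior : ∀ G, 0 < structPrior G)
    {α : Fin 4 → ℝ} (hα : ∀ i, 0 < α i) (Q : Measure (Bool × Bool)) [IsProbabilityMeasure Q] :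
    Tendsto (rBDe structPrior α Q) atTop (𝓝 (mutualInfo fun c => Q.real {c})) := by
  obtain ⟨C, hC⟩ := exists_abs_bdeRate_sub_le hprior hα
  have he : (fun c => ∫ z, cellFeature c z ∂Q) = fun c => Q.real {c} := by
    ext c
    have : cellFeature c = Set.indicator {c} 1 := by
      ext z; simp [cellFeature, Set.indicator_apply]
    rw [this, integral_indicator_one (MeasurableSet.singleton c)]
  have hg : Tendsto (fun p : ℕ × (Bool × Bool → ℝ) => mutualInfo p.2)
      (atTop ×ˢ 𝓝 fun c => ∫ z, cellFeature c z ∂Q) (𝓝 (mutualInfo fun c => Q.real {c})) := by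
    rw [he]
    exact (continuous_mutualInfo.tendsto _).comp tendsto_snd
  have hbound : ∀ N : ℕ, 0 < N → ∀ x : Fin N → Bool × Bool,
      |mutualInfo (sampleMean cellFeature x)|
        ≤ 4 * (1 + log N + ∑ j, |sampleMean cellFeature x j|) := by
    intro N hN x
    have hN' : (0 : ℝ) < N := Nat.cast_pos.2 hN
    have hs := sum_cellCount x
    have hv : ∀ n : ℕ, n ≤ N → 0 ≤ negMulLog ((n : ℝ) / N) ∧ negMulLog ((n : ℝ) / N) ≤ 1 := by
      intro n hn
      have h1 : (n : ℝ) / N ≤ 1 := (div_le_one hN').2 (Nat.cast_le.2 hn)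
      have h0 : 0 ≤ (n : ℝ) / N := by positivity
      refine ⟨negMulLog_nonneg h0 h1, ?_⟩
      exact (negMulLog_le_one_sub_self h0).trans (by linarith)
    have hl := log_natCast_nonneg N
    have hsum : 0 ≤ ∑ j, |sampleMean cellFeature x j| :=
      Finset.sum_nonneg fun j _ => abs_nonneg _
    -- Four entropy terms in `[0, 1]` enter with each sign.
    have h4 : |mutualInfo (sampleMean cellFeature x)| ≤ 4 := by
      simp only [mutualInfo, sampleMean_cellFeature, ← add_div, ← Nat.cast_add]
      have k0 := hv (cellCount x (true, true)) (by omega)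
      have k1 := hv (cellCount x (true, false)) (by omega)
      have k2 := hv (cellCount x (false, true)) (by omega)
      have k3 := hv (cellCount x (false, false)) (by omega)
      have k4 := hv (cellCount x (true, true) + cellCount x (true, false)) (by omega)
      have k5 := hv (cellCount x (false, true) + cellCount x (false, false)) (by omega)
      have k6 := hv (cellCount x (true, true) + cellCount x (false, true)) (by omega)
      have k7 := hv (cellCount x (true, false) + cellCount x (false, false)) (by omega)
      rw [abs_le]
      constructor <;> linarith [k0.1, k0.2, k1.1, k1.2, k2.1, k2.2, k3.1, k3.2, k4.1, k4.2,
        k5.1, k5.2, k6.1, k6.2, k7.1, k7.2]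
    linarith
  have hlim := tendsto_integral_sampleMean (P := Q) (φ := cellFeature) (fun j => MemLp.of_discrete)
    (g := fun _ m => mutualInfo m) hg (by norm_num) hbound fun N _ => Integrable.of_finite
  have herr : Tendsto (fun N : ℕ => C * (1 + log ((N : ℝ) + 1)) / N) atTop (𝓝 0) := by
    have h1 : Tendsto (fun N : ℕ => (1 : ℝ) / N) atTop (𝓝 0) := tendsto_one_div_atTop_nhds_zero_nat
    have h2 : Tendsto (fun N : ℕ => log ((N : ℝ) + 1) / N) atTop (𝓝 0) := by
      have h3 : Tendsto (fun N : ℕ => log ((N + 1 : ℕ) : ℝ) / ((N + 1 : ℕ) : ℝ)) atTop (𝓝 0) := by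
        have := (Real.isLittleO_log_id_atTop.tendsto_div_nhds_zero).comp
          ((tendsto_natCast_atTop_atTop (R := ℝ)).comp (tendsto_add_atTop_nat 1))
        simpa [Function.comp_def] using this
      have h4 := h3.mul (h1.const_add 1)
      rw [zero_mul] at h4
      refine h4.congr' ?_
      filter_upwards [eventually_gt_atTop 0] with N hN
      have hN' : (0 : ℝ) < N := Nat.cast_pos.2 hN
      push_cast
      field_simp
    have h5 := (h1.add h2).const_mul C
    simp only [add_zero, mul_zero] at h5
    refine h5.congr fun N => ?_
    ring
  have hdiff : Tendsto (fun N : ℕ => rBDe structPrior α Q N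
      - ∫ x : Fin N → Bool × Bool, mutualInfo (sampleMean cellFeature x) ∂(Measure.pi fun _ => Q))
      atTop (𝓝 0) := by
    refine squeeze_zero_norm' ?_ herr
    filter_upwards [eventually_gt_atTop 0] with N hN
    have e : rBDe structPrior α Q N = ∫ x : Fin N → Bool × Bool,
        1 / (N : ℝ) * logPosteriorRatio structPrior (bdeMarginal α x) ∂(Measure.pi fun _ => Q) := by
      rw [rBDe, integral_const_mul, integral_fintype Integrable.of_finite]
      congr 1
      exact Finset.sum_congr rfl fun x _ => by rw [smul_eq_mul, mul_comm]
    rw [e, ← integral_sub Integrable.of_finite Integrable.of_finite]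
    refine (norm_integral_le_of_norm_le_const (ae_of_all _ fun x => ?_)).trans_eq
      (by rw [probReal_univ, mul_one])
    exact hC N hN x
  simpa using hdiff.add hlim

/-- All four margins equal `1 / 2`, so their entropy terms contribute `4 * (log 2 / 2) = log 4`. -/
theorem mutualInfo_eq_of_symmetric {m : Bool × Bool → ℝ} {p : ℝ} (h0 : m (true, true) = p)
    (h1 : m (true, false) = 1 / 2 - p) (h2 : m (false, true) = 1 / 2 - p)
    (h3 : m (false, false) = p) :
    mutualInfo m = log 4 + 2 * p * log p + (1 - 2 * p) * log (1 / 2 - p) := by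
  simp only [mutualInfo, h0, h1, h2, h3, negMulLog]
  have e1 : p + (1 / 2 - p) = 2⁻¹ := by ring
  have e2 : 1 / 2 - p + p = 2⁻¹ := by ring
  have e3 : log (4 : ℝ) = 2 * log 2 := by
    rw [show (4 : ℝ) = 2 ^ 2 by norm_num, log_pow]; norm_num
  rw [e1, e2, e3, log_inv]
  ring

/-! ### The law of the continuous parent and the discrete child -/

theorem logistic_pos (u : ℝ) : 0 < (logistic u : ℝ) :=
  div_pos (exp_pos u) (add_pos one_pos (exp_pos u))

theorem logistic_lt_one (u : ℝ) : (logistic u : ℝ) < 1 :=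
  (div_lt_one (add_pos one_pos (exp_pos u))).2 (by linarith)

theorem logistic_neg (u : ℝ) : (logistic (-u) : ℝ) = 1 - logistic u := by
  have h := exp_pos u
  change exp (-u) / (1 + exp (-u)) = 1 - exp u / (1 + exp u)
  rw [exp_neg]
  field_simp
  ring

theorem map_gaussianReal_standard {σ₁ : ℝ} (μ₁ : ℝ) :
    (gaussianReal 0 1).map (fun s => μ₁ + σ₁ * s) = gaussianReal μ₁ (σ₁ ^ 2).toNNReal := by
  have e : (fun s => μ₁ + σ₁ * s) = (fun x => μ₁ + x) ∘ fun s => σ₁ * s := rfl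
  rw [e, ← Measure.map_map (by fun_prop) (by fun_prop), gaussianReal_map_const_mul,
    gaussianReal_map_const_add, mul_zero, zero_add, mul_one]
  congr 1
  ext
  simp [sq_nonneg]

instance isProbabilityMeasure_scdLaw (μ₁ σ₁ β : ℝ) : IsProbabilityMeasure (scdLaw μ₁ σ₁ β) := by
  unfold scdLaw; infer_instance

/-- Disintegration over the parent, followed by standardization `x = μ₁ + σ₁ * s`, reduces every
moment to an integral against the standard normal law. -/
theorem integral_scdLaw {μ₁ σ₁ β : ℝ} {f : ℝ × Bool → ℝ} (hm : Measurable f)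
    (hf : Integrable f (scdLaw μ₁ σ₁ β)) :
    ∫ z, f z ∂(scdLaw μ₁ σ₁ β) = ∫ s, ((logistic (β * σ₁ * s) : ℝ) * f (μ₁ + σ₁ * s, true)
      + (1 - logistic (β * σ₁ * s)) * f (μ₁ + σ₁ * s, false)) ∂(gaussianReal 0 1) := by
  rw [scdLaw, Measure.integral_compProd hf]
  have e : ∀ x, ∫ b, f (x, b) ∂(scdKernel μ₁ β x) = (logistic (β * (x - μ₁)) : ℝ) * f (x, true)
      + (1 - logistic (β * (x - μ₁))) * f (x, false) := fun x =>
    integral_bernoulliMeasure true false (logistic (β * (x - μ₁))) fun b => f (x, b)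
  simp_rw [e]
  rw [← map_gaussianReal_standard μ₁, integral_map (by fun_prop)]
  · simp_rw [add_sub_cancel_left, ← mul_assoc]
  · exact Measurable.aestronglyMeasurable (by fun_prop)

theorem integral_gaussianReal_standard (f : ℝ → ℝ) :
    ∫ s, f s ∂(gaussianReal 0 1) = ∫ s, 1 / √(2 * π) * f s * exp (-(s ^ 2 / 2)) := by
  rw [integral_gaussianReal_eq_integral_smul one_ne_zero]
  refine integral_congr_ae (ae_of_all _ fun s => ?_)
  simp only [gaussianPDFReal, smul_eq_mul, NNReal.coe_one, mul_one, sub_zero]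
  rw [neg_div]
  ring

theorem map_fst_scdLaw (μ₁ σ₁ β : ℝ) :
    (scdLaw μ₁ σ₁ β).map Prod.fst = gaussianReal μ₁ (σ₁ ^ 2).toNNReal :=
  Measure.fst_compProd _ _

theorem measurable_asReal : Measurable asReal := by
  refine measurable_pi_lambda _ fun i => ?_
  fin_cases i
  · exact measurable_fst
  · exact Measurable.ite (measurable_snd (measurableSet_singleton true)) measurable_const
      measurable_const

theorem measurable_discretize (m : ℝ) : Measurable (discretize m) := by
  have h : Measurable fun x : ℝ => decide (m ≤ x) := measurable_to_bool (by
    have : (fun x : ℝ => decide (m ≤ x)) ⁻¹' {true} = Set.Ici m := by ext x; simp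
    rw [this]; exact measurableSet_Ici)
  exact (h.comp measurable_fst).prodMk measurable_snd

section Moments

variable (μ₁ σ₁ β : ℝ)

theorem memLp_fst_scdLaw (p : NNReal) :
    MemLp (fun z : ℝ × Bool => z.1) p (scdLaw μ₁ σ₁ β) := by
  have h := memLp_id_gaussianReal (μ := μ₁) (v := (σ₁ ^ 2).toNNReal) p
  rw [← map_fst_scdLaw μ₁ σ₁ β, memLp_map_measure_iff aestronglyMeasurable_id
    measurable_fst.aemeasurable] at h
  exact h

/-- Only the square of the parent needs a fourth Gaussian moment; since the child is bounded by one,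
the other features are dominated by the parent or by a constant. -/
theorem memLp_bgeFeature (j : Fin 5) :
    MemLp (bgeFeature j) 2 ((scdLaw μ₁ σ₁ β).map asReal) := by
  rw [memLp_map_measure_iff (measurable_bgeFeature j).aestronglyMeasurable
    measurable_asReal.aemeasurable]
  have hm : AEStronglyMeasurable (bgeFeature j ∘ asReal) (scdLaw μ₁ σ₁ β) :=
    ((measurable_bgeFeature j).comp measurable_asReal).aestronglyMeasurable
  have h1 : MemLp (fun z : ℝ × Bool => z.1) 2 (scdLaw μ₁ σ₁ β) := by
    simpa using memLp_fst_scdLaw μ₁ σ₁ β 2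
  have h2 : ∀ z : ℝ × Bool, |asReal z 1| ≤ 1 := by
    rintro ⟨x, _ | _⟩ <;> simp [asReal]
  have hone : MemLp (fun _ : ℝ × Bool => (1 : ℝ)) 2 (scdLaw μ₁ σ₁ β) := memLp_const 1
  fin_cases j
  · have h4 : MemLp (fun z : ℝ × Bool => z.1) 4 (scdLaw μ₁ σ₁ β) := by
      simpa using memLp_fst_scdLaw μ₁ σ₁ β 4
    have hi := h4.integrable_norm_pow (by norm_num)
    refine (memLp_two_iff_integrable_sq hm).2 (hi.congr (ae_of_all _ fun z => ?_))
    change ‖z.1‖ ^ 4 = (z.1 * z.1) ^ 2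
    rw [Real.norm_eq_abs, show (4 : ℕ) = 2 * 2 from rfl, pow_mul, sq_abs, sq z.1]
  · refine h1.mono hm (ae_of_all _ fun z => ?_)
    change ‖z.1 * asReal z 1‖ ≤ ‖z.1‖
    rw [norm_mul]
    exact mul_le_of_le_one_right (norm_nonneg _) (h2 z)
  · refine hone.mono hm (ae_of_all _ fun z => ?_)
    change ‖asReal z 1 * asReal z 1‖ ≤ ‖(1 : ℝ)‖
    rw [norm_mul, norm_one]
    exact mul_le_one₀ (h2 z) (norm_nonneg _) (h2 z)
  · exact h1
  · refine hone.mono hm (ae_of_all _ fun z => ?_)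
    change ‖asReal z 1‖ ≤ ‖(1 : ℝ)‖
    rw [norm_one]
    exact h2 z

theorem integral_bgeFeature (j : Fin 5) :
    ∫ z, bgeFeature j z ∂((scdLaw μ₁ σ₁ β).map asReal)
      = ∫ s, ((logistic (β * σ₁ * s) : ℝ) * bgeFeature j ![μ₁ + σ₁ * s, 1]
        + (1 - logistic (β * σ₁ * s)) * bgeFeature j ![μ₁ + σ₁ * s, 0]) ∂(gaussianReal 0 1) := by
  have h := (memLp_bgeFeature μ₁ σ₁ β j).integrable one_le_two
  have hm := measurable_bgeFeature j
  rw [integrable_map_measure hm.aestronglyMeasurable measurable_asReal.aemeasurable] at h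
  rw [integral_map measurable_asReal.aemeasurable hm.aestronglyMeasurable]
  exact (integral_scdLaw (hm.comp measurable_asReal) h).trans rfl

theorem integrable_logistic_mul {f : ℝ → ℝ} {ν : Measure ℝ} (hf : Integrable f ν) (c : ℝ) :
    Integrable (fun s => (logistic (c * s) : ℝ) * f s) ν := by
  refine hf.norm.mono' ?_ (ae_of_all _ fun s => ?_)
  · exact (Measurable.aestronglyMeasurable (by fun_prop)).mul hf.aestronglyMeasurable
  · rw [norm_mul, Real.norm_eq_abs, abs_of_pos (logistic_pos _)]
    exact mul_le_of_le_one_left (norm_nonneg _) (logistic_lt_one _).le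

theorem integrable_id_standard : Integrable (fun s : ℝ => s) (gaussianReal 0 1) :=
  (memLp_id_gaussianReal (μ := 0) (v := 1) 1).integrable (by simp)

theorem integrable_sq_standard : Integrable (fun s : ℝ => s ^ 2) (gaussianReal 0 1) := by
  have h : MemLp id 2 (gaussianReal 0 1) := by
    simpa using memLp_id_gaussianReal (μ := 0) (v := 1) 2
  exact h.integrable_sq

theorem integral_sq_standard : ∫ s, s ^ 2 ∂(gaussianReal 0 1) = 1 := by
  have h := variance_fun_id_gaussianReal (μ := 0) (v := 1)
  rw [variance_eq_integral (by fun_prop), integral_id_gaussianReal] at h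
  simpa using h

/-- `E(X₂)`. -/
noncomputable def meanChild : ℝ := ∫ s, (logistic (β * σ₁ * s) : ℝ) ∂(gaussianReal 0 1)

/-- The covariance of the standardized parent and the child. -/
noncomputable def covChild : ℝ := ∫ s, (logistic (β * σ₁ * s) : ℝ) * s ∂(gaussianReal 0 1)

/-- With `l` the success probability, the squared residual of `l` regressed on `s` has nonnegative
mean, so `E ^ 2 + A ^ 2` is at most the mean of `l ^ 2`. That is strictly below the mean of `l`,
because `0 < l < 1`. After multiplication by `σ₁ ^ 2` this is positivity of the covariance
determinant. -/
theorem covChild_sq_lt : covChild σ₁ β ^ 2 < meanChild σ₁ β - meanChild σ₁ β ^ 2 := by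
  set E := meanChild σ₁ β with hE
  set A := covChild σ₁ β with hA
  set l : ℝ → ℝ := fun s => (logistic (β * σ₁ * s) : ℝ) with hl
  have i0 : Integrable (fun _ : ℝ => (1 : ℝ)) (gaussianReal 0 1) := integrable_const 1
  have i1 : Integrable l (gaussianReal 0 1) := by
    simpa using integrable_logistic_mul i0 (β * σ₁)
  have i2 : Integrable (fun s => l s * s) (gaussianReal 0 1) :=
    integrable_logistic_mul integrable_id_standard (β * σ₁)
  have i3 : Integrable (fun s => l s * l s) (gaussianReal 0 1) :=
    integrable_logistic_mul i1 (β * σ₁)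
  have i4 : Integrable (fun s => l s * (1 - l s)) (gaussianReal 0 1) :=
    integrable_logistic_mul (i0.sub i1) (β * σ₁)
  have hpos : 0 < ∫ s, l s * (1 - l s) ∂(gaussianReal 0 1) := by
    have hp : ∀ s, 0 < l s * (1 - l s) := fun s =>
      mul_pos (logistic_pos _) (sub_pos.2 (logistic_lt_one _))
    rw [integral_pos_iff_support_of_nonneg (fun s => (hp s).le) i4]
    have : Function.support (fun s => l s * (1 - l s)) = Set.univ := by
      ext s; simpa using (hp s).ne'
    rw [this, measure_univ]
    exact one_pos
  have hsub : ∫ s, l s * (1 - l s) ∂(gaussianReal 0 1) = E - ∫ s, l s * l s ∂(gaussianReal 0 1) := by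
    rw [hE, meanChild, ← integral_sub i1 i3]
    exact integral_congr_ae (ae_of_all _ fun s => by simp only [hl]; ring)
  have hsq : 0 ≤ ∫ s, (l s - E - A * s) ^ 2 ∂(gaussianReal 0 1) :=
    integral_nonneg fun s => sq_nonneg _
  have hexp : ∫ s, (l s - E - A * s) ^ 2 ∂(gaussianReal 0 1)
      = ∫ s, l s * l s ∂(gaussianReal 0 1) - 2 * E * ∫ s, l s ∂(gaussianReal 0 1)
        - 2 * A * ∫ s, l s * s ∂(gaussianReal 0 1) + E ^ 2
        + 2 * E * A * ∫ s, s ∂(gaussianReal 0 1) + A ^ 2 * ∫ s, s ^ 2 ∂(gaussianReal 0 1) := by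
    have e : ∀ s, (l s - E - A * s) ^ 2 = l s * l s - 2 * E * l s - 2 * A * (l s * s) + E ^ 2
        + 2 * E * A * s + A ^ 2 * s ^ 2 := fun s => by ring
    simp_rw [e]
    have j1 := i1.const_mul (2 * E)
    have j2 := i2.const_mul (2 * A)
    have j3 := integrable_id_standard.const_mul (2 * E * A)
    have j4 := integrable_sq_standard.const_mul (A ^ 2)
    have j5 : Integrable (fun _ : ℝ => E ^ 2) (gaussianReal 0 1) := integrable_const _
    have k1 : Integrable (fun s => l s * l s - 2 * E * l s) (gaussianReal 0 1) := i3.sub j1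
    have k2 : Integrable (fun s => l s * l s - 2 * E * l s - 2 * A * (l s * s))
      (gaussianReal 0 1) := k1.sub j2
    have k3 : Integrable (fun s => l s * l s - 2 * E * l s - 2 * A * (l s * s) + E ^ 2)
      (gaussianReal 0 1) := k2.add j5
    have k4 : Integrable (fun s => l s * l s - 2 * E * l s - 2 * A * (l s * s) + E ^ 2
      + 2 * E * A * s) (gaussianReal 0 1) := k3.add j3
    rw [integral_add k4 j4, integral_add k3 j3, integral_add k2 j5, integral_sub k1 j2,
      integral_sub i3 j1, integral_const_mul, integral_const_mul, integral_const_mul,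
      integral_const_mul]
    simp
  rw [integral_id_gaussianReal, integral_sq_standard, ← covChild.eq_def, ← meanChild.eq_def,
    ← hE, ← hA] at hexp
  nlinarith

theorem integral_parent : ∫ z, z 0 ∂((scdLaw μ₁ σ₁ β).map asReal) = μ₁ := by
  refine (integral_bgeFeature μ₁ σ₁ β 3).trans ?_
  have e : ∀ s : ℝ, (logistic (β * σ₁ * s) : ℝ) * bgeFeature 3 ![μ₁ + σ₁ * s, 1]
      + (1 - logistic (β * σ₁ * s)) * bgeFeature 3 ![μ₁ + σ₁ * s, 0] = μ₁ + σ₁ * s := fun s => by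
    simp [bgeFeature]; ring
  simp_rw [e]
  rw [integral_add (integrable_const _) (integrable_id_standard.const_mul _), integral_const_mul,
    integral_id_gaussianReal]
  simp

theorem integral_child :
    ∫ z, z 1 ∂((scdLaw μ₁ σ₁ β).map asReal) = meanChild σ₁ β := by
  refine (integral_bgeFeature μ₁ σ₁ β 4).trans ?_
  simp [bgeFeature, meanChild]

theorem integral_child_sq :
    ∫ z, z 1 * z 1 ∂((scdLaw μ₁ σ₁ β).map asReal) = meanChild σ₁ β := by
  refine (integral_bgeFeature μ₁ σ₁ β 2).trans ?_
  simp [bgeFeature, meanChild]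

theorem integral_parent_sq :
    ∫ z, z 0 * z 0 ∂((scdLaw μ₁ σ₁ β).map asReal) = μ₁ * μ₁ + σ₁ ^ 2 := by
  refine (integral_bgeFeature μ₁ σ₁ β 0).trans ?_
  have e : ∀ s : ℝ, (logistic (β * σ₁ * s) : ℝ) * bgeFeature 0 ![μ₁ + σ₁ * s, 1]
      + (1 - logistic (β * σ₁ * s)) * bgeFeature 0 ![μ₁ + σ₁ * s, 0]
      = μ₁ * μ₁ + 2 * μ₁ * σ₁ * s + σ₁ ^ 2 * s ^ 2 := fun s => by
    simp [bgeFeature]; ring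
  have j1 := integrable_id_standard.const_mul (2 * μ₁ * σ₁)
  have j2 := integrable_sq_standard.const_mul (σ₁ ^ 2)
  have j0 : Integrable (fun _ : ℝ => μ₁ * μ₁) (gaussianReal 0 1) := integrable_const _
  have k1 : Integrable (fun s => μ₁ * μ₁ + 2 * μ₁ * σ₁ * s) (gaussianReal 0 1) := j0.add j1
  simp_rw [e]
  rw [integral_add k1 j2, integral_add j0 j1, integral_const,
    integral_const_mul (2 * μ₁ * σ₁) fun s : ℝ => s, integral_const_mul,
    integral_id_gaussianReal, integral_sq_standard]
  simp

theorem integral_parent_mul_child :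
    ∫ z, z 0 * z 1 ∂((scdLaw μ₁ σ₁ β).map asReal)
      = μ₁ * meanChild σ₁ β + σ₁ * covChild σ₁ β := by
  refine (integral_bgeFeature μ₁ σ₁ β 1).trans ?_
  have i1 : Integrable (fun s => (logistic (β * σ₁ * s) : ℝ)) (gaussianReal 0 1) := by
    simpa using integrable_logistic_mul (integrable_const (1 : ℝ)) (β * σ₁)
  have e : ∀ s : ℝ, (logistic (β * σ₁ * s) : ℝ) * bgeFeature 1 ![μ₁ + σ₁ * s, 1]
      + (1 - logistic (β * σ₁ * s)) * bgeFeature 1 ![μ₁ + σ₁ * s, 0]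
      = μ₁ * (logistic (β * σ₁ * s) : ℝ) + σ₁ * ((logistic (β * σ₁ * s) : ℝ) * s) := fun s => by
    simp [bgeFeature]; ring
  simp_rw [e]
  rw [integral_add (i1.const_mul _) ((integrable_logistic_mul integrable_id_standard _).const_mul _),
    integral_const_mul, integral_const_mul, meanChild, covChild]

theorem covMatrix_apply (i j : Fin 2) :
    covMatrix ((scdLaw μ₁ σ₁ β).map asReal) i j
      = ∫ z, z i * z j ∂((scdLaw μ₁ σ₁ β).map asReal)
        - (∫ z, z i ∂((scdLaw μ₁ σ₁ β).map asReal)) * ∫ z, z j ∂((scdLaw μ₁ σ₁ β).map asReal) := by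
  have : IsProbabilityMeasure ((scdLaw μ₁ σ₁ β).map asReal) :=
    Measure.isProbabilityMeasure_map measurable_asReal.aemeasurable
  have h : ∀ i : Fin 2, MemLp (fun z : Fin 2 → ℝ => z i) 2 ((scdLaw μ₁ σ₁ β).map asReal) := by
    intro i
    fin_cases i
    · exact memLp_bgeFeature μ₁ σ₁ β 3
    · exact memLp_bgeFeature μ₁ σ₁ β 4
  exact covariance_eq_sub (h i) (h j)

end Moments

/-! ### The discretized law -/

theorem gaussianReal_standard_real_Ici : (gaussianReal 0 1).real (Set.Ici 0) = 1 / 2 := by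
  have hnull := nullSingletonClass_gaussianReal (μ := 0) (v := 1) one_ne_zero
  have h1 : (gaussianReal 0 1).real (Set.Ici 0) = (gaussianReal 0 1).real (Set.Iic 0) := by
    have h := gaussianReal_map_neg (μ := 0) (v := 1)
    rw [neg_zero] at h
    conv_lhs => rw [← h]
    rw [map_measureReal_apply (by fun_prop) measurableSet_Ici]
    congr 1
    ext s; simp
  have h2 : (gaussianReal 0 1).real (Set.Iic 0) = (gaussianReal 0 1).real (Set.Iio 0) :=
    measureReal_congr Iio_ae_eq_Iic.symm
  have h3 := probReal_compl_eq_one_sub (μ := gaussianReal 0 1) (measurableSet_Ici (a := (0 : ℝ)))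
  rw [Set.compl_Ici] at h3
  linarith

/-- A median other than `μ₁` would leave an open interval between the two; it has positive Gaussian
mass, which pushes one half line below mass `1 / 2`. -/
theorem eq_of_isMedian {μ₁ σ₁ m : ℝ} (hσ₁ : 0 < σ₁)
    (h : IsMedian (gaussianReal μ₁ (σ₁ ^ 2).toNNReal) m) : m = μ₁ := by
  have hv : (σ₁ ^ 2).toNNReal ≠ 0 := by simpa using hσ₁.ne'
  set γ := gaussianReal μ₁ (σ₁ ^ 2).toNNReal with hγ
  have hnull := nullSingletonClass_gaussianReal (μ := μ₁) hv
  have hIci : γ.real (Set.Ici μ₁) = 1 / 2 := by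
    rw [hγ, ← map_gaussianReal_standard μ₁, map_measureReal_apply (by fun_prop) measurableSet_Ici,
      ← gaussianReal_standard_real_Ici]
    congr 1
    ext s
    simp only [Set.mem_preimage, Set.mem_Ici, le_add_iff_nonneg_right]
    exact ⟨fun h => nonneg_of_mul_nonneg_right h hσ₁, fun h => mul_nonneg hσ₁.le h⟩
  have hIic : γ.real (Set.Iic μ₁) = 1 / 2 := by
    have h3 := probReal_compl_eq_one_sub (μ := γ) (measurableSet_Ici (a := μ₁))
    rw [Set.compl_Ici] at h3
    have h2 : γ.real (Set.Iio μ₁) = γ.real (Set.Iic μ₁) := measureReal_congr Iio_ae_eq_Iic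
    linarith
  have hpos : ∀ {a b : ℝ}, a < b → 0 < γ.real (Set.Ioo a b) := by
    intro a b hab
    refine ENNReal.toReal_pos (fun h0 => ?_) (measure_ne_top _ _)
    have := gaussianReal_absolutelyContinuous' μ₁ hv h0
    simp [hab.not_ge] at this
  rcases lt_trichotomy m μ₁ with hlt | heq | hgt
  · exfalso
    have hd : Disjoint (Set.Iic m) (Set.Ioo m μ₁) :=
      Set.disjoint_left.2 fun x hx hx' => (not_lt.2 hx) hx'.1
    have hle : γ.real (Set.Iic m ∪ Set.Ioo m μ₁) ≤ γ.real (Set.Iic μ₁) := by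
      refine measureReal_mono ?_
      rintro x (hx | hx)
      · exact le_trans hx hlt.le
      · exact hx.2.le
    rw [measureReal_union hd measurableSet_Ioo, hIic] at hle
    linarith [h.1, hpos hlt]
  · exact heq
  · exfalso
    have hd : Disjoint (Set.Ici m) (Set.Ioo μ₁ m) :=
      Set.disjoint_left.2 fun x hx hx' => (not_lt.2 hx) hx'.2
    have hle : γ.real (Set.Ici m ∪ Set.Ioo μ₁ m) ≤ γ.real (Set.Ici μ₁) := by
      refine measureReal_mono ?_
      rintro x (hx | hx)
      · exact le_trans hgt.le hx
      · exact hx.1.le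
    rw [measureReal_union hd measurableSet_Ioo, hIci] at hle
    linarith [h.2, hpos hgt]

/-- `P(X₁' = 1, X₂' = 1)`. -/
noncomputable def jointSuccess (σ₁ β : ℝ) : ℝ :=
  ∫ s in Set.Ici (0 : ℝ), (logistic (β * σ₁ * s) : ℝ) ∂(gaussianReal 0 1)

theorem setIntegral_one_sub_logistic (σ₁ β : ℝ) :
    ∫ s in Set.Ici (0 : ℝ), (1 - logistic (β * σ₁ * s) : ℝ) ∂(gaussianReal 0 1)
      = 1 / 2 - jointSuccess σ₁ β := by
  have i1 : Integrable (fun s => (logistic (β * σ₁ * s) : ℝ)) (gaussianReal 0 1) := by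
    simpa using integrable_logistic_mul (integrable_const (1 : ℝ)) (β * σ₁)
  rw [integral_sub (integrable_const _) i1.integrableOn, jointSuccess, setIntegral_const,
    gaussianReal_standard_real_Ici]
  simp

theorem setIntegral_Iio_eq (f : ℝ → ℝ) :
    ∫ s in Set.Iio (0 : ℝ), f s ∂(gaussianReal 0 1)
      = ∫ s in Set.Ici (0 : ℝ), f (-s) ∂(gaussianReal 0 1) := by
  have hnull := nullSingletonClass_gaussianReal (μ := 0) (v := 1) one_ne_zero
  have h := gaussianReal_map_neg (μ := 0) (v := 1)
  rw [neg_zero] at h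
  conv_lhs => rw [← h]
  have he : MeasurableEmbedding fun x : ℝ => -x := (MeasurableEquiv.neg ℝ).measurableEmbedding
  rw [he.setIntegral_map]
  rw [setIntegral_congr_set (s := Set.Ici (0 : ℝ)) (t := Set.Ioi 0) Ioi_ae_eq_Ici.symm]
  congr 2
  ext s; simp

theorem setIntegral_Ici_pos {f : ℝ → ℝ} (hf : ∀ s, 0 < f s)
    (hi : Integrable f (gaussianReal 0 1)) :
    0 < ∫ s in Set.Ici (0 : ℝ), f s ∂(gaussianReal 0 1) := by
  rw [setIntegral_pos_iff_support_of_nonneg_ae (ae_of_all _ fun s => (hf s).le) hi.integrableOn]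
  have : Function.support f = Set.univ := by ext s; simpa using (hf s).ne'
  rw [this, Set.univ_inter]
  have h := gaussianReal_standard_real_Ici
  by_contra h0
  rw [measureReal_def, nonpos_iff_eq_zero.1 (not_lt.1 h0)] at h
  norm_num at h

theorem jointSuccess_mem (σ₁ β : ℝ) : 0 < jointSuccess σ₁ β ∧ jointSuccess σ₁ β < 1 / 2 := by
  have i1 : Integrable (fun s => (logistic (β * σ₁ * s) : ℝ)) (gaussianReal 0 1) := by
    simpa using integrable_logistic_mul (integrable_const (1 : ℝ)) (β * σ₁)
  refine ⟨setIntegral_Ici_pos (fun s => logistic_pos _) i1, ?_⟩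
  have h := setIntegral_Ici_pos (f := fun s => (1 - logistic (β * σ₁ * s) : ℝ))
    (fun s => sub_pos.2 (logistic_lt_one _)) ((integrable_const _).sub i1)
  rw [setIntegral_one_sub_logistic] at h
  linarith

theorem map_discretize_real {μ₁ σ₁ β : ℝ} (hσ₁ : 0 < σ₁) (c : Bool × Bool) :
    ((scdLaw μ₁ σ₁ β).map (discretize μ₁)).real {c}
      = ∫ s, (if decide (0 ≤ s) = c.1 then
          (if c.2 then (logistic (β * σ₁ * s) : ℝ) else 1 - logistic (β * σ₁ * s)) else 0)
        ∂(gaussianReal 0 1) := by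
  have hms : MeasurableSet (discretize μ₁ ⁻¹' {c}) :=
    measurable_discretize μ₁ (MeasurableSet.singleton c)
  have hm : Measurable ((discretize μ₁ ⁻¹' {c}).indicator (1 : ℝ × Bool → ℝ)) :=
    measurable_one.indicator hms
  rw [map_measureReal_apply (measurable_discretize μ₁) (MeasurableSet.singleton c),
    ← integral_indicator_one hms, integral_scdLaw hm ((integrable_const (1 : ℝ)).indicator hms)]
  have hind : ∀ z, (discretize μ₁ ⁻¹' {c}).indicator (1 : ℝ × Bool → ℝ) z
      = if discretize μ₁ z = c then 1 else 0 := fun z => by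
    by_cases h : discretize μ₁ z = c
    · rw [Set.indicator_of_mem (show z ∈ discretize μ₁ ⁻¹' {c} from h), if_pos h, Pi.one_apply]
    · rw [Set.indicator_of_notMem (show z ∉ discretize μ₁ ⁻¹' {c} from h), if_neg h]
  simp_rw [hind]
  refine integral_congr_ae (ae_of_all _ fun s => ?_)
  have hs : decide (μ₁ ≤ μ₁ + σ₁ * s) = decide (0 ≤ s) := by
    congr 1
    rw [le_add_iff_nonneg_right]
    exact propext ⟨fun h => nonneg_of_mul_nonneg_right h hσ₁, fun h => mul_nonneg hσ₁.le h⟩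
  obtain ⟨c₁, c₂⟩ := c
  simp only [discretize, hs, Prod.mk.injEq]
  by_cases h1 : decide (0 ≤ s) = c₁ <;> cases c₂ <;> simp [h1]

/-- On the negative half line the reflection `s ↦ -s` exchanges success and failure of the child, so
the lower row of the table is the upper row reversed; each row has mass `1 / 2`. -/
theorem map_discretize_cells {μ₁ σ₁ β : ℝ} (hσ₁ : 0 < σ₁) :
    ((scdLaw μ₁ σ₁ β).map (discretize μ₁)).real {(true, true)} = jointSuccess σ₁ β
      ∧ ((scdLaw μ₁ σ₁ β).map (discretize μ₁)).real {(true, false)} = 1 / 2 - jointSuccess σ₁ β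
      ∧ ((scdLaw μ₁ σ₁ β).map (discretize μ₁)).real {(false, true)} = 1 / 2 - jointSuccess σ₁ β
      ∧ ((scdLaw μ₁ σ₁ β).map (discretize μ₁)).real {(false, false)} = jointSuccess σ₁ β := by
  have hpos : ∀ f : ℝ → ℝ, ∫ s, (if decide (0 ≤ s) = true then f s else 0) ∂(gaussianReal 0 1)
      = ∫ s in Set.Ici (0 : ℝ), f s ∂(gaussianReal 0 1) := fun f => by
    rw [← integral_indicator measurableSet_Ici]
    refine integral_congr_ae (ae_of_all _ fun s => ?_)
    simp [Set.indicator_apply]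
  have hneg : ∀ f : ℝ → ℝ, ∫ s, (if decide (0 ≤ s) = false then f s else 0) ∂(gaussianReal 0 1)
      = ∫ s in Set.Ici (0 : ℝ), f (-s) ∂(gaussianReal 0 1) := fun f => by
    rw [← setIntegral_Iio_eq, ← integral_indicator measurableSet_Iio]
    refine integral_congr_ae (ae_of_all _ fun s => ?_)
    simp [Set.indicator_apply]
  refine ⟨?_, ?_, ?_, ?_⟩
  · rw [map_discretize_real hσ₁, hpos]
    simp [jointSuccess]
  · rw [map_discretize_real hσ₁, hpos]
    simpa using setIntegral_one_sub_logistic σ₁ β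
  · rw [map_discretize_real hσ₁, hneg]
    simp only [mul_neg, logistic_neg]
    simpa using setIntegral_one_sub_logistic σ₁ β
  · rw [map_discretize_real hσ₁, hneg]
    simp only [mul_neg, logistic_neg]
    simp [jointSuccess]

theorem jointSuccess_eq (σ₁ β : ℝ) :
    jointSuccess σ₁ β = ∫ x in Set.Ioi (0 : ℝ), 1 / √(2 * π) * exp (-(x ^ 2 / 2))
      * (exp (β * x * σ₁) / (1 + exp (β * x * σ₁))) := by
  rw [jointSuccess, ← integral_indicator measurableSet_Ici, integral_gaussianReal_standard,
    ← integral_Ici_eq_integral_Ioi, ← integral_indicator measurableSet_Ici]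
  refine integral_congr_ae (ae_of_all _ fun s => ?_)
  by_cases hs : s ∈ Set.Ici (0 : ℝ)
  · simp only [Set.indicator_of_mem hs, logistic]
    rw [show β * s * σ₁ = β * σ₁ * s by ring]
    ring
  · simp only [Set.indicator_of_notMem hs]
    ring

theorem meanChild_eq (σ₁ β : ℝ) :
    meanChild σ₁ β = ∫ s : ℝ, 1 / √(2 * π)
      * (exp (β * σ₁ * s) / (1 + exp (β * σ₁ * s))) * exp (-(s ^ 2 / 2)) :=
  integral_gaussianReal_standard _

theorem mul_covChild_eq (σ₁ β : ℝ) :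
    σ₁ * covChild σ₁ β = ∫ s : ℝ, s * σ₁ / √(2 * π)
      * (exp (β * σ₁ * s) / (1 + exp (β * σ₁ * s))) * exp (-(s ^ 2 / 2)) := by
  rw [covChild, integral_gaussianReal_standard, ← integral_const_mul]
  refine integral_congr_ae (ae_of_all _ fun s => ?_)
  simp only [logistic]
  ring

end HybridBN

/-! ### Both limits for the Gaussian parent with a logistic child -/

theorem theorem2
    (μ₁ σ₁ β : ℝ) (hσ₁ : 0 < σ₁)
    (structPrior : HybridBN.TwoNodeDAG → ℝ) (hprior : ∀ G, 0 < structPrior G)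
    (t αμ αw : ℝ) (ht : 0 < t) (hαμ : 0 < αμ) (hαw : 3 < αw)
    (α : Fin 4 → ℝ) (hα : ∀ i, 0 < α i)
    (P : Measure (ℝ × Bool)) (hP : P = HybridBN.scdLaw μ₁ σ₁ β)
    (m : ℝ) (hm : HybridBN.IsMedian (P.map Prod.fst) m)
    (S : Matrix (Fin 2) (Fin 2) ℝ) (hS : S = HybridBN.covMatrix (P.map HybridBN.asReal))
    (E₂ : ℝ) (hE₂ : E₂ = ∫ x, x 1 ∂(P.map HybridBN.asReal))
    (p₁₁ : ℝ) (hp₁₁ : p₁₁ = (P.map (HybridBN.discretize m)).real {(true, true)}) :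
    -- RAG
    (S 0 0 = σ₁ ^ 2
      ∧ S 0 1 = ∫ s : ℝ, s * σ₁ / √(2 * π)
          * (exp (β * σ₁ * s) / (1 + exp (β * σ₁ * s))) * exp (-(s ^ 2 / 2))
      ∧ E₂ = ∫ s : ℝ, 1 / √(2 * π)
          * (exp (β * σ₁ * s) / (1 + exp (β * σ₁ * s))) * exp (-(s ^ 2 / 2))
      ∧ S 1 1 = E₂ - E₂ ^ 2
      ∧ 0 < S 0 0 * S 1 1 - S 0 1 ^ 2
      ∧ (∀ N : ℕ, Integrable
          (fun x : Fin N → Fin 2 → ℝ =>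
            HybridBN.logPosteriorRatio structPrior (HybridBN.bgeMarginal t αμ αw x))
          (Measure.pi fun _ : Fin N => P.map HybridBN.asReal))
      ∧ Tendsto (HybridBN.rBGe structPrior t αμ αw (P.map HybridBN.asReal)) atTop
          (𝓝 (1 / 2 * log (S 0 0 * S 1 1 / (S 0 0 * S 1 1 - S 0 1 ^ 2)))))
    ∧
    -- DISC
    (p₁₁ = ∫ x in Set.Ioi (0 : ℝ), 1 / √(2 * π) * exp (-(x ^ 2 / 2))
          * (exp (β * x * σ₁) / (1 + exp (β * x * σ₁)))
      ∧ 0 < p₁₁ ∧ p₁₁ < 1 / 2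
      ∧ Tendsto (HybridBN.rBDe structPrior α (P.map (HybridBN.discretize m))) atTop
          (𝓝 (log 4 + 2 * p₁₁ * log p₁₁ + (1 - 2 * p₁₁) * log (1 / 2 - p₁₁)))) := by
  subst hP hS hE₂ hp₁₁
  rw [HybridBN.map_fst_scdLaw] at hm
  -- From here on `m` stands for the mean `μ₁` as well, so the cut is at the centre of the parent
  -- law.
  obtain rfl := HybridBN.eq_of_isMedian hσ₁ hm
  have : IsProbabilityMeasure ((HybridBN.scdLaw m σ₁ β).map HybridBN.asReal) :=
    Measure.isProbabilityMeasure_map HybridBN.measurable_asReal.aemeasurable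
  have : IsProbabilityMeasure ((HybridBN.scdLaw m σ₁ β).map (HybridBN.discretize m)) :=
    Measure.isProbabilityMeasure_map (HybridBN.measurable_discretize m).aemeasurable
  have hcov := HybridBN.covMatrix_apply m σ₁ β
  have h00 : HybridBN.covMatrix ((HybridBN.scdLaw m σ₁ β).map HybridBN.asReal) 0 0 = σ₁ ^ 2 := by
    rw [hcov, HybridBN.integral_parent_sq, HybridBN.integral_parent]
    ring
  have h01 : HybridBN.covMatrix ((HybridBN.scdLaw m σ₁ β).map HybridBN.asReal) 0 1
      = σ₁ * HybridBN.covChild σ₁ β := by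
    rw [hcov, HybridBN.integral_parent_mul_child, HybridBN.integral_parent,
      HybridBN.integral_child]
    ring
  have h11 : HybridBN.covMatrix ((HybridBN.scdLaw m σ₁ β).map HybridBN.asReal) 1 1
      = HybridBN.meanChild σ₁ β - HybridBN.meanChild σ₁ β ^ 2 := by
    rw [hcov, HybridBN.integral_child_sq, HybridBN.integral_child]
    ring
  have hlt := HybridBN.covChild_sq_lt σ₁ β
  have hd : 0 < σ₁ ^ 2 * (HybridBN.meanChild σ₁ β - HybridBN.meanChild σ₁ β ^ 2)
      - (σ₁ * HybridBN.covChild σ₁ β) ^ 2 := by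
    rw [mul_pow, ← mul_sub]
    exact mul_pos (pow_pos hσ₁ 2) (sub_pos.2 hlt)
  obtain ⟨hint, hlim⟩ := HybridBN.tendsto_rBGe hprior ht hαμ hαw
    ((HybridBN.scdLaw m σ₁ β).map HybridBN.asReal) (HybridBN.memLp_bgeFeature m σ₁ β)
    (hcov 0 0) (hcov 0 1) (hcov 1 1) (h00 ▸ pow_pos hσ₁ 2)
    (h11 ▸ (sq_nonneg _).trans_lt hlt) (by rwa [h00, h01, h11])
  obtain ⟨c11, c10, c01, c00⟩ := HybridBN.map_discretize_cells (μ₁ := m) (β := β) hσ₁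
  refine ⟨⟨h00, h01.trans (HybridBN.mul_covChild_eq σ₁ β), ?_, ?_, ?_, hint, hlim⟩,
    c11.trans (HybridBN.jointSuccess_eq σ₁ β), ?_, ?_, ?_⟩
  · rw [HybridBN.integral_child, HybridBN.meanChild_eq]
  · rw [h11, HybridBN.integral_child]
  · rwa [h00, h01, h11]
  · rw [c11]
    exact (HybridBN.jointSuccess_mem σ₁ β).1
  · rw [c11]
    exact (HybridBN.jointSuccess_mem σ₁ β).2
  · rw [c11, ← HybridBN.mutualInfo_eq_of_symmetric
      (m := fun c => ((HybridBN.scdLaw m σ₁ β).map (HybridBN.discretize m)).real {c})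
      c11 c10 c01 c00]
    exact HybridBN.tendsto_rBDe hprior hα _
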